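/- Let $G=\{1,\sigma\}$ be the group of order two and let $X$ be a Real space, i.e. a (Hausdorff) CW complex with a continuous involution $\sigma$. A Real vector bundle on $X$ is a complex vector bundle $E$ (of finite, locally constant rank) with a continuous involution $\sigma$ covering the involution of $X$ and $\mathbb C$-antilinear on the fibres; $KR(X)$ is the Grothendieck ring of Real vector bundles on $X$ (under $\oplus$ and $\otimes_{\mathbb C}$), and $KO_G(X)$ is the Grothendieck ring of $G$-equivariant real vector bundles on $X$ (under $\oplus$ and $\otimes_{\mathbb R}$). The dual $E^*$ of a Real bundle carries the involution $(\sigma\phi)(u)=\overline{\phi(\sigma u)}$. A Real symmetric form $(E,\varphi)$ is a Real bundle $E$ with an isomorphism of Real bundles $\varphi:E\to E^*$ such that $\varphi=\varphi^*$. The hyperbolic form $H(L)$ is $L\oplus L^*$ with the form $\bigl((u,f),(v,g)\bigr)\mapsto f(v)+g(u)$. The Grothendieck-Witt ring $GR(X)$ is the Grothendieck ring of isometry classes of Real symmetric forms (under orthogonal sum and tensor product) modulo the relations $[E,\varphi]=[H(L)]$ for every Real subbundle $L\subseteq E$ with $L=L^\perp$; the subgroup generated by these relations is an ideal. Every $G$-equivariant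 real vector bundle $F$ on $X$ has a $G$-invariant Riemannian metric. There is a ring isomorphism $$\psi: KO_G(X)\xrightarrow{\ \cong\ } GR(X)$$ such that, for every $F$ and every $G$-invariant metric $\theta$ on $F$, $\psi[F]=[\mathbb C\otimes_{\mathbb R} F,\theta_{\mathbb C}]$, where $\sigma(c\otimes v)=\bar c\otimes\sigma(v)$ and $\theta_{\mathbb C}$ is the $\mathbb C$-bilinear extension of $\theta$. The forgetful map $GR(X)\to KR(X)$, $[E,\varphi]\mapsto[E]$, is well defined, and its composition with $\psi$ is the complexification map $KO_G(X)\to KR(X)$, $[F]\mapsto[\mathbb C\otimes_{\mathbb R} F]$. The hyperbolic map $KR(X)\to GR(X)$, $[E]\mapsto[H(E)]$, is the composition of $\psi$ with the map $KR(X)\to KO_G(X)$ which sends a Real bundle to its underlying real vector bundle with the induced action of $G$. -/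

import Mathlib

namespace RealK

open Bundle Set Topology
open scoped TensorProduct

universe u w

noncomputable section

/-- An involution on a topological space, i.e. a continuous action of the group of order two. -/
class Involution (X : Type u) [TopologicalSpace X] where
  tau : X → X
  continuous_tau : Continuous tau
  tau_tau : ∀ x, tau (tau x) = x

open Involution (tau continuous_tau tau_tau)

variable {𝕜 : Type} [RCLike 𝕜] {X : Type u} [TopologicalSpace X]

/-- A topological `𝕜`-vector bundle of finite rank (the rank may depend on the point): a family of
vector spaces with a topology on the total space which is locally trivial, linearly on fibres. -/
structure VecBundle (𝕜 : Type) [RCLike 𝕜] (X : Type u) [TopologicalSpace X] where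
  Fib : X → Type
  [addCommGroup : ∀ x, AddCommGroup (Fib x)]
  [module : ∀ x, Module 𝕜 (Fib x)]
  [topology : TopologicalSpace (TotalSpace Unit Fib)]
  locallyTrivial : ∀ x, ∃ (n : ℕ)
    (e : Trivialization (Fin n → 𝕜) (TotalSpace.proj : TotalSpace Unit Fib → X)),
      x ∈ e.baseSet ∧ ∀ y ∈ e.baseSet, IsLinearMap 𝕜 (fun v : Fib y => (e ⟨y, v⟩).2)

attribute [instance] VecBundle.addCommGroup VecBundle.module VecBundle.topology

/-- A finite family of sections of a family of vector spaces which is a basis of the fibre over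
each point of the open set `U`, together with the coordinates with respect to it. -/
structure Frame (𝕜 : Type) [RCLike 𝕜] {X : Type u} [TopologicalSpace X] (Fib : X → Type)
    [∀ x, AddCommGroup (Fib x)] [∀ x, Module 𝕜 (Fib x)] where
  U : Set X
  isOpen : IsOpen U
  ι : Type
  [fintype : Fintype ι]
  [dec : DecidableEq ι]
  vec : ι → ∀ y, Fib y
  coord : ι → ∀ y, Fib y →ₗ[𝕜] 𝕜
  coord_vec : ∀ y ∈ U, ∀ i j, coord i y (vec j y) = if i = j then 1 else 0
  sum_coord : ∀ y ∈ U, ∀ v, ∑ i, coord i y v • vec i y = v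

attribute [instance] Frame.fintype Frame.dec

namespace Frame

variable {Fib : X → Type} [∀ x, AddCommGroup (Fib x)] [∀ x, Module 𝕜 (Fib x)]

/-- The point of the total space with given coordinates. -/
def assemble (f : Frame 𝕜 Fib) (p : X × (f.ι → 𝕜)) : TotalSpace Unit Fib :=
  ⟨p.1, ∑ i, p.2 i • f.vec i p.1⟩

lemma coord_sum (f : Frame 𝕜 Fib) {y : X} (hy : y ∈ f.U) (c : f.ι → 𝕜) (i : f.ι) :
    f.coord i y (∑ j, c j • f.vec j y) = c i := by
  simp [map_sum, f.coord_vec y hy]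

/-- The frame is continuous for a given topology on the total space: it provides a local
trivialization. -/
def IsCont [TopologicalSpace (TotalSpace Unit Fib)] (f : Frame 𝕜 Fib) : Prop :=
  ContinuousOn f.assemble (f.U ×ˢ univ) ∧
    ∀ i, ContinuousOn (fun e : TotalSpace Unit Fib => f.coord i e.1 e.2) (TotalSpace.proj ⁻¹' f.U)

/-- The local trivialization given by a continuous frame. -/
def trivialization [TopologicalSpace (TotalSpace Unit Fib)] (f : Frame 𝕜 Fib) (hf : f.IsCont)
    (hp : Continuous (TotalSpace.proj : TotalSpace Unit Fib → X)) {n : ℕ} (r : f.ι ≃ Fin n) :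
    Trivialization (Fin n → 𝕜) (TotalSpace.proj : TotalSpace Unit Fib → X) where
  toFun e := (e.1, fun i => f.coord (r.symm i) e.1 e.2)
  invFun p := f.assemble (p.1, fun i => p.2 (r i))
  source := TotalSpace.proj ⁻¹' f.U
  target := f.U ×ˢ univ
  map_source' e he := ⟨he, trivial⟩
  map_target' p hp := hp.1
  left_inv' e he := by
    obtain ⟨y, v⟩ := e
    simp only [assemble, Equiv.symm_apply_apply]
    congr 1
    exact f.sum_coord y he v
  right_inv' p hp := by
    obtain ⟨y, c⟩ := p
    refine Prod.ext rfl ?_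
    funext i
    exact (f.coord_sum hp.1 (fun i => c (r i)) (r.symm i)).trans (by simp)
  open_source := f.isOpen.preimage hp
  open_target := f.isOpen.prod isOpen_univ
  continuousOn_toFun := by
    refine hp.continuousOn.prodMk (continuousOn_pi.2 fun i => hf.2 _)
  continuousOn_invFun := by
    refine hf.1.comp (t := f.U ×ˢ univ) (Continuous.continuousOn (by fun_prop)) ?_
    intro p hp
    exact ⟨hp.1, trivial⟩
  baseSet := f.U
  open_baseSet := f.isOpen
  source_eq := rfl
  target_eq := rfl
  proj_toFun _ _ := rfl

/-- The frame given by a fibrewise linear local trivialization. -/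
def ofTrivialization [TopologicalSpace (TotalSpace Unit Fib)] {n : ℕ}
    (e : Trivialization (Fin n → 𝕜) (TotalSpace.proj : TotalSpace Unit Fib → X))
    (he : ∀ y ∈ e.baseSet, IsLinearMap 𝕜 (fun v : Fib y => (e ⟨y, v⟩).2)) :
    {f : Frame 𝕜 Fib // f.IsCont ∧ f.U = e.baseSet} := by
  classical
  have hbij : ∀ y (hy : y ∈ e.baseSet), Function.Bijective (IsLinearMap.mk' _ (he y hy)) := by
    intro y hy
    constructor
    · intro v w h
      have h' : (e ⟨y, v⟩).2 = (e ⟨y, w⟩).2 := h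
      have h1 : e ⟨y, v⟩ = e ⟨y, w⟩ := by
        refine Prod.ext ?_ h'
        rw [e.coe_fst (by rw [e.source_eq]; exact hy), e.coe_fst (by rw [e.source_eq]; exact hy)]
      have h2 := e.injOn (by rw [e.source_eq]; exact hy) (by rw [e.source_eq]; exact hy) h1
      simpa using h2
    · intro c
      have hm : (y, c) ∈ e.target := by rw [e.target_eq]; exact ⟨hy, trivial⟩
      have h1 : (e.toOpenPartialHomeomorph.symm (y, c)).proj = y := e.proj_symm_apply hm
      have h2 : e (e.toOpenPartialHomeomorph.symm (y, c)) = (y, c) := e.apply_symm_apply hm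
      revert h1 h2
      generalize e.toOpenPartialHomeomorph.symm (y, c) = z
      rintro rfl h2
      exact ⟨z.2, congrArg Prod.snd h2⟩
  let L : ∀ y (hy : y ∈ e.baseSet), Fib y ≃ₗ[𝕜] (Fin n → 𝕜) := fun y hy =>
    LinearEquiv.ofBijective _ (hbij y hy)
  have hL : ∀ y hy v, L y hy v = (e ⟨y, v⟩).2 := fun y hy v => rfl
  let f : Frame 𝕜 Fib :=
    { U := e.baseSet
      isOpen := e.open_baseSet
      ι := Fin n
      vec := fun i y => if hy : y ∈ e.baseSet then (L y hy).symm (Pi.single i 1) else 0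
      coord := fun i y => if hy : y ∈ e.baseSet then
        (LinearMap.proj i) ∘ₗ (L y hy).toLinearMap else 0
      coord_vec := by
        intro y hy i j
        simp [hy, Pi.single_apply]
      sum_coord := by
        intro y hy v
        apply (L y hy).injective
        funext k
        simp [hy, map_sum, Pi.single_apply] }
  refine ⟨f, ⟨?_, ?_⟩, rfl⟩
  · have h1 : ContinuousOn e.toOpenPartialHomeomorph.symm (e.baseSet ×ˢ univ) := by
      have := e.toOpenPartialHomeomorph.continuousOn_symm
      rwa [e.target_eq] at this
    refine h1.congr ?_
    rintro ⟨y, c⟩ ⟨hy, -⟩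
    have hm : (y, c) ∈ e.target := by rw [e.target_eq]; exact ⟨hy, trivial⟩
    have hs : (f.assemble (y, c)) ∈ e.source := by rw [e.source_eq]; exact hy
    apply e.injOn hs (e.toOpenPartialHomeomorph.map_target hm)
    change e _ = e _
    rw [e.apply_symm_apply hm]
    refine Prod.ext ?_ ?_
    · rw [e.coe_fst hs]; rfl
    · change L y hy (∑ i, c i • f.vec i y) = c
      funext k
      simp [f, hy, map_sum, Pi.single_apply]
  · intro i
    have h1 : ContinuousOn (fun z => (e z).2 i) e.source :=
      (continuous_apply i).comp_continuousOn (continuous_snd.comp_continuousOn e.continuousOn_toFun)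
    rw [e.source_eq] at h1
    refine h1.congr ?_
    rintro ⟨y, v⟩ hy
    have hy' : y ∈ e.baseSet := hy
    simp [f, hy', hL]

/-- Two frames have continuous transition functions in one direction. -/
def Compat (f g : Frame 𝕜 Fib) : Prop :=
  ∀ k l, ContinuousOn (fun y => f.coord k y (g.vec l y)) (f.U ∩ g.U)

lemma IsCont.vec [TopologicalSpace (TotalSpace Unit Fib)] {g : Frame 𝕜 Fib} (hg : g.IsCont)
    (l : g.ι) : ContinuousOn (fun y => (⟨y, g.vec l y⟩ : TotalSpace Unit Fib)) g.U := by
  have h : ContinuousOn (fun y : X => (y, (Pi.single l (1 : 𝕜) : g.ι → 𝕜))) g.U :=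
    Continuous.continuousOn (by fun_prop)
  refine (hg.1.comp h fun y hy => ⟨hy, trivial⟩).congr ?_
  intro y hy
  simp [assemble, Pi.single_apply]

lemma IsCont.compat [TopologicalSpace (TotalSpace Unit Fib)] {f g : Frame 𝕜 Fib} (hf : f.IsCont)
    (hg : g.IsCont) : f.Compat g := by
  intro k l
  exact (hf.2 k).comp ((hg.vec l).mono inter_subset_right) fun y hy => hy.1

section Atlas

variable {I : Type w} (A : I → Frame 𝕜 Fib)

/-- The topology on the total space defined by an atlas of frames: the finest one for which all
the maps `U × 𝕜^ι → E` are continuous. -/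
@[reducible]
def atlasTopology : TopologicalSpace (TotalSpace Unit Fib) :=
  ⨆ i, TopologicalSpace.coinduced
    (fun p : ((A i).U ×ˢ univ : Set (X × ((A i).ι → 𝕜))) => (A i).assemble p) inferInstance

lemma isOpen_atlas {s : Set (TotalSpace Unit Fib)} : IsOpen[atlasTopology A] s ↔
    ∀ i, IsOpen ((A i).U ×ˢ univ ∩ (A i).assemble ⁻¹' s) := by
  rw [atlasTopology, isOpen_iSup_iff]
  refine forall_congr' fun i => ?_
  rw [isOpen_coinduced]
  have hU : IsOpen ((A i).U ×ˢ univ : Set (X × ((A i).ι → 𝕜))) := (A i).isOpen.prod isOpen_univ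
  rw [hU.isOpenEmbedding_subtypeVal.isOpen_iff_image_isOpen]
  have : Subtype.val '' ((fun p : ((A i).U ×ˢ univ : Set (X × ((A i).ι → 𝕜))) =>
      (A i).assemble p) ⁻¹' s) = (A i).U ×ˢ univ ∩ (A i).assemble ⁻¹' s := by
    ext p
    constructor
    · rintro ⟨q, hq, rfl⟩
      exact ⟨q.2, hq⟩
    · rintro ⟨h1, h2⟩
      exact ⟨⟨p, h1⟩, h2, rfl⟩
  rw [this]

lemma continuous_proj_atlas :
    @Continuous _ _ (atlasTopology A) _ (TotalSpace.proj : TotalSpace Unit Fib → X) := by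
  rw [atlasTopology, continuous_iSup_dom]
  intro i
  rw [continuous_coinduced_dom]
  exact continuous_fst.comp continuous_subtype_val

lemma isCont_atlas (hA : ∀ i j, (A i).Compat (A j)) (i : I) :
    @IsCont _ _ _ _ Fib _ _ (atlasTopology A) (A i) := by
  let := atlasTopology A
  refine ⟨?_, fun k => ?_⟩
  · exact (continuousOn_open_iff ((A i).isOpen.prod isOpen_univ)).2 fun s hs =>
      (isOpen_atlas A).1 hs i
  · have ho : IsOpen (TotalSpace.proj ⁻¹' (A i).U : Set (TotalSpace Unit Fib)) :=
      (A i).isOpen.preimage (continuous_proj_atlas A)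
    rw [continuousOn_open_iff ho]
    intro W hW
    rw [isOpen_atlas]
    intro j
    have hc : ContinuousOn (fun p : X × ((A j).ι → 𝕜) =>
        ∑ l, p.2 l * (A i).coord k p.1 ((A j).vec l p.1)) (((A i).U ∩ (A j).U) ×ˢ univ) := by
      refine continuousOn_finsetSum _ fun l _ => ContinuousOn.mul ?_ ?_
      · exact Continuous.continuousOn (by fun_prop)
      · exact (hA i j k l).comp continuousOn_fst fun p hp => hp.1
    have := hc.isOpen_inter_preimage (((A i).isOpen.inter (A j).isOpen).prod isOpen_univ) hW
    convert this using 1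
    ext p
    simp only [mem_inter_iff, mem_prod, mem_univ, and_true, mem_preimage, assemble, map_sum,
      map_smul, smul_eq_mul]
    tauto

end Atlas
end Frame

namespace VecBundle

/-- The vector bundle defined by a covering atlas of frames with continuous transition
functions. -/
@[reducible]
def ofAtlas (Fib : X → Type) [∀ x, AddCommGroup (Fib x)] [∀ x, Module 𝕜 (Fib x)] {I : Type w}
    (A : I → Frame 𝕜 Fib) (cover : ∀ x, ∃ i, x ∈ (A i).U)
    (compat : ∀ i j, (A i).Compat (A j)) : VecBundle 𝕜 X where
  Fib := Fib
  topology := Frame.atlasTopology A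
  locallyTrivial x := by
    let := Frame.atlasTopology A
    obtain ⟨i, hi⟩ := cover x
    refine ⟨_, (A i).trivialization (Frame.isCont_atlas A compat i)
      (Frame.continuous_proj_atlas A) (Fintype.equivFin _), hi, fun y hy => ⟨?_, ?_⟩⟩
    · intro v w
      funext k
      exact map_add _ v w
    · intro c v
      funext k
      exact map_smul _ c v

variable (E F : VecBundle 𝕜 X)

/-- The continuous frames of a vector bundle. -/
abbrev CFrame := {f : Frame 𝕜 E.Fib // f.IsCont}

lemma exists_cframe (x : X) : ∃ f : E.CFrame, x ∈ f.1.U := by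
  obtain ⟨n, e, hx, he⟩ := E.locallyTrivial x
  obtain ⟨f, hf, hU⟩ := Frame.ofTrivialization e he
  exact ⟨⟨f, hf⟩, hU ▸ hx⟩

lemma continuous_proj : Continuous (TotalSpace.proj : TotalSpace Unit E.Fib → X) := by
  rw [continuous_iff_continuousAt]
  intro z
  obtain ⟨n, e, hx, he⟩ := E.locallyTrivial z.proj
  have hz : z ∈ e.source := by rw [e.source_eq]; exact hx
  have h := (continuous_fst.comp_continuousOn e.continuousOn_toFun).continuousAt
    (e.open_source.mem_nhds hz)
  refine h.congr ?_
  filter_upwards [e.open_source.mem_nhds hz] with w hw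
  exact e.proj_toFun w hw

lemma finite (x : X) : Module.Finite 𝕜 (E.Fib x) := by
  obtain ⟨f, hf⟩ := E.exists_cframe x
  refine Module.Finite.of_surjective (Fintype.linearCombination 𝕜 (fun i => f.1.vec i x)) ?_
  intro v
  exact ⟨fun i => f.1.coord i x v, by
    simpa [Fintype.linearCombination_apply] using f.1.sum_coord x hf v⟩

variable {E F} in
/-- Continuity of a fibrewise semilinear map can be checked on matrix coefficients. -/
lemma continuous_of_coef {κ : 𝕜 →+* 𝕜} (hκ : Continuous κ) {t : X → X} (ht : Continuous t)
    (φ : ∀ x, E.Fib x →ₛₗ[κ] F.Fib (t x))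
    (h : ∀ x, ∃ (e : E.CFrame) (g : F.CFrame), x ∈ e.1.U ∧ t x ∈ g.1.U ∧
      ∀ k l, ContinuousOn (fun y => g.1.coord k (t y) (φ y (e.1.vec l y)))
        (e.1.U ∩ t ⁻¹' g.1.U)) :
    Continuous (fun z : TotalSpace Unit E.Fib => (⟨t z.1, φ z.1 z.2⟩ : TotalSpace Unit F.Fib)) := by
  rw [continuous_iff_continuousAt]
  intro z
  obtain ⟨e, g, he, hg, hc⟩ := h z.1
  set S : Set (TotalSpace Unit E.Fib) := TotalSpace.proj ⁻¹' (e.1.U ∩ t ⁻¹' g.1.U) with hS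
  have hSo : IsOpen S := (e.1.isOpen.inter (g.1.isOpen.preimage ht)).preimage E.continuous_proj
  have hz : z ∈ S := ⟨he, hg⟩
  have hcon : ContinuousOn (fun z : TotalSpace Unit E.Fib => g.1.assemble
      (t z.1, fun k => ∑ l, κ (e.1.coord l z.1 z.2) * g.1.coord k (t z.1) (φ z.1 (e.1.vec l z.1))))
      S := by
    refine g.2.1.comp (t := g.1.U ×ˢ univ) (ContinuousOn.prodMk ?_ (continuousOn_pi.2 fun k => ?_))
      fun w hw => ⟨hw.2, trivial⟩
    · exact (ht.comp E.continuous_proj).continuousOn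
    · refine continuousOn_finsetSum _ fun l _ => ContinuousOn.mul ?_ ?_
      · exact hκ.comp_continuousOn ((e.2.2 l).mono fun w hw => hw.1)
      · exact (hc k l).comp E.continuous_proj.continuousOn fun w hw => hw
  refine (hcon.congr ?_).continuousAt (hSo.mem_nhds hz)
  rintro ⟨y, v⟩ ⟨hy1, hy2⟩
  simp only [Frame.assemble]
  congr 1
  conv_lhs => rw [← e.1.sum_coord y hy1 v, ← g.1.sum_coord (t y) hy2 (φ y _)]
  refine Finset.sum_congr rfl fun k _ => ?_
  simp [map_sum]

variable {E F} in
lemma coef_of_continuous {κ : 𝕜 →+* 𝕜} {t : X → X}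
    (φ : ∀ x, E.Fib x →ₛₗ[κ] F.Fib (t x))
    (h : Continuous
      (fun z : TotalSpace Unit E.Fib => (⟨t z.1, φ z.1 z.2⟩ : TotalSpace Unit F.Fib)))
    (e : E.CFrame) (g : F.CFrame) (k : g.1.ι) (l : e.1.ι) :
    ContinuousOn (fun y => g.1.coord k (t y) (φ y (e.1.vec l y))) (e.1.U ∩ t ⁻¹' g.1.U) :=
  (g.2.2 k).comp (h.comp_continuousOn ((e.2.vec l).mono inter_subset_left)) fun _ hy => hy.2


variable {E F} in
lemma continuous_of_coef_id (φ : ∀ x, E.Fib x →ₗ[𝕜] F.Fib x)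
    (h : ∀ x, ∃ (e : E.CFrame) (g : F.CFrame), x ∈ e.1.U ∧ x ∈ g.1.U ∧
      ∀ k l, ContinuousOn (fun y => g.1.coord k y (φ y (e.1.vec l y))) (e.1.U ∩ g.1.U)) :
    Continuous (fun z : TotalSpace Unit E.Fib => (⟨z.1, φ z.1 z.2⟩ : TotalSpace Unit F.Fib)) :=
  continuous_of_coef (κ := RingHom.id 𝕜) (t := fun x => x) continuous_id continuous_id φ h

/-- A member of an atlas as a continuous frame of the associated bundle. -/
@[reducible]
def ofAtlasFrame {Fib : X → Type} [∀ x, AddCommGroup (Fib x)] [∀ x, Module 𝕜 (Fib x)] {I : Type w}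
    (A : I → Frame 𝕜 Fib) (cover : ∀ x, ∃ i, x ∈ (A i).U)
    (compat : ∀ i j, (A i).Compat (A j)) (i : I) : (ofAtlas Fib A cover compat).CFrame :=
  ⟨A i, Frame.isCont_atlas A compat i⟩

end VecBundle

namespace Frame

variable {V W : X → Type} [∀ x, AddCommGroup (V x)] [∀ x, Module 𝕜 (V x)]
  [∀ x, AddCommGroup (W x)] [∀ x, Module 𝕜 (W x)]

/-- Frame of a direct sum. -/
@[reducible]
def prod (f : Frame 𝕜 V) (g : Frame 𝕜 W) : Frame 𝕜 (fun x => V x × W x) where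
  U := f.U ∩ g.U
  isOpen := f.isOpen.inter g.isOpen
  ι := f.ι ⊕ g.ι
  vec := Sum.elim (fun i y => (f.vec i y, 0)) (fun j y => (0, g.vec j y))
  coord := Sum.elim (fun i y => f.coord i y ∘ₗ LinearMap.fst 𝕜 _ _)
    (fun j y => g.coord j y ∘ₗ LinearMap.snd 𝕜 _ _)
  coord_vec := by
    rintro y ⟨hf, hg⟩ (i | i) (j | j) <;> simp [f.coord_vec y hf, g.coord_vec y hg]
  sum_coord := by
    rintro y ⟨hf, hg⟩ ⟨v, w⟩
    simp only [Fintype.sum_sum_type, Sum.elim_inl, Sum.elim_inr, LinearMap.comp_apply,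
      LinearMap.fst_apply, LinearMap.snd_apply]
    refine Prod.ext ?_ ?_
    · simpa [Prod.fst_sum] using f.sum_coord y hf v
    · simpa [Prod.snd_sum] using g.sum_coord y hg w

/-- Frame of a tensor product. -/
@[reducible]
def tensor (f : Frame 𝕜 V) (g : Frame 𝕜 W) : Frame 𝕜 (fun x => V x ⊗[𝕜] W x) where
  U := f.U ∩ g.U
  isOpen := f.isOpen.inter g.isOpen
  ι := f.ι × g.ι
  vec p y := f.vec p.1 y ⊗ₜ g.vec p.2 y
  coord p y := TensorProduct.lift ((LinearMap.mul 𝕜 𝕜).compl₁₂ (f.coord p.1 y) (g.coord p.2 y))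
  coord_vec := by
    rintro y ⟨hf, hg⟩ ⟨i, i'⟩ ⟨j, j'⟩
    simp only [TensorProduct.lift.tmul, LinearMap.compl₁₂_apply, LinearMap.mul_apply',
      f.coord_vec y hf, g.coord_vec y hg, Prod.mk.injEq]
    split_ifs <;> simp_all
  sum_coord := by
    rintro y ⟨hf, hg⟩ t
    induction t using TensorProduct.induction_on with
    | zero => simp
    | add a b ha hb =>
      conv_rhs => rw [← ha, ← hb, ← Finset.sum_add_distrib]
      simp [add_smul]
    | tmul v w =>
      conv_rhs => rw [← f.sum_coord y hf v, ← g.sum_coord y hg w]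
      rw [TensorProduct.sum_tmul, Fintype.sum_prod_type]
      refine Finset.sum_congr rfl fun i _ => ?_
      rw [TensorProduct.tmul_sum]
      refine Finset.sum_congr rfl fun j _ => ?_
      simp only [TensorProduct.lift.tmul, LinearMap.compl₁₂_apply, LinearMap.mul_apply',
        TensorProduct.smul_tmul_smul]

/-- The dual frame. -/
@[reducible]
def dual (f : Frame 𝕜 V) : Frame 𝕜 (fun x => Module.Dual 𝕜 (V x)) where
  U := f.U
  isOpen := f.isOpen
  ι := f.ι
  vec i y := f.coord i y
  coord i y := Module.Dual.eval 𝕜 (V y) (f.vec i y)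
  coord_vec := by
    intro y hy i j
    simp [f.coord_vec y hy, eq_comm]
  sum_coord := by
    intro y hy φ
    refine LinearMap.ext fun v => ?_
    conv_rhs => rw [← f.sum_coord y hy v]
    simp [map_sum, mul_comm]

/-- The frame of the trivial line bundle. -/
def one : Frame 𝕜 (fun _ : X => 𝕜) where
  U := univ
  isOpen := isOpen_univ
  ι := Unit
  vec _ _ := 1
  coord _ _ := LinearMap.id
  coord_vec := by simp
  sum_coord := by simp

/-- The frame of the zero bundle. -/
def zero : Frame 𝕜 (fun _ : X => PUnit.{1}) where
  U := univ
  isOpen := isOpen_univ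
  ι := Empty
  vec _ _ := 0
  coord _ _ := 0
  coord_vec := by simp
  sum_coord := by simp

end Frame

/-- Complexification of a frame. -/
@[reducible]
def Frame.complexify {V : X → Type} [∀ x, AddCommGroup (V x)] [∀ x, Module ℝ (V x)]
    (f : Frame ℝ V) : Frame ℂ (fun x => ℂ ⊗[ℝ] V x) where
  U := f.U
  isOpen := f.isOpen
  ι := f.ι
  vec i y := 1 ⊗ₜ f.vec i y
  coord i y := (Algebra.TensorProduct.rid ℝ ℂ ℂ).toLinearMap ∘ₗ (f.coord i y).baseChange ℂ
  coord_vec := by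
    intro y hy i j
    simp only [LinearMap.comp_apply, LinearMap.baseChange_tmul, f.coord_vec y hy]
    split_ifs <;> simp
  sum_coord := by
    intro y hy t
    induction t using TensorProduct.induction_on with
    | zero => simp
    | add a b ha hb =>
      conv_rhs => rw [← ha, ← hb, ← Finset.sum_add_distrib]
      simp only [map_add, add_smul]
    | tmul c v =>
      conv_rhs => rw [← f.sum_coord y hy v, TensorProduct.tmul_sum]
      refine Finset.sum_congr rfl fun i _ => ?_
      simp [TensorProduct.smul_tmul', TensorProduct.tmul_smul]

/-- The real frame underlying a complex frame. -/
@[reducible]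
def Frame.realify {V : X → Type} [∀ x, AddCommGroup (V x)] [∀ x, Module ℂ (V x)]
    (f : Frame ℂ V) : Frame ℝ V where
  U := f.U
  isOpen := f.isOpen
  ι := f.ι ⊕ f.ι
  vec := Sum.elim f.vec (fun i y => Complex.I • f.vec i y)
  coord := Sum.elim (fun i y => Complex.reLm ∘ₗ (f.coord i y).restrictScalars ℝ)
    (fun i y => Complex.imLm ∘ₗ (f.coord i y).restrictScalars ℝ)
  coord_vec := by
    rintro y hy (i | i) (j | j) <;> simp [f.coord_vec y hy] <;> split_ifs <;> simp
  sum_coord := by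
    intro y hy v
    conv_rhs => rw [← f.sum_coord y hy v]
    simp only [Fintype.sum_sum_type, Sum.elim_inl, Sum.elim_inr, ← Finset.sum_add_distrib]
    refine Finset.sum_congr rfl fun i _ => ?_
    conv_rhs => rw [← Complex.re_add_im (f.coord i y v), add_smul, mul_smul, Complex.coe_smul,
      Complex.coe_smul]
    rfl

namespace VecBundle

variable (E F : VecBundle 𝕜 X)

/-- The direct sum of vector bundles. -/
@[reducible]
def prod : VecBundle 𝕜 X :=
  ofAtlas (fun x => E.Fib x × F.Fib x) (fun p : E.CFrame × F.CFrame => p.1.1.prod p.2.1)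
    (fun x => by
      obtain ⟨e, he⟩ := E.exists_cframe x
      obtain ⟨f, hf⟩ := F.exists_cframe x
      exact ⟨(e, f), he, hf⟩)
    (fun p q => by
      rintro (k | k) (l | l)
      · exact (p.1.2.compat q.1.2 k l).mono fun y hy => ⟨hy.1.1, hy.2.1⟩
      · simpa [Frame.prod] using continuousOn_const
      · simpa [Frame.prod] using continuousOn_const
      · exact (p.2.2.compat q.2.2 k l).mono fun y hy => ⟨hy.1.2, hy.2.2⟩)

/-- The tensor product of vector bundles. -/
@[reducible]
def tensor : VecBundle 𝕜 X :=
  ofAtlas (fun x => E.Fib x ⊗[𝕜] F.Fib x) (fun p : E.CFrame × F.CFrame => p.1.1.tensor p.2.1)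
    (fun x => by
      obtain ⟨e, he⟩ := E.exists_cframe x
      obtain ⟨f, hf⟩ := F.exists_cframe x
      exact ⟨(e, f), he, hf⟩)
    (fun p q k l =>
      ((p.1.2.compat q.1.2 k.1 l.1).mono fun y hy => ⟨hy.1.1, hy.2.1⟩).mul
        ((p.2.2.compat q.2.2 k.2 l.2).mono fun y hy => ⟨hy.1.2, hy.2.2⟩))

/-- The dual of a vector bundle. -/
@[reducible]
def dual : VecBundle 𝕜 X :=
  ofAtlas (fun x => Module.Dual 𝕜 (E.Fib x)) (fun p : E.CFrame => p.1.dual)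
    (fun x => E.exists_cframe x)
    (fun p q k l => (q.2.compat p.2 l k).mono fun y hy => ⟨hy.2, hy.1⟩)

/-- The trivial line bundle. -/
@[reducible]
def one : VecBundle 𝕜 X :=
  ofAtlas (fun _ => 𝕜) (fun _ : Unit => Frame.one) (fun _ => ⟨(), trivial⟩)
    (fun _ _ _ _ => continuousOn_const)

/-- The zero bundle. -/
@[reducible]
def zero : VecBundle 𝕜 X :=
  ofAtlas (fun _ => PUnit.{1}) (fun _ : Unit => Frame.zero) (fun _ => ⟨(), trivial⟩)
    (fun _ _ k => k.elim)

/-- The complexification of a real vector bundle. -/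
@[reducible]
def complexify (E : VecBundle ℝ X) : VecBundle ℂ X :=
  ofAtlas (fun x => ℂ ⊗[ℝ] E.Fib x) (fun p : E.CFrame => p.1.complexify)
    (fun x => E.exists_cframe x)
    (fun p q k l => by
      refine (Complex.continuous_ofReal.comp_continuousOn (p.2.compat q.2 k l)).congr ?_
      intro y hy
      simp [Frame.complexify])

lemma isCont_realify {E : VecBundle ℂ X} (e : E.CFrame) :
    @Frame.IsCont ℝ _ X _ E.Fib _ _ E.topology e.1.realify := by
  refine ⟨?_, ?_⟩
  · have h : ContinuousOn (fun p : X × (e.1.ι ⊕ e.1.ι → ℝ) => e.1.assemble (p.1, fun i =>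
        ((p.2 (Sum.inl i) : ℂ) + (p.2 (Sum.inr i) : ℂ) * Complex.I))) (e.1.U ×ˢ univ) := by
      refine e.2.1.comp (t := e.1.U ×ˢ univ) (Continuous.continuousOn (by fun_prop)) ?_
      intro p hp
      exact ⟨hp.1, trivial⟩
    refine h.congr fun p hp => ?_
    simp only [Frame.assemble, add_smul, mul_smul, Finset.sum_add_distrib, Complex.coe_smul]
    congr 1
    exact Fintype.sum_sum_type _
  · rintro (i | i)
    · exact Complex.continuous_re.comp_continuousOn (e.2.2 i)
    · exact Complex.continuous_im.comp_continuousOn (e.2.2 i)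

/-- The real vector bundle underlying a complex vector bundle, with the same total space. -/
@[reducible]
def realify (E : VecBundle ℂ X) : VecBundle ℝ X where
  Fib := E.Fib
  topology := E.topology
  locallyTrivial x := by
    obtain ⟨e, he⟩ := E.exists_cframe x
    have hc := isCont_realify e
    refine ⟨_, e.1.realify.trivialization hc E.continuous_proj (Fintype.equivFin _), he,
      fun y hy => ⟨?_, ?_⟩⟩
    · intro v w
      funext k
      exact map_add _ v w
    · intro c v
      funext k
      exact map_smul _ c v

section Frames

variable {E F}

/-- The frame of a direct sum given by frames of the summands. -/
@[reducible]
def prodFrame (e : E.CFrame) (f : F.CFrame) : (E.prod F).CFrame :=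
  ⟨e.1.prod f.1, (ofAtlasFrame (fun p : E.CFrame × F.CFrame => p.1.1.prod p.2.1) _ _ (e, f)).2⟩

/-- The frame of a tensor product given by frames of the factors. -/
@[reducible]
def tensorFrame (e : E.CFrame) (f : F.CFrame) : (E.tensor F).CFrame :=
  ⟨e.1.tensor f.1, (ofAtlasFrame (fun p : E.CFrame × F.CFrame => p.1.1.tensor p.2.1) _ _ (e, f)).2⟩

/-- The dual frame of a continuous frame. -/
@[reducible]
def dualFrame (e : E.CFrame) : E.dual.CFrame :=
  ⟨e.1.dual, (ofAtlasFrame (fun p : E.CFrame => p.1.dual) _ _ e).2⟩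

/-- The frame of the trivial line bundle. -/
@[reducible]
def oneFrame : (one : VecBundle 𝕜 X).CFrame :=
  ⟨Frame.one, (ofAtlasFrame (fun _ : Unit => Frame.one) _ _ ()).2⟩

/-- The frame of the zero bundle. -/
@[reducible]
def zeroFrame : (zero : VecBundle 𝕜 X).CFrame :=
  ⟨Frame.zero, (ofAtlasFrame (fun _ : Unit => Frame.zero) _ _ ()).2⟩

/-- The frame of the complexification given by a frame of a real bundle. -/
@[reducible]
def complexifyFrame {E : VecBundle ℝ X} (e : E.CFrame) : E.complexify.CFrame :=
  ⟨e.1.complexify, (ofAtlasFrame (fun p : E.CFrame => p.1.complexify) _ _ e).2⟩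

/-- The real frame of the underlying real bundle given by a complex frame. -/
@[reducible]
def realifyFrame {E : VecBundle ℂ X} (e : E.CFrame) : E.realify.CFrame :=
  ⟨e.1.realify, isCont_realify e⟩

end Frames

end VecBundle

/-! ### Bundles with involution -/

/-- A vector bundle over a space with involution together with an involution of the total space
which covers the one of the base and is conjugate-linear on the fibres. For `𝕜 = ℂ` this is a Real
vector bundle; for `𝕜 = ℝ`, where the conjugation `starRingEnd ℝ` is the identity, it is an
equivariant real vector bundle for the group of order two. -/
structure ConjBundle (𝕜 : Type) [RCLike 𝕜] (X : Type u) [TopologicalSpace X] [Involution X]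
    extends VecBundle 𝕜 X where
  inv : ∀ x, Fib x →ₛₗ[starRingEnd 𝕜] Fib (tau x)
  continuous_inv : Continuous
    (fun z : TotalSpace Unit Fib => (⟨tau z.1, inv z.1 z.2⟩ : TotalSpace Unit Fib))
  inv_inv : ∀ x v, (⟨tau (tau x), inv (tau x) (inv x v)⟩ : TotalSpace Unit Fib) = ⟨x, v⟩

section Total

variable {V W : X → Type} [∀ x, AddCommGroup (V x)] [∀ x, Module 𝕜 (V x)]
  [∀ x, AddCommGroup (W x)] [∀ x, Module 𝕜 (W x)]

lemma total_add {x y : X} {a b : V y} {v w : V x}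
    (h1 : (⟨y, a⟩ : TotalSpace Unit V) = ⟨x, v⟩) (h2 : (⟨y, b⟩ : TotalSpace Unit V) = ⟨x, w⟩) :
    (⟨y, a + b⟩ : TotalSpace Unit V) = ⟨x, v + w⟩ := by
  cases h1; cases h2; rfl

lemma total_zero {x y : X} (h : y = x) :
    (⟨y, 0⟩ : TotalSpace Unit V) = ⟨x, 0⟩ := by
  cases h; rfl

lemma total_prod {x y : X} {a : V y} {b : W y} {v : V x} {w : W x}
    (h1 : (⟨y, a⟩ : TotalSpace Unit V) = ⟨x, v⟩) (h2 : (⟨y, b⟩ : TotalSpace Unit W) = ⟨x, w⟩) :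
    (⟨y, (a, b)⟩ : TotalSpace Unit (fun x => V x × W x)) = ⟨x, (v, w)⟩ := by
  cases h1; cases h2; rfl

lemma total_tmul {x y : X} {a : V y} {b : W y} {v : V x} {w : W x}
    (h1 : (⟨y, a⟩ : TotalSpace Unit V) = ⟨x, v⟩) (h2 : (⟨y, b⟩ : TotalSpace Unit W) = ⟨x, w⟩) :
    (⟨y, a ⊗ₜ b⟩ : TotalSpace Unit (fun x => V x ⊗[𝕜] W x)) = ⟨x, v ⊗ₜ w⟩ := by
  cases h1; cases h2; rfl

lemma total_ctmul {V : X → Type} [∀ x, AddCommGroup (V x)] [∀ x, Module ℝ (V x)] {x y : X} (c : ℂ)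
    {a : V y} {v : V x} (h1 : (⟨y, a⟩ : TotalSpace Unit V) = ⟨x, v⟩) :
    (⟨y, c ⊗ₜ a⟩ : TotalSpace Unit (fun x => ℂ ⊗[ℝ] V x)) = ⟨x, c ⊗ₜ v⟩ := by
  cases h1; rfl

lemma total_const {Z : Type} {x y : X} (h : y = x) (c : Z) :
    (⟨y, c⟩ : TotalSpace Unit (fun _ : X => Z)) = ⟨x, c⟩ := by
  cases h; rfl

lemma total_dual {x y : X} (h : y = x) {φ : Module.Dual 𝕜 (V y)} {ψ : Module.Dual 𝕜 (V x)}
    (H : ∀ a v, (⟨y, a⟩ : TotalSpace Unit V) = ⟨x, v⟩ → φ a = ψ v) :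
    (⟨y, φ⟩ : TotalSpace Unit (fun x => Module.Dual 𝕜 (V x))) = ⟨x, ψ⟩ := by
  cases h
  congr 1
  exact LinearMap.ext fun v => H v v rfl

end Total

namespace ConjBundle

variable [Involution X] (E F : ConjBundle 𝕜 X)

lemma inv_bijective (x : X) : Function.Bijective (E.inv x) := by
  have hinj : ∀ x, Function.Injective (E.inv x) := by
    intro x v w h
    have h1 := E.inv_inv x v
    rw [h, E.inv_inv x w] at h1
    simpa using h1.symm
  refine ⟨hinj x, fun w => ?_⟩
  have h := E.inv_inv (tau x) w
  have key : ∀ y, y = x → ∀ v : E.Fib y, (⟨tau y, E.inv y v⟩ : TotalSpace Unit E.Fib) =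
      ⟨tau x, w⟩ → ∃ a, E.inv x a = w := by
    rintro y rfl v hv
    exact ⟨v, by simpa using hv⟩
  exact key _ (tau_tau x) _ h

/-- The involution as a conjugate-linear isomorphism of fibres. -/
def invEquiv (x : X) : E.Fib x ≃ₛₗ[starRingEnd 𝕜] E.Fib (tau x) :=
  LinearEquiv.ofBijective (E.inv x) (E.inv_bijective x)

lemma invEquiv_symm_inv (x : X) (v : E.Fib x) : (E.invEquiv x).symm (E.inv x v) = v :=
  (E.invEquiv x).symm_apply_apply v

lemma inv_invEquiv_symm (x : X) (v : E.Fib (tau x)) : E.inv x ((E.invEquiv x).symm v) = v :=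
  (E.invEquiv x).apply_symm_apply v

lemma total_invEquiv_symm (x : X) (w : E.Fib (tau x)) :
    (⟨x, (E.invEquiv x).symm w⟩ : TotalSpace Unit E.Fib) = ⟨tau (tau x), E.inv (tau x) w⟩ := by
  rw [← E.inv_inv, inv_invEquiv_symm]

lemma coef_inv (e g : E.CFrame) (k : g.1.ι) (l : e.1.ι) :
    ContinuousOn (fun y => g.1.coord k (tau y) (E.inv y (e.1.vec l y)))
      (e.1.U ∩ tau ⁻¹' g.1.U) :=
  VecBundle.coef_of_continuous (t := tau) E.inv E.continuous_inv e g k l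

/-- The direct sum of two conjugate-linear maps. -/
@[reducible]
def prodMap {V V' W W' : Type} [AddCommGroup V] [AddCommGroup V'] [AddCommGroup W]
    [AddCommGroup W'] [Module 𝕜 V] [Module 𝕜 V'] [Module 𝕜 W] [Module 𝕜 W']
    (f : V →ₛₗ[starRingEnd 𝕜] V') (g : W →ₛₗ[starRingEnd 𝕜] W') :
    V × W →ₛₗ[starRingEnd 𝕜] V' × W' where
  toFun v := (f v.1, g v.2)
  map_add' v w := by simp
  map_smul' c v := by simp

/-- The direct sum. -/
@[reducible]
def prod : ConjBundle 𝕜 X where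
  toVecBundle := E.toVecBundle.prod F.toVecBundle
  inv x := prodMap (E.inv x) (F.inv x)
  continuous_inv := by
    refine VecBundle.continuous_of_coef (E := E.toVecBundle.prod F.toVecBundle)
      (F := E.toVecBundle.prod F.toVecBundle) RCLike.continuous_conj continuous_tau
      (fun x => prodMap (E.inv x) (F.inv x)) fun x => ?_
    obtain ⟨e, he⟩ := E.exists_cframe x
    obtain ⟨f, hf⟩ := F.exists_cframe x
    obtain ⟨e', he'⟩ := E.exists_cframe (tau x)
    obtain ⟨f', hf'⟩ := F.exists_cframe (tau x)
    refine ⟨VecBundle.prodFrame e f, VecBundle.prodFrame e' f', ⟨he, hf⟩, ⟨he', hf'⟩, ?_⟩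
    rintro (k | k) (l | l)
    · exact (E.coef_inv e e' k l).mono fun y hy => ⟨hy.1.1, hy.2.1⟩
    · simpa [Frame.prod] using continuousOn_const
    · simpa [Frame.prod] using continuousOn_const
    · exact (F.coef_inv f f' k l).mono fun y hy => ⟨hy.1.2, hy.2.2⟩
  inv_inv x v := total_prod (E.inv_inv x v.1) (F.inv_inv x v.2)

lemma tensor_inv_inv (x : X) (v : E.Fib x ⊗[𝕜] F.Fib x) :
    (⟨tau (tau x), TensorProduct.map (E.inv (tau x)) (F.inv (tau x))
      (TensorProduct.map (E.inv x) (F.inv x) v)⟩ :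
        TotalSpace Unit (fun x => E.Fib x ⊗[𝕜] F.Fib x)) = ⟨x, v⟩ := by
  induction v using TensorProduct.induction_on with
  | zero =>
    rw [map_zero, map_zero]
    exact total_zero (V := fun x => E.Fib x ⊗[𝕜] F.Fib x) (tau_tau x)
  | add a b ha hb =>
    rw [map_add, map_add]
    exact total_add (V := fun x => E.Fib x ⊗[𝕜] F.Fib x) ha hb
  | tmul v w => exact total_tmul (E.inv_inv x v) (F.inv_inv x w)

/-- The tensor product. -/
@[reducible]
def tensor : ConjBundle 𝕜 X where
  toVecBundle := E.toVecBundle.tensor F.toVecBundle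
  inv x := TensorProduct.map (E.inv x) (F.inv x)
  continuous_inv := by
    refine VecBundle.continuous_of_coef (E := E.toVecBundle.tensor F.toVecBundle)
      (F := E.toVecBundle.tensor F.toVecBundle) RCLike.continuous_conj continuous_tau
      (fun x => TensorProduct.map (E.inv x) (F.inv x)) fun x => ?_
    obtain ⟨e, he⟩ := E.exists_cframe x
    obtain ⟨f, hf⟩ := F.exists_cframe x
    obtain ⟨e', he'⟩ := E.exists_cframe (tau x)
    obtain ⟨f', hf'⟩ := F.exists_cframe (tau x)
    refine ⟨VecBundle.tensorFrame e f, VecBundle.tensorFrame e' f', ⟨he, hf⟩, ⟨he', hf'⟩, ?_⟩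
    rintro ⟨k, k'⟩ ⟨l, l'⟩
    exact ((E.coef_inv e e' k l).mono fun y hy => ⟨hy.1.1, hy.2.1⟩).mul
      ((F.coef_inv f f' k' l').mono fun y hy => ⟨hy.1.2, hy.2.2⟩)
  inv_inv := E.tensor_inv_inv F

/-- The conjugate-linear map of dual fibres, `(σ φ)(u) = conj (φ (σ u))`. The map `σ` from the
fibre over `σ x` to the fibre over `x` is written as the inverse of the one from the fibre
over `x` to the fibre over `σ x`. -/
@[reducible]
def dualInv (x : X) : Module.Dual 𝕜 (E.Fib x) →ₛₗ[starRingEnd 𝕜] Module.Dual 𝕜 (E.Fib (tau x)) where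
  toFun φ :=
    { toFun := fun u => starRingEnd 𝕜 (φ ((E.invEquiv x).symm u))
      map_add' := by simp
      map_smul' := fun c u => by
        rw [(E.invEquiv x).symm.map_smulₛₗ]
        simp }
  map_add' φ ψ := by ext; simp
  map_smul' c φ := by ext; simp

lemma dualInv_inv (x : X) (φ : Module.Dual 𝕜 (E.Fib x)) (v : E.Fib x) :
    E.dualInv x φ (E.inv x v) = starRingEnd 𝕜 (φ v) := by
  simp [dualInv, invEquiv_symm_inv]

lemma dual_inv_inv (x : X) (φ : Module.Dual 𝕜 (E.Fib x)) :
    (⟨tau (tau x), E.dualInv (tau x) (E.dualInv x φ)⟩ :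
      TotalSpace Unit (fun x => Module.Dual 𝕜 (E.Fib x))) = ⟨x, φ⟩ := by
  refine total_dual (tau_tau x) fun a v h => ?_
  rw [← E.inv_inv x v] at h
  have h' : a = E.inv (tau x) (E.inv x v) := by simpa using h
  rw [h', dualInv_inv, dualInv_inv]
  simp

/-- The dual. -/
@[reducible]
def dual : ConjBundle 𝕜 X where
  toVecBundle := E.toVecBundle.dual
  inv := E.dualInv
  continuous_inv := by
    refine VecBundle.continuous_of_coef (E := E.toVecBundle.dual)
      (F := E.toVecBundle.dual) RCLike.continuous_conj continuous_tau E.dualInv fun x => ?_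
    obtain ⟨e, he⟩ := E.exists_cframe x
    obtain ⟨e', he'⟩ := E.exists_cframe (tau x)
    refine ⟨VecBundle.dualFrame e, VecBundle.dualFrame e', he, he', fun k l => ?_⟩
    have h := (E.coef_inv e' e l k).comp (s := e.1.U ∩ tau ⁻¹' e'.1.U)
      (continuous_tau (X := X)).continuousOn (fun y hy => ⟨hy.2, by
        simpa [tau_tau] using hy.1⟩)
    refine (RCLike.continuous_conj.comp_continuousOn h).congr fun y hy => ?_
    simp only [Module.Dual.eval_apply, dualInv, LinearMap.coe_mk, AddHom.coe_mk, Function.comp_apply]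
    congr 1
    have key := E.total_invEquiv_symm y (e'.1.vec k (tau y))
    exact congrArg (fun z : TotalSpace Unit E.Fib => e.1.coord l z.1 z.2) key
  inv_inv := E.dual_inv_inv

/-- The trivial line bundle, with complex conjugation. -/
@[reducible]
def one : ConjBundle 𝕜 X where
  toVecBundle := VecBundle.one
  inv _ := (starRingEnd 𝕜).toSemilinearMap
  continuous_inv := by
    refine VecBundle.continuous_of_coef (E := VecBundle.one)
      (F := VecBundle.one) RCLike.continuous_conj continuous_tau
      (fun _ => (starRingEnd 𝕜).toSemilinearMap) fun x => ?_
    exact ⟨VecBundle.oneFrame, VecBundle.oneFrame, trivial, trivial, fun k l =>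
      (continuousOn_const (c := (1 : 𝕜))).congr fun y hy => by simp [Frame.one]⟩
  inv_inv x v := by
    have := total_const (tau_tau x) v
    simpa using this

/-- The zero bundle. -/
@[reducible]
def zero : ConjBundle 𝕜 X where
  toVecBundle := VecBundle.zero
  inv _ := 0
  continuous_inv := by
    refine VecBundle.continuous_of_coef (E := VecBundle.zero)
      (F := VecBundle.zero) RCLike.continuous_conj continuous_tau
      (fun _ => 0) fun x => ?_
    exact ⟨VecBundle.zeroFrame, VecBundle.zeroFrame, trivial, trivial, fun k => k.elim⟩
  inv_inv x v := total_const (tau_tau x) v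

section Complexify

variable (E : ConjBundle ℝ X)

/-- The conjugate-linear map `c ⊗ v ↦ conj c ⊗ σ v`. -/
@[reducible]
def complexifyInv (x : X) : ℂ ⊗[ℝ] E.Fib x →ₛₗ[starRingEnd ℂ] ℂ ⊗[ℝ] E.Fib (tau x) where
  toFun := TensorProduct.map (R := ℝ) Complex.conjAe.toLinearMap
    ({ toFun := E.inv x, map_add' := by simp, map_smul' := by simp } :
      E.Fib x →ₗ[ℝ] E.Fib (tau x))
  map_add' := map_add _
  map_smul' c t := by
    induction t using TensorProduct.induction_on with
    | zero => simp
    | add a b ha hb => rw [smul_add, map_add, ha, hb, map_add, smul_add]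
    | tmul d v => simp [TensorProduct.smul_tmul']

lemma complexifyInv_tmul (x : X) (c : ℂ) (v : E.Fib x) :
    E.complexifyInv x (c ⊗ₜ v) = (starRingEnd ℂ c) ⊗ₜ E.inv x v := rfl

lemma complexify_inv_inv (x : X) (t : ℂ ⊗[ℝ] E.Fib x) :
    (⟨tau (tau x), E.complexifyInv (tau x) (E.complexifyInv x t)⟩ :
      TotalSpace Unit (fun x => ℂ ⊗[ℝ] E.Fib x)) = ⟨x, t⟩ := by
  induction t using TensorProduct.induction_on with
  | zero =>
    rw [map_zero, map_zero]
    exact total_zero (V := fun x => ℂ ⊗[ℝ] E.Fib x) (tau_tau x)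
  | add a b ha hb =>
    rw [map_add, map_add]
    exact total_add (V := fun x => ℂ ⊗[ℝ] E.Fib x) ha hb
  | tmul c v =>
    rw [complexifyInv_tmul, complexifyInv_tmul, Complex.conj_conj]
    exact total_ctmul c (E.inv_inv x v)

/-- The complexification of an equivariant real bundle, as a Real bundle. -/
@[reducible]
def complexify : ConjBundle ℂ X where
  toVecBundle := E.toVecBundle.complexify
  inv := E.complexifyInv
  continuous_inv := by
    refine VecBundle.continuous_of_coef (E := E.toVecBundle.complexify)
      (F := E.toVecBundle.complexify) RCLike.continuous_conj continuous_tau E.complexifyInv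
      fun x => ?_
    obtain ⟨e, he⟩ := E.exists_cframe x
    obtain ⟨e', he'⟩ := E.exists_cframe (tau x)
    refine ⟨VecBundle.complexifyFrame e, VecBundle.complexifyFrame e', he, he', fun k l => ?_⟩
    refine (Complex.continuous_ofReal.comp_continuousOn (E.coef_inv e e' k l)).congr fun y hy => ?_
    simp [complexifyInv_tmul]
  inv_inv := E.complexify_inv_inv

end Complexify

/-- The equivariant real bundle underlying a Real bundle. -/
@[reducible]
def realify (E : ConjBundle ℂ X) : ConjBundle ℝ X where
  toVecBundle := E.toVecBundle.realify
  inv x :=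
    { toFun := E.inv x
      map_add' := map_add _
      map_smul' := fun c v => by
        have h := (E.inv x).map_smulₛₗ (c : ℂ) v
        rw [Complex.conj_ofReal] at h
        exact h }
  continuous_inv := E.continuous_inv
  inv_inv := E.inv_inv

/-! ### Isomorphisms -/

/-- Isomorphisms of bundles with involution: fibrewise linear homeomorphisms of the total spaces
over `X` which commute with the involutions. -/
structure Iso (E F : ConjBundle 𝕜 X) where
  equiv : ∀ x, E.Fib x ≃ₗ[𝕜] F.Fib x
  continuous_toFun : Continuous
    (fun z : TotalSpace Unit E.Fib => (⟨z.1, equiv z.1 z.2⟩ : TotalSpace Unit F.Fib))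
  continuous_invFun : Continuous
    (fun z : TotalSpace Unit F.Fib => (⟨z.1, (equiv z.1).symm z.2⟩ : TotalSpace Unit E.Fib))
  map_inv : ∀ x v, equiv (tau x) (E.inv x v) = F.inv x (equiv x v)

namespace Iso

variable {E F} {E' F' P : ConjBundle 𝕜 X}

/-- Construction of an isomorphism by checking continuity on matrix coefficients. -/
def ofCoef (φ : ∀ x, E.Fib x ≃ₗ[𝕜] F.Fib x)
    (h : ∀ x, ∃ (e : E.CFrame) (g : F.CFrame), x ∈ e.1.U ∧ x ∈ g.1.U ∧
      (∀ k l, ContinuousOn (fun y => g.1.coord k y (φ y (e.1.vec l y))) (e.1.U ∩ g.1.U)) ∧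
      (∀ k l, ContinuousOn (fun y => e.1.coord k y ((φ y).symm (g.1.vec l y))) (e.1.U ∩ g.1.U)))
    (hinv : ∀ x v, φ (tau x) (E.inv x v) = F.inv x (φ x v)) : Iso E F where
  equiv := φ
  continuous_toFun := VecBundle.continuous_of_coef_id (fun x => (φ x).toLinearMap) fun x => by
    obtain ⟨e, g, he, hg, h1, h2⟩ := h x
    exact ⟨e, g, he, hg, h1⟩
  continuous_invFun := VecBundle.continuous_of_coef_id (fun x => (φ x).symm.toLinearMap)
    fun x => by
      obtain ⟨e, g, he, hg, h1, h2⟩ := h x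
      exact ⟨g, e, hg, he, fun k l => (h2 k l).mono fun y hy => ⟨hy.2, hy.1⟩⟩
  map_inv := hinv

lemma coef (φ : Iso E F) (e : E.CFrame) (g : F.CFrame) (k : g.1.ι) (l : e.1.ι) :
    ContinuousOn (fun y => g.1.coord k y (φ.equiv y (e.1.vec l y))) (e.1.U ∩ g.1.U) :=
  VecBundle.coef_of_continuous (t := fun x => x) (fun x => (φ.equiv x).toLinearMap)
    φ.continuous_toFun e g k l

lemma coef_symm (φ : Iso E F) (e : E.CFrame) (g : F.CFrame) (k : e.1.ι) (l : g.1.ι) :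
    ContinuousOn (fun y => e.1.coord k y ((φ.equiv y).symm (g.1.vec l y))) (e.1.U ∩ g.1.U) :=
  (VecBundle.coef_of_continuous (t := fun x => x) (fun x => (φ.equiv x).symm.toLinearMap)
    φ.continuous_invFun g e k l).mono fun y hy => ⟨hy.2, hy.1⟩

/-- The identity. -/
def refl (E : ConjBundle 𝕜 X) : Iso E E where
  equiv x := LinearEquiv.refl 𝕜 _
  continuous_toFun := continuous_id
  continuous_invFun := continuous_id
  map_inv _ _ := rfl

/-- The inverse. -/
def symm (φ : Iso E F) : Iso F E where
  equiv x := (φ.equiv x).symm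
  continuous_toFun := φ.continuous_invFun
  continuous_invFun := φ.continuous_toFun
  map_inv x v := by
    apply (φ.equiv (tau x)).injective
    rw [φ.map_inv]
    simp

/-- Composition. -/
def trans (φ : Iso E F) (ψ : Iso F P) : Iso E P where
  equiv x := (φ.equiv x).trans (ψ.equiv x)
  continuous_toFun := ψ.continuous_toFun.comp φ.continuous_toFun
  continuous_invFun := φ.continuous_invFun.comp ψ.continuous_invFun
  map_inv x v := by simp [φ.map_inv, ψ.map_inv]

/-- Functoriality of the direct sum. -/
def prodCongr (φ : Iso E E') (ψ : Iso F F') : Iso (E.prod F) (E'.prod F') :=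
  ofCoef (E := E.prod F) (F := E'.prod F') (fun x => (φ.equiv x).prodCongr (ψ.equiv x))
    (fun x => by
      obtain ⟨e, he⟩ := E.exists_cframe x
      obtain ⟨f, hf⟩ := F.exists_cframe x
      obtain ⟨e', he'⟩ := E'.exists_cframe x
      obtain ⟨f', hf'⟩ := F'.exists_cframe x
      refine ⟨VecBundle.prodFrame e f, VecBundle.prodFrame e' f', ⟨he, hf⟩, ⟨he', hf'⟩, ?_, ?_⟩
      · rintro (k | k) (l | l)
        · exact (φ.coef e e' k l).mono fun y hy => ⟨hy.1.1, hy.2.1⟩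
        · simpa [Frame.prod] using continuousOn_const
        · simpa [Frame.prod] using continuousOn_const
        · exact (ψ.coef f f' k l).mono fun y hy => ⟨hy.1.2, hy.2.2⟩
      · rintro (k | k) (l | l)
        · exact (φ.coef_symm e e' k l).mono fun y hy => ⟨hy.1.1, hy.2.1⟩
        · simpa [Frame.prod] using continuousOn_const
        · simpa [Frame.prod] using continuousOn_const
        · exact (ψ.coef_symm f f' k l).mono fun y hy => ⟨hy.1.2, hy.2.2⟩)
    (fun x v => Prod.ext (φ.map_inv x v.1) (ψ.map_inv x v.2))

/-- Functoriality of the tensor product. -/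
def tensorCongr (φ : Iso E E') (ψ : Iso F F') : Iso (E.tensor F) (E'.tensor F') :=
  ofCoef (E := E.tensor F) (F := E'.tensor F')
    (fun x => TensorProduct.congr (φ.equiv x) (ψ.equiv x))
    (fun x => by
      obtain ⟨e, he⟩ := E.exists_cframe x
      obtain ⟨f, hf⟩ := F.exists_cframe x
      obtain ⟨e', he'⟩ := E'.exists_cframe x
      obtain ⟨f', hf'⟩ := F'.exists_cframe x
      refine ⟨VecBundle.tensorFrame e f, VecBundle.tensorFrame e' f', ⟨he, hf⟩, ⟨he', hf'⟩, ?_, ?_⟩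
      · intro k l
        exact ((φ.coef e e' k.1 l.1).mono fun y hy => ⟨hy.1.1, hy.2.1⟩).mul
          ((ψ.coef f f' k.2 l.2).mono fun y hy => ⟨hy.1.2, hy.2.2⟩)
      · intro k l
        exact ((φ.coef_symm e e' k.1 l.1).mono fun y hy => ⟨hy.1.1, hy.2.1⟩).mul
          ((ψ.coef_symm f f' k.2 l.2).mono fun y hy => ⟨hy.1.2, hy.2.2⟩))
    (fun x v => by
      induction v using TensorProduct.induction_on with
      | zero => simp only [map_zero]
      | add a b ha hb => simp only [map_add, ha, hb]
      | tmul v w => simp [φ.map_inv, ψ.map_inv])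

/-- Functoriality of complexification. -/
def complexifyCongr {E F : ConjBundle ℝ X} (φ : Iso E F) : Iso E.complexify F.complexify :=
  ofCoef (E := E.complexify) (F := F.complexify) (fun x => (φ.equiv x).baseChange ℝ ℂ _ _)
    (fun x => by
      obtain ⟨e, he⟩ := E.exists_cframe x
      obtain ⟨e', he'⟩ := F.exists_cframe x
      refine ⟨VecBundle.complexifyFrame e, VecBundle.complexifyFrame e', he, he', ?_, ?_⟩
      · intro k l
        refine (Complex.continuous_ofReal.comp_continuousOn (φ.coef e e' k l)).congr fun y hy => ?_
        simp
      · intro k l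
        refine (Complex.continuous_ofReal.comp_continuousOn
          (φ.coef_symm e e' k l)).congr fun y hy => ?_
        simp)
    (fun x v => by
      induction v using TensorProduct.induction_on with
      | zero => simp only [map_zero]
      | add a b ha hb => simp only [map_add, ha, hb]
      | tmul c w => simp [complexifyInv_tmul, φ.map_inv])

/-- Functoriality of the underlying real bundle. -/
def realifyCongr {E F : ConjBundle ℂ X} (φ : Iso E F) : Iso E.realify F.realify where
  equiv x := (φ.equiv x).restrictScalars ℝ
  continuous_toFun := φ.continuous_toFun
  continuous_invFun := φ.continuous_invFun
  map_inv := φ.map_inv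

/-- The contragredient isomorphism of duals. -/
def dualCongr (φ : Iso E F) : Iso E.dual F.dual :=
  ofCoef (E := E.dual) (F := F.dual) (fun x => (φ.equiv x).symm.dualMap)
    (fun x => by
      obtain ⟨e, he⟩ := E.exists_cframe x
      obtain ⟨e', he'⟩ := F.exists_cframe x
      exact ⟨VecBundle.dualFrame e, VecBundle.dualFrame e', he, he',
        fun k l => φ.coef_symm e e' l k, fun k l => φ.coef e e' l k⟩)
    (fun x f => by
      refine LinearMap.ext fun u => ?_
      obtain ⟨v, rfl⟩ := (F.inv_bijective x).2 u
      have h := φ.symm.map_inv x v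
      change (φ.equiv (tau x)).symm (F.inv x v) = E.inv x ((φ.equiv x).symm v) at h
      change E.dualInv x f ((φ.equiv (tau x)).symm (F.inv x v)) =
        F.dualInv x ((φ.equiv x).symm.dualMap f) (F.inv x v)
      rw [h, dualInv_inv, dualInv_inv]
      rfl)

/-- Commutativity of the direct sum. -/
def prodComm (E F : ConjBundle 𝕜 X) : Iso (E.prod F) (F.prod E) :=
  ofCoef (E := E.prod F) (F := F.prod E) (fun x => LinearEquiv.prodComm 𝕜 _ _)
    (fun x => by
      obtain ⟨e, he⟩ := E.exists_cframe x
      obtain ⟨f, hf⟩ := F.exists_cframe x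
      refine ⟨VecBundle.prodFrame e f, VecBundle.prodFrame f e, ⟨he, hf⟩, ⟨hf, he⟩, ?_, ?_⟩
      · rintro (k | k) (l | l)
        · simpa [Frame.prod] using continuousOn_const
        · exact (f.2.compat f.2 k l).mono fun y hy => ⟨hy.1.2, hy.1.2⟩
        · exact (e.2.compat e.2 k l).mono fun y hy => ⟨hy.1.1, hy.1.1⟩
        · simpa [Frame.prod] using continuousOn_const
      · rintro (k | k) (l | l)
        · simpa [Frame.prod] using continuousOn_const
        · exact (e.2.compat e.2 k l).mono fun y hy => ⟨hy.1.1, hy.1.1⟩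
        · exact (f.2.compat f.2 k l).mono fun y hy => ⟨hy.1.2, hy.1.2⟩
        · simpa [Frame.prod] using continuousOn_const)
    (fun x v => rfl)

/-- Associativity of the direct sum. -/
def prodAssoc (E F P : ConjBundle 𝕜 X) : Iso ((E.prod F).prod P) (E.prod (F.prod P)) :=
  ofCoef (E := (E.prod F).prod P) (F := E.prod (F.prod P)) (fun x => LinearEquiv.prodAssoc 𝕜 _ _ _)
    (fun x => by
      obtain ⟨e, he⟩ := E.exists_cframe x
      obtain ⟨f, hf⟩ := F.exists_cframe x
      obtain ⟨p, hp⟩ := P.exists_cframe x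
      refine ⟨VecBundle.prodFrame (VecBundle.prodFrame e f) p,
        VecBundle.prodFrame e (VecBundle.prodFrame f p), ⟨⟨he, hf⟩, hp⟩, ⟨he, hf, hp⟩, ?_, ?_⟩
      · rintro (k | k | k) ((l | l) | l)
        all_goals first
          | exact (e.2.compat e.2 k l).mono fun y hy => ⟨hy.2.1, hy.2.1⟩
          | exact (f.2.compat f.2 k l).mono fun y hy => ⟨hy.2.2.1, hy.2.2.1⟩
          | exact (p.2.compat p.2 k l).mono fun y hy => ⟨hy.2.2.2, hy.2.2.2⟩
          | exact continuousOn_const.congr fun y hy => map_zero (e.1.coord k y)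
          | exact continuousOn_const.congr fun y hy => map_zero (f.1.coord k y)
          | exact continuousOn_const.congr fun y hy => map_zero (p.1.coord k y)
      · rintro ((k | k) | k) (l | l | l)
        all_goals first
          | exact (e.2.compat e.2 k l).mono fun y hy => ⟨hy.2.1, hy.2.1⟩
          | exact (f.2.compat f.2 k l).mono fun y hy => ⟨hy.2.2.1, hy.2.2.1⟩
          | exact (p.2.compat p.2 k l).mono fun y hy => ⟨hy.2.2.2, hy.2.2.2⟩
          | exact continuousOn_const.congr fun y hy => map_zero (e.1.coord k y)
          | exact continuousOn_const.congr fun y hy => map_zero (f.1.coord k y)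
          | exact continuousOn_const.congr fun y hy => map_zero (p.1.coord k y))
    (fun x v => rfl)

/-- The zero bundle is neutral for the direct sum. -/
def zeroProd (E : ConjBundle 𝕜 X) : Iso (zero.prod E) E :=
  ofCoef (E := zero.prod E) (F := E) (fun x => LinearEquiv.uniqueProd)
    (fun x => by
      obtain ⟨e, he⟩ := E.exists_cframe x
      refine ⟨VecBundle.prodFrame VecBundle.zeroFrame e, e, ⟨trivial, he⟩, he, ?_, ?_⟩
      · rintro k (l | l)
        · exact l.elim
        · exact (e.2.compat e.2 k l).mono fun y hy => ⟨hy.2, hy.2⟩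
      · rintro (k | k) l
        · exact k.elim
        · exact (e.2.compat e.2 k l).mono fun y hy => ⟨hy.2, hy.2⟩)
    (fun x v => rfl)

/-- Commutativity of the tensor product. -/
def tensorComm (E F : ConjBundle 𝕜 X) : Iso (E.tensor F) (F.tensor E) :=
  ofCoef (E := E.tensor F) (F := F.tensor E) (fun x => TensorProduct.comm 𝕜 _ _)
    (fun x => by
      obtain ⟨e, he⟩ := E.exists_cframe x
      obtain ⟨f, hf⟩ := F.exists_cframe x
      refine ⟨VecBundle.tensorFrame e f, VecBundle.tensorFrame f e, ⟨he, hf⟩, ⟨hf, he⟩, ?_, ?_⟩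
      · intro k l
        exact ((f.2.compat f.2 k.1 l.2).mono fun y hy => ⟨hy.1.2, hy.1.2⟩).mul
          ((e.2.compat e.2 k.2 l.1).mono fun y hy => ⟨hy.1.1, hy.1.1⟩)
      · intro k l
        exact ((e.2.compat e.2 k.1 l.2).mono fun y hy => ⟨hy.1.1, hy.1.1⟩).mul
          ((f.2.compat f.2 k.2 l.1).mono fun y hy => ⟨hy.1.2, hy.1.2⟩))
    (fun x v => by
      induction v using TensorProduct.induction_on with
      | zero => simp only [map_zero]
      | add a b ha hb => simp only [map_add, ha, hb]
      | tmul v w => rfl)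

/-- Associativity of the tensor product. -/
def tensorAssoc (E F P : ConjBundle 𝕜 X) : Iso ((E.tensor F).tensor P) (E.tensor (F.tensor P)) :=
  ofCoef (E := (E.tensor F).tensor P) (F := E.tensor (F.tensor P))
    (fun x => TensorProduct.assoc 𝕜 _ _ _)
    (fun x => by
      obtain ⟨e, he⟩ := E.exists_cframe x
      obtain ⟨f, hf⟩ := F.exists_cframe x
      obtain ⟨p, hp⟩ := P.exists_cframe x
      refine ⟨VecBundle.tensorFrame (VecBundle.tensorFrame e f) p,
        VecBundle.tensorFrame e (VecBundle.tensorFrame f p), ⟨⟨he, hf⟩, hp⟩, ⟨he, hf, hp⟩, ?_, ?_⟩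
      · intro k l
        exact ((e.2.compat e.2 k.1 l.1.1).mono fun y hy => ⟨hy.2.1, hy.2.1⟩).mul
          (((f.2.compat f.2 k.2.1 l.1.2).mono fun y hy => ⟨hy.2.2.1, hy.2.2.1⟩).mul
          ((p.2.compat p.2 k.2.2 l.2).mono fun y hy => ⟨hy.2.2.2, hy.2.2.2⟩))
      · intro k l
        exact (((e.2.compat e.2 k.1.1 l.1).mono fun y hy => ⟨hy.2.1, hy.2.1⟩).mul
          ((f.2.compat f.2 k.1.2 l.2.1).mono fun y hy => ⟨hy.2.2.1, hy.2.2.1⟩)).mul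
          ((p.2.compat p.2 k.2 l.2.2).mono fun y hy => ⟨hy.2.2.2, hy.2.2.2⟩))
    (fun x v => by
      induction v using TensorProduct.induction_on with
      | zero => simp only [map_zero]
      | add a b ha hb => simp only [map_add, ha, hb]
      | tmul v w =>
        induction v using TensorProduct.induction_on with
        | zero => simp only [map_zero, TensorProduct.zero_tmul]
        | add a b ha hb => simp only [map_add, TensorProduct.add_tmul, ha, hb]
        | tmul u v => rfl)

/-- The trivial line bundle is neutral for the tensor product. -/
def oneTensor (E : ConjBundle 𝕜 X) : Iso (one.tensor E) E :=
  ofCoef (E := one.tensor E) (F := E) (fun x => TensorProduct.lid 𝕜 _)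
    (fun x => by
      obtain ⟨e, he⟩ := E.exists_cframe x
      refine ⟨VecBundle.tensorFrame VecBundle.oneFrame e, e, ⟨trivial, he⟩, he, ?_, ?_⟩
      · intro k l
        refine ((e.2.compat e.2 k l.2).mono fun y hy => ⟨hy.2, hy.2⟩).congr fun y hy => ?_
        simp [Frame.one]
      · intro k l
        refine ((e.2.compat e.2 k.2 l).mono fun y hy => ⟨hy.2, hy.2⟩).congr fun y hy => ?_
        simp [Frame.one])
    (fun x v => by
      induction v using TensorProduct.induction_on with
      | zero => simp only [map_zero]
      | add a b ha hb => simp only [map_add, ha, hb]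
      | tmul v w => simp)

/-- The tensor product with the zero bundle. -/
def zeroTensor (E : ConjBundle 𝕜 X) : Iso (zero.tensor E) zero :=
  ofCoef (E := zero.tensor E) (F := zero) (fun x => 0)
    (fun x => by
      obtain ⟨e, he⟩ := E.exists_cframe x
      exact ⟨VecBundle.tensorFrame VecBundle.zeroFrame e, VecBundle.zeroFrame, ⟨trivial, he⟩,
        trivial, fun k => k.elim, fun k => k.1.elim⟩)
    (fun x v => rfl)

lemma prodRight_symm_left {V W W' : Type} [AddCommGroup V] [AddCommGroup W] [AddCommGroup W']
    [Module 𝕜 V] [Module 𝕜 W] [Module 𝕜 W'] (v : V) (w : W) :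
    (TensorProduct.prodRight 𝕜 𝕜 V W W').symm (v ⊗ₜ w, 0) = v ⊗ₜ (w, 0) := by
  rw [LinearEquiv.symm_apply_eq]
  simp

lemma prodRight_symm_right {V W W' : Type} [AddCommGroup V] [AddCommGroup W] [AddCommGroup W']
    [Module 𝕜 V] [Module 𝕜 W] [Module 𝕜 W'] (v : V) (w : W') :
    (TensorProduct.prodRight 𝕜 𝕜 V W W').symm (0, v ⊗ₜ w) = v ⊗ₜ (0, w) := by
  rw [LinearEquiv.symm_apply_eq]
  simp

/-- Distributivity. -/
def tensorProd (E F P : ConjBundle 𝕜 X) :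
    Iso (E.tensor (F.prod P)) ((E.tensor F).prod (E.tensor P)) :=
  ofCoef (E := E.tensor (F.prod P)) (F := (E.tensor F).prod (E.tensor P))
    (fun x => TensorProduct.prodRight 𝕜 𝕜 _ _ _)
    (fun x => by
      obtain ⟨e, he⟩ := E.exists_cframe x
      obtain ⟨f, hf⟩ := F.exists_cframe x
      obtain ⟨p, hp⟩ := P.exists_cframe x
      refine ⟨VecBundle.tensorFrame e (VecBundle.prodFrame f p),
        VecBundle.prodFrame (VecBundle.tensorFrame e f) (VecBundle.tensorFrame e p),
        ⟨he, hf, hp⟩, ⟨⟨he, hf⟩, ⟨he, hp⟩⟩, ?_, ?_⟩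
      · rintro (k | k) ⟨l, l' | l'⟩
        · exact ((e.2.compat e.2 k.1 l).mono fun y hy => ⟨hy.1.1, hy.1.1⟩).mul
            ((f.2.compat f.2 k.2 l').mono fun y hy => ⟨hy.1.2.1, hy.1.2.1⟩)
        · simpa [Frame.prod, Frame.tensor] using continuousOn_const
        · simpa [Frame.prod, Frame.tensor] using continuousOn_const
        · exact ((e.2.compat e.2 k.1 l).mono fun y hy => ⟨hy.1.1, hy.1.1⟩).mul
            ((p.2.compat p.2 k.2 l').mono fun y hy => ⟨hy.1.2.2, hy.1.2.2⟩)
      · rintro ⟨k, k' | k'⟩ (l | l)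
        · refine (((e.2.compat e.2 k l.1).mono fun y hy => ⟨hy.1.1, hy.1.1⟩).mul
            ((f.2.compat f.2 k' l.2).mono fun y hy => ⟨hy.1.2.1, hy.1.2.1⟩)).congr fun y hy => ?_
          simp [prodRight_symm_left]
        · simpa [prodRight_symm_left, prodRight_symm_right] using continuousOn_const
        · simpa [prodRight_symm_left, prodRight_symm_right] using continuousOn_const
        · refine (((e.2.compat e.2 k l.1).mono fun y hy => ⟨hy.1.1, hy.1.1⟩).mul
            ((p.2.compat p.2 k' l.2).mono fun y hy => ⟨hy.1.2.2, hy.1.2.2⟩)).congr fun y hy => ?_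
          simp [prodRight_symm_right])
    (fun x v => by
      induction v using TensorProduct.induction_on with
      | zero => simp only [map_zero]
      | add a b ha hb => simp only [map_add, ha, hb]
      | tmul v w => rfl)

end Iso

end ConjBundle
/-! ### Symmetric forms -/

section Forms

variable [Involution X]

/-- A nondegenerate symmetric form on a bundle with involution: an isomorphism `φ : E → E*` of
bundles with involution (a continuous map of bundles which is bijective on the fibres and commutes
with the involutions) such that `φ = φ*`. For `𝕜 = ℂ` this is a Real symmetric form. -/
structure SymForm (E : ConjBundle 𝕜 X) where
  form : ∀ x, LinearMap.BilinForm 𝕜 (E.Fib x)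
  continuous_form : Continuous[E.topology, E.dual.topology] (fun z : TotalSpace Unit E.Fib =>
    (⟨z.1, form z.1 z.2⟩ : TotalSpace Unit E.dual.Fib))
  bijective_form : ∀ x, Function.Bijective (form x)
  form_inv : ∀ x v, form (tau x) (E.inv x v) = E.dual.inv x (form x v)
  form_symm : ∀ x v w, form x v w = form x w v

/-- An invariant metric on an equivariant real bundle: a positive definite invariant symmetric
form. -/
structure InvariantMetric (E : ConjBundle ℝ X) extends SymForm E where
  form_pos : ∀ x v, v ≠ 0 → 0 < form x v v

namespace SymForm

variable {E F : ConjBundle 𝕜 X}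

lemma form_inv_inv (φ : SymForm E) (x : X) (v w : E.Fib x) :
    φ.form (tau x) (E.inv x v) (E.inv x w) = starRingEnd 𝕜 (φ.form x v w) := by
  rw [φ.form_inv]
  exact E.dualInv_inv x _ w

lemma coef (φ : SymForm E) (e : E.CFrame) (k l : e.1.ι) :
    ContinuousOn (fun y => φ.form y (e.1.vec l y) (e.1.vec k y)) e.1.U :=
  (VecBundle.coef_of_continuous (E := E.toVecBundle) (F := E.toVecBundle.dual) (t := fun x => x)
    φ.form φ.continuous_form e (VecBundle.dualFrame e) k l).mono fun y hy => ⟨hy, hy⟩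

/-- Construction of a symmetric form by checking continuity on matrix coefficients. -/
@[reducible]
def ofCoef (form : ∀ x, LinearMap.BilinForm 𝕜 (E.Fib x))
    (cont : ∀ x, ∃ e : E.CFrame, x ∈ e.1.U ∧ ∀ k l,
      ContinuousOn (fun y => form y (e.1.vec l y) (e.1.vec k y)) e.1.U)
    (bij : ∀ x, Function.Bijective (form x))
    (hinv : ∀ x v w, form (tau x) (E.inv x v) (E.inv x w) = starRingEnd 𝕜 (form x v w))
    (symm : ∀ x v w, form x v w = form x w v) : SymForm E where
  form := form
  continuous_form := VecBundle.continuous_of_coef_id (F := E.toVecBundle.dual) form fun x => by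
    obtain ⟨e, he, h⟩ := cont x
    exact ⟨e, VecBundle.dualFrame e, he, he, fun k l => (h k l).mono fun y hy => hy.1⟩
  bijective_form := bij
  form_inv x v := LinearMap.ext fun u => by
    obtain ⟨w, rfl⟩ := (E.inv_bijective x).2 u
    rw [hinv]
    exact (E.dualInv_inv x _ w).symm
  form_symm := symm

/-- The orthogonal sum of two bilinear forms. -/
@[reducible]
def sumForm {V W : Type} [AddCommGroup V] [AddCommGroup W] [Module 𝕜 V] [Module 𝕜 W]
    (B : LinearMap.BilinForm 𝕜 V) (C : LinearMap.BilinForm 𝕜 W) :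
    LinearMap.BilinForm 𝕜 (V × W) :=
  LinearMap.mk₂ 𝕜 (fun v w => B v.1 w.1 + C v.2 w.2)
    (fun a b c => by simp; ring) (fun r a b => by simp; ring)
    (fun a b c => by simp; ring) (fun r a b => by simp; ring)

/-- The orthogonal sum. -/
@[reducible]
def prod (φ : SymForm E) (ψ : SymForm F) : SymForm (E.prod F) :=
  ofCoef (E := E.prod F) (fun x => sumForm (φ.form x) (ψ.form x))
    (fun x => by
      obtain ⟨e, he⟩ := E.exists_cframe x
      obtain ⟨f, hf⟩ := F.exists_cframe x
      refine ⟨VecBundle.prodFrame e f, ⟨he, hf⟩, ?_⟩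
      rintro (k | k) (l | l)
      · refine ((φ.coef e k l).mono fun y hy => hy.1).congr fun y hy => ?_
        simp [Frame.prod]
      · refine (continuousOn_const (c := (0 : 𝕜))).congr fun y hy => ?_
        simp [Frame.prod]
      · refine (continuousOn_const (c := (0 : 𝕜))).congr fun y hy => ?_
        simp [Frame.prod]
      · refine ((ψ.coef f k l).mono fun y hy => hy.2).congr fun y hy => ?_
        simp [Frame.prod])
    (fun x => by
      constructor
      · rw [injective_iff_map_eq_zero]
        rintro ⟨v, w⟩ h
        have h1 : φ.form x v = 0 := LinearMap.ext fun a => by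
          simpa using LinearMap.congr_fun h (a, 0)
        have h2 : ψ.form x w = 0 := LinearMap.ext fun a => by
          simpa using LinearMap.congr_fun h (0, a)
        have h1' := (injective_iff_map_eq_zero _).1 (φ.bijective_form x).1 _ h1
        have h2' := (injective_iff_map_eq_zero _).1 (ψ.bijective_form x).1 _ h2
        rw [h1', h2']
        rfl
      · intro f
        obtain ⟨v, hv⟩ := (φ.bijective_form x).2 (f ∘ₗ LinearMap.inl 𝕜 _ _)
        obtain ⟨w, hw⟩ := (ψ.bijective_form x).2 (f ∘ₗ LinearMap.inr 𝕜 _ _)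
        refine ⟨(v, w), LinearMap.ext ?_⟩
        rintro ⟨a, b⟩
        simp only [LinearMap.mk₂_apply, hv, hw, LinearMap.comp_apply, LinearMap.inl_apply,
          LinearMap.inr_apply, ← map_add]
        simp)
    (fun x v w => by
      simp only [LinearMap.mk₂_apply, map_add]
      exact congrArg₂ _ (φ.form_inv_inv x v.1 w.1) (ψ.form_inv_inv x v.2 w.2))
    (fun x v w => by simp [φ.form_symm x v.1, ψ.form_symm x v.2])

lemma bilin_tensor_ext {V W : Type} [AddCommGroup V] [AddCommGroup W] [Module 𝕜 V] [Module 𝕜 W]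
    {B C : LinearMap.BilinForm 𝕜 (V ⊗[𝕜] W)}
    (h : ∀ a b c d, B (a ⊗ₜ b) (c ⊗ₜ d) = C (a ⊗ₜ b) (c ⊗ₜ d)) (u v : V ⊗[𝕜] W) :
    B u v = C u v := by
  have : B = C := by
    refine TensorProduct.ext' fun a b => ?_
    exact TensorProduct.ext' fun c d => h a b c d
  rw [this]

lemma tmul_bijective {V W : Type} [AddCommGroup V] [AddCommGroup W] [Module 𝕜 V] [Module 𝕜 W]
    [Module.Finite 𝕜 V] [Module.Finite 𝕜 W]
    {B : LinearMap.BilinForm 𝕜 V} {C : LinearMap.BilinForm 𝕜 W} (hB : Function.Bijective B)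
    (hC : Function.Bijective C) : Function.Bijective (LinearMap.BilinForm.tmul B C) := by
  have : LinearMap.BilinForm.tmul B C = ((TensorProduct.congr (LinearEquiv.ofBijective B hB)
      (LinearEquiv.ofBijective C hC)).trans (TensorProduct.dualDistribEquiv 𝕜 V W)).toLinearMap := by
    refine TensorProduct.ext' fun a b => ?_
    refine TensorProduct.ext' fun c d => ?_
    simp [mul_comm]
  rw [this]
  exact LinearEquiv.bijective _

/-- The tensor product of symmetric forms. -/
@[reducible]
def tensor (φ : SymForm E) (ψ : SymForm F) : SymForm (E.tensor F) :=
  ofCoef (E := E.tensor F) (fun x => LinearMap.BilinForm.tmul (φ.form x) (ψ.form x))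
    (fun x => by
      obtain ⟨e, he⟩ := E.exists_cframe x
      obtain ⟨f, hf⟩ := F.exists_cframe x
      refine ⟨VecBundle.tensorFrame e f, ⟨he, hf⟩, ?_⟩
      rintro k l
      exact ((ψ.coef f k.2 l.2).mono fun y hy => hy.2).mul
        ((φ.coef e k.1 l.1).mono fun y hy => hy.1))
    (fun x => by
      have := E.finite x
      have := F.finite x
      exact tmul_bijective (φ.bijective_form x) (ψ.bijective_form x))
    (fun x v w => by
      induction v using TensorProduct.induction_on with
      | zero => simp only [map_zero, LinearMap.zero_apply]
      | add a b ha hb => simp only [map_add, LinearMap.add_apply, ha, hb]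
      | tmul a b =>
        induction w using TensorProduct.induction_on with
        | zero => simp only [map_zero]
        | add a b ha hb => simp only [map_add, ha, hb]
        | tmul c d => simp [form_inv_inv])
    (fun x v w => by
      refine bilin_tensor_ext (C := (LinearMap.BilinForm.tmul (φ.form x) (ψ.form x)).flip) ?_ v w
      intro a b c d
      simp [φ.form_symm x a, ψ.form_symm x b])

/-- The unit form `(a, b) ↦ a b` on the trivial line bundle. -/
@[reducible]
def one : SymForm (ConjBundle.one : ConjBundle 𝕜 X) :=
  ofCoef (E := ConjBundle.one) (fun _ => LinearMap.mul 𝕜 𝕜)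
    (fun x => ⟨VecBundle.oneFrame, trivial, fun k l =>
      (continuousOn_const (c := (1 : 𝕜))).congr fun y hy => by simp [Frame.one]⟩)
    (fun x => by
      constructor
      · intro a b h
        simpa using LinearMap.congr_fun h 1
      · intro f
        refine ⟨f 1, LinearMap.ext fun a => ?_⟩
        have : a = a • (1 : 𝕜) := by simp
        conv_rhs => rw [this, map_smul]
        simp [mul_comm])
    (fun x v w => by simp)
    (fun x v w => by simp [mul_comm])

/-- The zero form on the zero bundle. -/
@[reducible]
def zero : SymForm (ConjBundle.zero : ConjBundle 𝕜 X) :=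
  ofCoef (E := ConjBundle.zero) (fun _ => 0)
    (fun x => ⟨VecBundle.zeroFrame, trivial, fun k l => k.elim⟩)
    (fun x => ⟨fun a b _ => Subsingleton.elim _ _, fun f => ⟨0, LinearMap.ext fun a => by
      rw [Subsingleton.elim a 0]; simp⟩⟩)
    (fun x v w => by simp)
    (fun x v w => by simp)

/-- The pairing `((u, f), (v, g)) ↦ f v + g u` on `V ⊕ V*`. -/
@[reducible]
def hypForm (V : Type) [AddCommGroup V] [Module 𝕜 V] :
    LinearMap.BilinForm 𝕜 (V × Module.Dual 𝕜 V) :=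
  LinearMap.mk₂ 𝕜 (fun v w => v.2 w.1 + w.2 v.1)
    (fun a b c => by simp; ring) (fun r a b => by simp; ring)
    (fun a b c => by simp; ring) (fun r a b => by simp; ring)

/-- The hyperbolic form on `E ⊕ E*`. -/
@[reducible]
def hyperbolic (E : ConjBundle 𝕜 X) : SymForm (E.prod E.dual) :=
  ofCoef (E := E.prod E.dual) (fun x => hypForm (E.Fib x))
    (fun x => by
      obtain ⟨e, he⟩ := E.exists_cframe x
      refine ⟨VecBundle.prodFrame e (VecBundle.dualFrame e), ⟨he, he⟩, ?_⟩
      rintro (k | k) (l | l)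
      · refine (continuousOn_const (c := (0 : 𝕜))).congr fun y hy => ?_
        simp [Frame.prod]
      · refine ((e.2.compat e.2 l k).mono fun y hy => ⟨hy.1, hy.1⟩).congr fun y hy => ?_
        simp [Frame.prod]
      · refine ((e.2.compat e.2 k l).mono fun y hy => ⟨hy.1, hy.1⟩).congr fun y hy => ?_
        simp [Frame.prod]
      · refine (continuousOn_const (c := (0 : 𝕜))).congr fun y hy => ?_
        simp [Frame.prod])
    (fun x => by
      have := E.finite x
      constructor
      · rw [injective_iff_map_eq_zero]
        rintro ⟨v, f⟩ h
        have h1 : f = 0 := LinearMap.ext fun a => by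
          simpa using LinearMap.congr_fun h (a, 0)
        have h2 : v = 0 := (Module.forall_dual_apply_eq_zero_iff 𝕜 v).1 fun g => by
          simpa using LinearMap.congr_fun h (0, g)
        rw [h1, h2]
        rfl
      · intro f
        refine ⟨((Module.evalEquiv 𝕜 (E.Fib x)).symm (f ∘ₗ LinearMap.inr 𝕜 _ _),
          f ∘ₗ LinearMap.inl 𝕜 _ _), LinearMap.ext ?_⟩
        rintro ⟨a, b⟩
        simp only [LinearMap.mk₂_apply, LinearMap.comp_apply, LinearMap.inl_apply,
          Module.apply_evalEquiv_symm_apply, LinearMap.inr_apply, ← map_add]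
        simp)
    (fun x v w => by
      simp only [LinearMap.mk₂_apply, map_add]
      exact congrArg₂ _ (E.dualInv_inv x v.2 w.1) (E.dualInv_inv x w.2 v.1))
    (fun x v w => by simp [add_comm])

lemma baseChange_form_inj {E : ConjBundle ℝ X} (φ : SymForm E) (x : X) :
    Function.Injective ((φ.form x).baseChange ℂ) := by
  rw [injective_iff_map_eq_zero]
  intro t ht
  obtain ⟨e, he⟩ := E.exists_cframe x
  rw [← e.1.complexify.sum_coord x he t]
  refine Finset.sum_eq_zero fun i _ => ?_
  obtain ⟨w, hw⟩ := (φ.bijective_form x).2 (e.1.coord i x)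
  have key : ∀ s : ℂ ⊗[ℝ] E.Fib x, e.1.complexify.coord i x s =
      (φ.form x).baseChange ℂ s (1 ⊗ₜ w) := by
    intro s
    induction s using TensorProduct.induction_on with
    | zero => simp
    | add a b ha hb => rw [map_add, ha, hb, map_add, LinearMap.add_apply]
    | tmul c v => simp [← hw, φ.form_symm x v w]
  rw [key, ht]
  simp

/-- The complexification of a form on an equivariant real bundle: the `ℂ`-bilinear extension. -/
@[reducible]
def complexify {E : ConjBundle ℝ X} (φ : SymForm E) : SymForm E.complexify :=
  ofCoef (E := E.complexify) (fun x => (φ.form x).baseChange ℂ)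
    (fun x => by
      obtain ⟨e, he⟩ := E.exists_cframe x
      refine ⟨VecBundle.complexifyFrame e, he, fun k l => ?_⟩
      refine (Complex.continuous_ofReal.comp_continuousOn (φ.coef e k l)).congr fun y hy => ?_
      simp [Frame.complexify])
    (fun x => by
      have := E.finite x
      refine ⟨φ.baseChange_form_inj x, ?_⟩
      refine (LinearMap.injective_iff_surjective_of_finrank_eq_finrank ?_).1
        (φ.baseChange_form_inj x)
      exact (Subspace.dual_finrank_eq (K := ℂ) (V := ℂ ⊗[ℝ] E.Fib x)).symm)
    (fun x v w => by
      induction v using TensorProduct.induction_on with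
      | zero => simp only [map_zero, LinearMap.zero_apply]
      | add a b ha hb => simp only [map_add, LinearMap.add_apply, ha, hb]
      | tmul a b =>
        induction w using TensorProduct.induction_on with
        | zero => simp only [map_zero]
        | add a b ha hb => simp only [map_add, ha, hb]
        | tmul c d =>
          have h := φ.form_inv_inv x b d
          rw [conj_trivial] at h
          simp [ConjBundle.complexifyInv_tmul, h])
    (fun x v w => by
      induction v using TensorProduct.induction_on with
      | zero => simp only [map_zero, LinearMap.zero_apply]
      | add a b ha hb => simp only [map_add, LinearMap.add_apply, ha, hb]
      | tmul a b =>
        induction w using TensorProduct.induction_on with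
        | zero => simp only [map_zero, LinearMap.zero_apply]
        | add a b ha hb => simp only [map_add, LinearMap.add_apply, ha, hb]
        | tmul c d => simp [φ.form_symm x b d, mul_comm])

end SymForm

/-- Isometries of symmetric forms. -/
structure Isometry {E F : ConjBundle 𝕜 X} (φ : SymForm E) (ψ : SymForm F)
    extends ConjBundle.Iso E F where
  map_form : ∀ x u v, ψ.form x (equiv x u) (equiv x v) = φ.form x u v

/-- A Lagrangian of a symmetric form: a subbundle with involution (given by a fibrewise injective
map of bundles) which is equal to its orthogonal complement. -/
structure Lagrangian {E : ConjBundle 𝕜 X} (φ : SymForm E) where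
  bundle : ConjBundle 𝕜 X
  incl : ∀ x, bundle.Fib x →ₗ[𝕜] E.Fib x
  continuous_incl : Continuous (fun z : TotalSpace Unit bundle.Fib =>
    (⟨z.1, incl z.1 z.2⟩ : TotalSpace Unit E.Fib))
  incl_inv : ∀ x v, incl (tau x) (bundle.inv x v) = E.inv x (incl x v)
  incl_injective : ∀ x, Function.Injective (incl x)
  mem_range_iff : ∀ x v, v ∈ LinearMap.range (incl x) ↔
    ∀ w ∈ LinearMap.range (incl x), φ.form x v w = 0

end Forms

/-! ### Isomorphism classes -/

section Classes

variable [Involution X]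

namespace Isometry

variable {E F P E' F' : ConjBundle 𝕜 X} {φ : SymForm E} {ψ : SymForm F} {χ : SymForm P}
  {φ' : SymForm E'} {ψ' : SymForm F'}

/-- The identity. -/
def refl (φ : SymForm E) : Isometry φ φ where
  toIso := .refl E
  map_form _ _ _ := rfl

/-- The inverse. -/
def symm (f : Isometry φ ψ) : Isometry ψ φ where
  toIso := f.toIso.symm
  map_form x u v := by
    rw [← f.map_form]
    simp [ConjBundle.Iso.symm]

/-- Composition. -/
def trans (f : Isometry φ ψ) (g : Isometry ψ χ) : Isometry φ χ where
  toIso := f.toIso.trans g.toIso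
  map_form x u v := (g.map_form x _ _).trans (f.map_form x u v)

/-- Functoriality of the orthogonal sum. -/
def prodCongr (f : Isometry φ φ') (g : Isometry ψ ψ') : Isometry (φ.prod ψ) (φ'.prod ψ') where
  toIso := f.toIso.prodCongr g.toIso
  map_form x u v := congrArg₂ _ (f.map_form x u.1 v.1) (g.map_form x u.2 v.2)

/-- Functoriality of the tensor product. -/
def tensorCongr (f : Isometry φ φ') (g : Isometry ψ ψ') :
    Isometry (φ.tensor ψ) (φ'.tensor ψ') where
  toIso := f.toIso.tensorCongr g.toIso
  map_form x u v := by
    refine SymForm.bilin_tensor_ext (B := LinearMap.compl₁₂ ((φ'.tensor ψ').form x)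
      ((f.toIso.tensorCongr g.toIso).equiv x).toLinearMap
      ((f.toIso.tensorCongr g.toIso).equiv x).toLinearMap) (C := (φ.tensor ψ).form x) ?_ u v
    intro a b c d
    exact congrArg₂ (fun s t => s * t) (g.map_form x b d) (f.map_form x a c)

/-- Functoriality of complexification. -/
def complexifyCongr {E F : ConjBundle ℝ X} {φ : SymForm E} {ψ : SymForm F} (f : Isometry φ ψ) :
    Isometry φ.complexify ψ.complexify where
  toIso := f.toIso.complexifyCongr
  map_form x u v := by
    have hf := f.map_form x
    induction u using TensorProduct.induction_on with
    | zero => simp only [map_zero, LinearMap.zero_apply]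
    | add a b ha hb => simp only [map_add, LinearMap.add_apply, ha, hb]
    | tmul a b =>
      induction v using TensorProduct.induction_on with
      | zero => simp only [map_zero]
      | add a b ha hb => simp only [map_add, ha, hb]
      | tmul c d => exact congrArg (fun t : ℝ => t • (a * c)) (hf b d)

/-- Functoriality of the hyperbolic form. -/
def hyperbolicCongr (f : ConjBundle.Iso E F) :
    Isometry (SymForm.hyperbolic E) (SymForm.hyperbolic F) where
  toIso := f.prodCongr f.dualCongr
  map_form x u v := by
    change u.2 ((f.equiv x).symm (f.equiv x v.1)) + v.2 ((f.equiv x).symm (f.equiv x u.1)) =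
      u.2 v.1 + v.2 u.1
    simp

/-- Commutativity of the orthogonal sum. -/
def prodComm (φ : SymForm E) (ψ : SymForm F) : Isometry (φ.prod ψ) (ψ.prod φ) where
  toIso := .prodComm E F
  map_form x u v := add_comm (ψ.form x u.2 v.2) (φ.form x u.1 v.1)

/-- Associativity of the orthogonal sum. -/
def prodAssoc (φ : SymForm E) (ψ : SymForm F) (χ : SymForm P) :
    Isometry ((φ.prod ψ).prod χ) (φ.prod (ψ.prod χ)) where
  toIso := .prodAssoc E F P
  map_form x u v := (add_assoc (φ.form x u.1.1 v.1.1) (ψ.form x u.1.2 v.1.2)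
    (χ.form x u.2 v.2)).symm

/-- The zero form is neutral for the orthogonal sum. -/
def zeroProd (φ : SymForm E) : Isometry (SymForm.zero.prod φ) φ where
  toIso := .zeroProd E
  map_form x u v := (zero_add (φ.form x u.2 v.2)).symm

/-- Commutativity of the tensor product. -/
def tensorComm (φ : SymForm E) (ψ : SymForm F) : Isometry (φ.tensor ψ) (ψ.tensor φ) where
  toIso := .tensorComm E F
  map_form x u v := by
    refine SymForm.bilin_tensor_ext (B := LinearMap.compl₁₂ ((ψ.tensor φ).form x)
      ((ConjBundle.Iso.tensorComm E F).equiv x).toLinearMap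
      ((ConjBundle.Iso.tensorComm E F).equiv x).toLinearMap) (C := (φ.tensor ψ).form x) ?_ u v
    intro a b c d
    exact mul_comm (φ.form x a c) (ψ.form x b d)

/-- Associativity of the tensor product. -/
def tensorAssoc (φ : SymForm E) (ψ : SymForm F) (χ : SymForm P) :
    Isometry ((φ.tensor ψ).tensor χ) (φ.tensor (ψ.tensor χ)) where
  toIso := .tensorAssoc E F P
  map_form x u v := by
    refine SymForm.bilin_tensor_ext (B := LinearMap.compl₁₂ ((φ.tensor (ψ.tensor χ)).form x)
      ((ConjBundle.Iso.tensorAssoc E F P).equiv x).toLinearMap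
      ((ConjBundle.Iso.tensorAssoc E F P).equiv x).toLinearMap)
      (C := ((φ.tensor ψ).tensor χ).form x) ?_ u v
    intro a b c d
    induction a using TensorProduct.induction_on with
    | zero => simp only [map_zero, TensorProduct.zero_tmul, LinearMap.zero_apply]
    | add a a' ha hb => simp only [map_add, TensorProduct.add_tmul, LinearMap.add_apply, ha, hb]
    | tmul a a' =>
      induction c using TensorProduct.induction_on with
      | zero => simp only [map_zero, TensorProduct.zero_tmul]
      | add a a' ha hb => simp only [map_add, TensorProduct.add_tmul, ha, hb]
      | tmul c c' =>
        exact mul_assoc (χ.form x b d) (ψ.form x a' c') (φ.form x a c)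

/-- The unit form is neutral for the tensor product. -/
def oneTensor (φ : SymForm E) : Isometry (SymForm.one.tensor φ) φ where
  toIso := .oneTensor E
  map_form x u v := by
    refine SymForm.bilin_tensor_ext (B := LinearMap.compl₁₂ (φ.form x)
      ((ConjBundle.Iso.oneTensor E).equiv x).toLinearMap
      ((ConjBundle.Iso.oneTensor E).equiv x).toLinearMap)
      (C := (SymForm.one.tensor φ).form x) ?_ u v
    intro a b c d
    change φ.form x (a • b) (c • d) = φ.form x b d * (a * c)
    simp
    ring

/-- The tensor product with the zero form. -/
def zeroTensor (φ : SymForm E) : Isometry (SymForm.zero.tensor φ) SymForm.zero where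
  toIso := .zeroTensor E
  map_form x u v := by
    refine SymForm.bilin_tensor_ext (B := 0) (C := (SymForm.zero.tensor φ).form x) ?_ u v
    intro a b c d
    exact (mul_zero (φ.form x b d)).symm

/-- Distributivity. -/
def tensorProd (φ : SymForm E) (ψ : SymForm F) (χ : SymForm P) :
    Isometry (φ.tensor (ψ.prod χ)) ((φ.tensor ψ).prod (φ.tensor χ)) where
  toIso := .tensorProd E F P
  map_form x u v := by
    refine SymForm.bilin_tensor_ext
      (B := LinearMap.compl₁₂ (((φ.tensor ψ).prod (φ.tensor χ)).form x)
      ((ConjBundle.Iso.tensorProd E F P).equiv x).toLinearMap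
      ((ConjBundle.Iso.tensorProd E F P).equiv x).toLinearMap)
      (C := (φ.tensor (ψ.prod χ)).form x) ?_ u v
    intro a b c d
    exact (add_mul (ψ.form x b.1 d.1) (χ.form x b.2 d.2) (φ.form x a c)).symm

end Isometry

/-- Isomorphism of bundles with involution. -/
instance ConjBundle.isoSetoid : Setoid (ConjBundle 𝕜 X) where
  r E F := Nonempty (ConjBundle.Iso E F)
  iseqv := ⟨fun E => ⟨.refl E⟩, fun ⟨f⟩ => ⟨f.symm⟩, fun ⟨f⟩ ⟨g⟩ => ⟨f.trans g⟩⟩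

variable (𝕜 X) in
/-- The semiring of isomorphism classes of bundles with involution, under direct sum and tensor
product. -/
def BundleClass : Type (max u 1) := Quotient (ConjBundle.isoSetoid (𝕜 := 𝕜) (X := X))

/-- The isomorphism class of a bundle. -/
def BundleClass.mk (E : ConjBundle 𝕜 X) : BundleClass 𝕜 X := Quotient.mk _ E

instance : Zero (BundleClass 𝕜 X) := ⟨Quotient.mk _ ConjBundle.zero⟩

instance : One (BundleClass 𝕜 X) := ⟨Quotient.mk _ ConjBundle.one⟩

instance : Add (BundleClass 𝕜 X) :=
  ⟨Quotient.map₂ ConjBundle.prod fun _ _ ⟨f⟩ _ _ ⟨g⟩ => ⟨f.prodCongr g⟩⟩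

instance : Mul (BundleClass 𝕜 X) :=
  ⟨Quotient.map₂ ConjBundle.tensor fun _ _ ⟨f⟩ _ _ ⟨g⟩ => ⟨f.tensorCongr g⟩⟩

instance : CommSemiring (BundleClass 𝕜 X) where
  nsmul := nsmulRec
  npow := npowRec
  add_assoc := by
    rintro ⟨E⟩ ⟨F⟩ ⟨P⟩
    exact Quotient.sound ⟨.prodAssoc E F P⟩
  zero_add := by
    rintro ⟨E⟩
    exact Quotient.sound ⟨.zeroProd E⟩
  add_zero := by
    rintro ⟨E⟩
    exact Quotient.sound ⟨(ConjBundle.Iso.prodComm _ _).trans (.zeroProd E)⟩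
  add_comm := by
    rintro ⟨E⟩ ⟨F⟩
    exact Quotient.sound ⟨.prodComm E F⟩
  mul_assoc := by
    rintro ⟨E⟩ ⟨F⟩ ⟨P⟩
    exact Quotient.sound ⟨.tensorAssoc E F P⟩
  one_mul := by
    rintro ⟨E⟩
    exact Quotient.sound ⟨.oneTensor E⟩
  mul_one := by
    rintro ⟨E⟩
    exact Quotient.sound ⟨(ConjBundle.Iso.tensorComm _ _).trans (.oneTensor E)⟩
  mul_comm := by
    rintro ⟨E⟩ ⟨F⟩
    exact Quotient.sound ⟨.tensorComm E F⟩
  zero_mul := by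
    rintro ⟨E⟩
    exact Quotient.sound ⟨.zeroTensor E⟩
  mul_zero := by
    rintro ⟨E⟩
    exact Quotient.sound ⟨(ConjBundle.Iso.tensorComm _ _).trans (.zeroTensor E)⟩
  left_distrib := by
    rintro ⟨E⟩ ⟨F⟩ ⟨P⟩
    exact Quotient.sound ⟨.tensorProd E F P⟩
  right_distrib := by
    rintro ⟨E⟩ ⟨F⟩ ⟨P⟩
    exact Quotient.sound ⟨((ConjBundle.Iso.tensorComm _ _).trans (.tensorProd P E F)).trans
      (.prodCongr (.tensorComm _ _) (.tensorComm _ _))⟩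

/-- A bundle with involution together with a symmetric form. -/
structure FormBundle (𝕜 : Type) [RCLike 𝕜] (X : Type u) [TopologicalSpace X] [Involution X] where
  bundle : ConjBundle 𝕜 X
  form : SymForm bundle

/-- Isometry of bundles with a symmetric form. -/
instance FormBundle.isometrySetoid : Setoid (FormBundle 𝕜 X) where
  r E F := Nonempty (Isometry E.form F.form)
  iseqv := ⟨fun E => ⟨.refl E.form⟩, fun ⟨f⟩ => ⟨f.symm⟩, fun ⟨f⟩ ⟨g⟩ => ⟨f.trans g⟩⟩

variable (𝕜 X) in
/-- The semiring of isometry classes of symmetric forms, under orthogonal sum and tensor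
product. -/
def FormClass : Type (max u 1) := Quotient (FormBundle.isometrySetoid (𝕜 := 𝕜) (X := X))

/-- The isometry class of a symmetric form. -/
def FormClass.mk {E : ConjBundle 𝕜 X} (φ : SymForm E) : FormClass 𝕜 X := Quotient.mk _ ⟨E, φ⟩

instance : Zero (FormClass 𝕜 X) := ⟨Quotient.mk _ ⟨_, SymForm.zero⟩⟩

instance : One (FormClass 𝕜 X) := ⟨Quotient.mk _ ⟨_, SymForm.one⟩⟩

instance : Add (FormClass 𝕜 X) :=
  ⟨Quotient.map₂ (fun E F => ⟨_, E.form.prod F.form⟩)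
    fun _ _ ⟨f⟩ _ _ ⟨g⟩ => ⟨f.prodCongr g⟩⟩

instance : Mul (FormClass 𝕜 X) :=
  ⟨Quotient.map₂ (fun E F => ⟨_, E.form.tensor F.form⟩)
    fun _ _ ⟨f⟩ _ _ ⟨g⟩ => ⟨f.tensorCongr g⟩⟩

instance : CommSemiring (FormClass 𝕜 X) where
  nsmul := nsmulRec
  npow := npowRec
  add_assoc := by
    rintro ⟨E⟩ ⟨F⟩ ⟨P⟩
    exact Quotient.sound ⟨.prodAssoc E.form F.form P.form⟩
  zero_add := by
    rintro ⟨E⟩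
    exact Quotient.sound ⟨.zeroProd E.form⟩
  add_zero := by
    rintro ⟨E⟩
    exact Quotient.sound ⟨(Isometry.prodComm _ _).trans (.zeroProd E.form)⟩
  add_comm := by
    rintro ⟨E⟩ ⟨F⟩
    exact Quotient.sound ⟨.prodComm E.form F.form⟩
  mul_assoc := by
    rintro ⟨E⟩ ⟨F⟩ ⟨P⟩
    exact Quotient.sound ⟨.tensorAssoc E.form F.form P.form⟩
  one_mul := by
    rintro ⟨E⟩
    exact Quotient.sound ⟨.oneTensor E.form⟩
  mul_one := by
    rintro ⟨E⟩
    exact Quotient.sound ⟨(Isometry.tensorComm _ _).trans (.oneTensor E.form)⟩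
  mul_comm := by
    rintro ⟨E⟩ ⟨F⟩
    exact Quotient.sound ⟨.tensorComm E.form F.form⟩
  zero_mul := by
    rintro ⟨E⟩
    exact Quotient.sound ⟨.zeroTensor E.form⟩
  mul_zero := by
    rintro ⟨E⟩
    exact Quotient.sound ⟨(Isometry.tensorComm _ _).trans (.zeroTensor E.form)⟩
  left_distrib := by
    rintro ⟨E⟩ ⟨F⟩ ⟨P⟩
    exact Quotient.sound ⟨.tensorProd E.form F.form P.form⟩
  right_distrib := by
    rintro ⟨E⟩ ⟨F⟩ ⟨P⟩
    exact Quotient.sound ⟨((Isometry.tensorComm _ _).trans (.tensorProd P.form E.form F.form)).trans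
      (.prodCongr (.tensorComm _ _) (.tensorComm _ _))⟩

end Classes

/-! ### The Grothendieck ring of a commutative semiring -/

section Grothendieck

open Algebra (GrothendieckAddGroup)

variable {S : Type w} [CommSemiring S]

lemma grothendieck_induction {p : GrothendieckAddGroup S → Prop} (a : GrothendieckAddGroup S)
    (h : ∀ s t : S, p (GrothendieckAddGroup.of s - GrothendieckAddGroup.of t)) : p a := by
  induction a using AddLocalization.ind with
  | _ y =>
    obtain ⟨s, t⟩ := y
    have := h s t
    have e : AddLocalization.mk s t = GrothendieckAddGroup.of s - GrothendieckAddGroup.of (t : S) := by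
      rw [eq_sub_iff_add_eq]
      simp only [GrothendieckAddGroup.of, AddSubmonoid.LocalizationMap.toAddMonoidHom]
      change _ + AddLocalization.mk (t : S) 0 = AddLocalization.mk s 0
      rw [AddLocalization.mk_add, AddLocalization.mk_eq_mk_iff, AddLocalization.r_iff_exists]
      exact ⟨0, by simp [add_comm]⟩
    rwa [e]

lemma grothendieck_lift_of {A : Type*} [AddCommGroup A] (f : S →+ A) (s : S) :
    GrothendieckAddGroup.lift f (GrothendieckAddGroup.of s) = f s :=
  DFunLike.congr_fun (GrothendieckAddGroup.lift.symm_apply_apply f) s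

lemma grothendieck_hom_ext {A : Type*} [AddCommGroup A] {f g : GrothendieckAddGroup S →+ A}
    (h : ∀ s : S, f (GrothendieckAddGroup.of s) = g (GrothendieckAddGroup.of s)) : f = g :=
  GrothendieckAddGroup.lift.symm.injective (AddMonoidHom.ext h)

/-- The multiplication of the Grothendieck group of a semiring, as a biadditive map. -/
def grothendieckMul : GrothendieckAddGroup S →+ GrothendieckAddGroup S →+ GrothendieckAddGroup S :=
  GrothendieckAddGroup.lift
    { toFun := fun s => GrothendieckAddGroup.lift
        (GrothendieckAddGroup.of.comp (AddMonoidHom.mulLeft s))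
      map_zero' := grothendieck_hom_ext fun t => by
        simp only [grothendieck_lift_of, AddMonoidHom.comp_apply, AddMonoidHom.coe_mulLeft,
          zero_mul, map_zero, AddMonoidHom.zero_apply]
      map_add' := fun s t => grothendieck_hom_ext fun r => by
        simp only [grothendieck_lift_of, AddMonoidHom.comp_apply, AddMonoidHom.coe_mulLeft,
          add_mul, map_add, AddMonoidHom.add_apply] }

lemma grothendieckMul_of (s t : S) :
    grothendieckMul (GrothendieckAddGroup.of s) (GrothendieckAddGroup.of t) =
      GrothendieckAddGroup.of (s * t) :=
  (DFunLike.congr_fun (grothendieck_lift_of _ s) (GrothendieckAddGroup.of t)).trans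
    (grothendieck_lift_of _ t)

/-- The Grothendieck ring of a commutative semiring: the multiplication on the Grothendieck group
of the additive monoid which extends the one of the semiring. -/
instance grothendieckCommRing : CommRing (GrothendieckAddGroup S) where
  __ := (inferInstance : AddCommGroup (GrothendieckAddGroup S))
  mul a b := grothendieckMul a b
  one := GrothendieckAddGroup.of 1
  zero_mul a := by
    change grothendieckMul 0 a = 0
    simp
  mul_zero a := by
    change grothendieckMul a 0 = 0
    simp
  left_distrib a b c := map_add (grothendieckMul a) b c
  right_distrib a b c := by
    change grothendieckMul (a + b) c = _
    rw [map_add]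
    rfl
  mul_assoc a b c := by
    change grothendieckMul (grothendieckMul a b) c = grothendieckMul a (grothendieckMul b c)
    induction a using grothendieck_induction with
    | h s s' =>
      induction b using grothendieck_induction with
      | h t t' =>
        induction c using grothendieck_induction with
        | h r r' => simp only [map_sub, AddMonoidHom.sub_apply, grothendieckMul_of, mul_assoc]
  mul_comm a b := by
    change grothendieckMul a b = grothendieckMul b a
    induction a using grothendieck_induction with
    | h s s' =>
      induction b using grothendieck_induction with
      | h t t' =>
        simp only [map_sub, AddMonoidHom.sub_apply, grothendieckMul_of, mul_comm]
        abel
  one_mul a := by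
    change grothendieckMul (GrothendieckAddGroup.of 1) a = a
    induction a using grothendieck_induction with
    | h s s' => simp only [map_sub, grothendieckMul_of, one_mul]
  mul_one a := by
    change grothendieckMul a (GrothendieckAddGroup.of 1) = a
    induction a using grothendieck_induction with
    | h s s' => simp only [map_sub, AddMonoidHom.sub_apply, grothendieckMul_of, mul_one]

end Grothendieck

/-! ### The rings `KO_G`, `KR`, `GR` and the maps between them -/

section KTheory

open Algebra (GrothendieckAddGroup)

variable (X) [Involution X]

/-- `KR(X)`: the Grothendieck ring of Real vector bundles on `X`. -/
abbrev KR : Type (max u 1) := GrothendieckAddGroup (BundleClass ℂ X)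

/-- `KO_G(X)`: the Grothendieck ring of `G`-equivariant real vector bundles on `X`, where `G` is
the group of order two acting through the involution. -/
abbrev KOG : Type (max u 1) := GrothendieckAddGroup (BundleClass ℝ X)

variable {X}

/-- The class of a bundle with involution in the Grothendieck ring. -/
def ConjBundle.cls (E : ConjBundle 𝕜 X) : GrothendieckAddGroup (BundleClass 𝕜 X) :=
  GrothendieckAddGroup.of (BundleClass.mk E)

/-- The class of a symmetric form in the Grothendieck ring of isometry classes of forms. -/
def SymForm.preCls {E : ConjBundle 𝕜 X} (φ : SymForm E) : GrothendieckAddGroup (FormClass 𝕜 X) :=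
  GrothendieckAddGroup.of (FormClass.mk φ)

variable (X) in
/-- The elements `[E, φ] - [H(L)]`, where `L` is a Lagrangian of the Real symmetric form
`(E, φ)`. -/
def lagrangianRelations : Set (GrothendieckAddGroup (FormClass ℂ X)) :=
  {a | ∃ (E : ConjBundle ℂ X) (φ : SymForm E) (L : Lagrangian φ),
    a = φ.preCls - (SymForm.hyperbolic L.bundle).preCls}

variable (X) in
/-- `GR(X)`: the Grothendieck-Witt ring of Real vector bundles on `X`, that is, the Grothendieck
ring of Real symmetric forms modulo the relations `[E, φ] = [H(L)]` for each Lagrangian `L`. -/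
abbrev GR : Type (max u 1) :=
  GrothendieckAddGroup (FormClass ℂ X) ⧸ Ideal.span (lagrangianRelations X)

/-- The class of a Real symmetric form in `GR(X)`. -/
def SymForm.cls {E : ConjBundle ℂ X} (φ : SymForm E) : GR X := Ideal.Quotient.mk _ φ.preCls

lemma ConjBundle.cls_congr {E F : ConjBundle 𝕜 X} (f : Iso E F) : E.cls = F.cls :=
  congrArg GrothendieckAddGroup.of (Quotient.sound ⟨f⟩)

lemma ConjBundle.cls_prod (E F : ConjBundle 𝕜 X) : (E.prod F).cls = E.cls + F.cls :=
  map_add (GrothendieckAddGroup.of (M := BundleClass 𝕜 X)) (BundleClass.mk E) (BundleClass.mk F)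

lemma SymForm.cls_congr {E F : ConjBundle ℂ X} {φ : SymForm E} {ψ : SymForm F}
    (f : Isometry φ ψ) : φ.cls = ψ.cls :=
  congrArg (fun a : FormClass ℂ X => (Ideal.Quotient.mk _ (GrothendieckAddGroup.of a) : GR X))
    (Quotient.sound ⟨f⟩)

lemma SymForm.cls_prod {E F : ConjBundle ℂ X} (φ : SymForm E) (ψ : SymForm F) :
    (φ.prod ψ).cls = φ.cls + ψ.cls := by
  have : (φ.prod ψ).preCls = φ.preCls + ψ.preCls :=
    map_add (GrothendieckAddGroup.of (M := FormClass ℂ X)) (FormClass.mk φ) (FormClass.mk ψ)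
  rw [SymForm.cls, this, map_add]
  rfl

/-- A function on bundles with involution which respects isomorphisms and direct sums induces a
homomorphism on the Grothendieck group. -/
def liftK {A : Type*} [AddCommGroup A] (f : ConjBundle 𝕜 X → A)
    (hcongr : ∀ E F, ConjBundle.Iso E F → f E = f F)
    (hprod : ∀ E F, f (ConjBundle.prod E F) = f E + f F) :
    GrothendieckAddGroup (BundleClass 𝕜 X) →+ A :=
  GrothendieckAddGroup.lift
    { toFun := Quotient.lift f fun E F ⟨g⟩ => hcongr E F g
      map_zero' := by
        change f ConjBundle.zero = 0
        have h := hcongr _ _ (ConjBundle.Iso.zeroProd (ConjBundle.zero : ConjBundle 𝕜 X))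
        rw [hprod] at h
        simpa using h
      map_add' := by
        rintro ⟨E⟩ ⟨F⟩
        exact hprod E F }

lemma liftK_cls {A : Type*} [AddCommGroup A] (f : ConjBundle 𝕜 X → A)
    (hcongr : ∀ E F, ConjBundle.Iso E F → f E = f F)
    (hprod : ∀ E F, f (ConjBundle.prod E F) = f E + f F) (E : ConjBundle 𝕜 X) :
    liftK f hcongr hprod E.cls = f E :=
  grothendieck_lift_of _ _

namespace ConjBundle

/-- Complexification is compatible with direct sums. -/
def Iso.complexifyProd (E F : ConjBundle ℝ X) :
    Iso (E.prod F).complexify (E.complexify.prod F.complexify) :=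
  ofCoef (E := (E.prod F).complexify) (F := E.complexify.prod F.complexify)
    (fun x => TensorProduct.prodRight ℝ ℂ _ _ _)
    (fun x => by
      obtain ⟨e, he⟩ := E.exists_cframe x
      obtain ⟨f, hf⟩ := F.exists_cframe x
      have hec := fun k l => Complex.continuous_ofReal.comp_continuousOn (e.2.compat e.2 k l)
      have hfc := fun k l => Complex.continuous_ofReal.comp_continuousOn (f.2.compat f.2 k l)
      refine ⟨VecBundle.complexifyFrame (VecBundle.prodFrame e f),
        VecBundle.prodFrame (VecBundle.complexifyFrame e) (VecBundle.complexifyFrame f),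
        ⟨he, hf⟩, ⟨he, hf⟩, ?_, ?_⟩
      · rintro (k | k) (l | l)
        · refine ((hec k l).mono fun y hy => ⟨hy.1.1, hy.1.1⟩).congr fun y hy => ?_
          simp
        · simpa using continuousOn_const
        · simpa using continuousOn_const
        · refine ((hfc k l).mono fun y hy => ⟨hy.1.2, hy.1.2⟩).congr fun y hy => ?_
          simp
      · have hl : ∀ y (v : E.Fib y), (TensorProduct.prodRight ℝ ℂ ℂ (E.Fib y) (F.Fib y)).symm
            (1 ⊗ₜ v, 0) = 1 ⊗ₜ (v, 0) := fun y v => by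
          rw [LinearEquiv.symm_apply_eq]; simp
        have hr : ∀ y (v : F.Fib y), (TensorProduct.prodRight ℝ ℂ ℂ (E.Fib y) (F.Fib y)).symm
            (0, 1 ⊗ₜ v) = 1 ⊗ₜ (0, v) := fun y v => by
          rw [LinearEquiv.symm_apply_eq]; simp
        rintro (k | k) (l | l)
        · refine ((hec k l).mono fun y hy => ⟨hy.1.1, hy.1.1⟩).congr fun y hy => ?_
          simp [hl]
        · simpa [hr] using continuousOn_const
        · simpa [hl] using continuousOn_const
        · refine ((hfc k l).mono fun y hy => ⟨hy.1.2, hy.1.2⟩).congr fun y hy => ?_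
          simp [hr])
    (fun x v => by
      induction v using TensorProduct.induction_on with
      | zero => simp only [map_zero]
      | add a b ha hb => simp only [map_add, ha, hb]
      | tmul v w => rfl)

/-- Passage to the underlying real bundle is compatible with direct sums. -/
def Iso.realifyProd (E F : ConjBundle ℂ X) :
    Iso (E.prod F).realify (E.realify.prod F.realify) :=
  ofCoef (E := (E.prod F).realify) (F := E.realify.prod F.realify)
    (fun x => LinearEquiv.refl ℝ _)
    (fun x => by
      obtain ⟨e, he⟩ := E.exists_cframe x
      obtain ⟨f, hf⟩ := F.exists_cframe x
      have hec := (VecBundle.realifyFrame e).2.compat (VecBundle.realifyFrame e).2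
      have hfc := (VecBundle.realifyFrame f).2.compat (VecBundle.realifyFrame f).2
      refine ⟨VecBundle.realifyFrame (VecBundle.prodFrame e f),
        VecBundle.prodFrame (VecBundle.realifyFrame e) (VecBundle.realifyFrame f),
        ⟨he, hf⟩, ⟨he, hf⟩, ?_, ?_⟩
      · rintro (k | k) l
        · rcases k with k | k <;> rcases l with (l | l) | (l | l)
          all_goals first
            | exact (hec (Sum.inl k) (Sum.inl l)).mono fun y hy => ⟨hy.1.1, hy.1.1⟩
            | exact (hec (Sum.inl k) (Sum.inr l)).mono fun y hy => ⟨hy.1.1, hy.1.1⟩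
            | exact (hec (Sum.inr k) (Sum.inl l)).mono fun y hy => ⟨hy.1.1, hy.1.1⟩
            | exact (hec (Sum.inr k) (Sum.inr l)).mono fun y hy => ⟨hy.1.1, hy.1.1⟩
            | exact (continuousOn_const (c := (0 : ℝ))).congr fun y hy => by simp [Frame.prod]
        · rcases k with k | k <;> rcases l with (l | l) | (l | l)
          all_goals first
            | exact (hfc (Sum.inl k) (Sum.inl l)).mono fun y hy => ⟨hy.1.2, hy.1.2⟩
            | exact (hfc (Sum.inl k) (Sum.inr l)).mono fun y hy => ⟨hy.1.2, hy.1.2⟩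
            | exact (hfc (Sum.inr k) (Sum.inl l)).mono fun y hy => ⟨hy.1.2, hy.1.2⟩
            | exact (hfc (Sum.inr k) (Sum.inr l)).mono fun y hy => ⟨hy.1.2, hy.1.2⟩
            | exact (continuousOn_const (c := (0 : ℝ))).congr fun y hy => by simp [Frame.prod]
      · rintro ((k | k) | (k | k)) ((l | l) | (l | l))
        all_goals first
          | exact (hec (Sum.inl k) (Sum.inl l)).mono fun y hy => ⟨hy.1.1, hy.1.1⟩
          | exact (hec (Sum.inl k) (Sum.inr l)).mono fun y hy => ⟨hy.1.1, hy.1.1⟩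
          | exact (hec (Sum.inr k) (Sum.inl l)).mono fun y hy => ⟨hy.1.1, hy.1.1⟩
          | exact (hec (Sum.inr k) (Sum.inr l)).mono fun y hy => ⟨hy.1.1, hy.1.1⟩
          | exact (hfc (Sum.inl k) (Sum.inl l)).mono fun y hy => ⟨hy.1.2, hy.1.2⟩
          | exact (hfc (Sum.inl k) (Sum.inr l)).mono fun y hy => ⟨hy.1.2, hy.1.2⟩
          | exact (hfc (Sum.inr k) (Sum.inl l)).mono fun y hy => ⟨hy.1.2, hy.1.2⟩
          | exact (hfc (Sum.inr k) (Sum.inr l)).mono fun y hy => ⟨hy.1.2, hy.1.2⟩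
          | exact (continuousOn_const (c := (0 : ℝ))).congr fun y hy => by simp [Frame.prod])
    (fun x v => rfl)

/-- The components of a linear form on a direct sum. -/
@[reducible]
def hypSplit (V W : Type) [AddCommGroup V] [AddCommGroup W] [Module 𝕜 V] [Module 𝕜 W] :
    ((V × W) × Module.Dual 𝕜 (V × W)) ≃ₗ[𝕜]
      ((V × Module.Dual 𝕜 V) × (W × Module.Dual 𝕜 W)) where
  toFun p := ((p.1.1, p.2 ∘ₗ LinearMap.inl 𝕜 V W), (p.1.2, p.2 ∘ₗ LinearMap.inr 𝕜 V W))
  invFun p := ((p.1.1, p.2.1), p.1.2.coprod p.2.2)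
  map_add' p q := rfl
  map_smul' c p := rfl
  left_inv p := by
    refine Prod.ext rfl (LinearMap.ext fun v => ?_)
    simp [← map_add]
  right_inv p := by
    refine Prod.ext (Prod.ext rfl ?_) (Prod.ext rfl ?_) <;> ext <;> simp

/-- The isomorphism `H(E ⊕ F) ≅ H(E) ⊕ H(F)` on the underlying bundles. -/
def Iso.hyperbolicProd (E F : ConjBundle 𝕜 X) :
    Iso ((E.prod F).prod (E.prod F).dual) ((E.prod E.dual).prod (F.prod F.dual)) :=
  ofCoef (E := (E.prod F).prod (E.prod F).dual) (F := (E.prod E.dual).prod (F.prod F.dual))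
    (fun x => hypSplit (E.Fib x) (F.Fib x))
    (fun x => by
      obtain ⟨e, he⟩ := E.exists_cframe x
      obtain ⟨f, hf⟩ := F.exists_cframe x
      have hec := e.2.compat e.2
      have hfc := f.2.compat f.2
      refine ⟨VecBundle.prodFrame (VecBundle.prodFrame e f)
          (VecBundle.dualFrame (VecBundle.prodFrame e f)),
        VecBundle.prodFrame (VecBundle.prodFrame e (VecBundle.dualFrame e))
          (VecBundle.prodFrame f (VecBundle.dualFrame f)),
        ⟨⟨he, hf⟩, ⟨he, hf⟩⟩, ⟨⟨he, he⟩, ⟨hf, hf⟩⟩, ?_, ?_⟩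
      · rintro ((k | k) | (k | k)) ((l | l) | (l | l))
        all_goals first
          | exact (hec k l).mono fun y hy => ⟨hy.1.1.1, hy.1.1.1⟩
          | exact (hec l k).mono fun y hy => ⟨hy.1.1.1, hy.1.1.1⟩
          | exact (hfc k l).mono fun y hy => ⟨hy.1.1.2, hy.1.1.2⟩
          | exact (hfc l k).mono fun y hy => ⟨hy.1.1.2, hy.1.1.2⟩
          | exact (continuousOn_const (c := (0 : 𝕜))).congr fun y hy => by simp [Frame.prod]
      · rintro ((k | k) | (k | k)) ((l | l) | (l | l))
        all_goals first
          | exact (hec k l).mono fun y hy => ⟨hy.1.1.1, hy.1.1.1⟩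
          | exact (hfc k l).mono fun y hy => ⟨hy.1.1.2, hy.1.1.2⟩
          | (refine ((hec l k).mono fun y hy => ⟨hy.1.1.1, hy.1.1.1⟩).congr fun y hy => ?_
             simp [Frame.prod, hypSplit]
             done)
          | (refine ((hfc l k).mono fun y hy => ⟨hy.1.1.2, hy.1.1.2⟩).congr fun y hy => ?_
             simp [Frame.prod, hypSplit]
             done)
          | (refine (continuousOn_const (c := (0 : 𝕜))).congr fun y hy => ?_
             simp [Frame.prod, hypSplit]
             done))
    (fun x v => by
      have key1 : ∀ (g : Module.Dual 𝕜 (E.Fib x × F.Fib x)), (E.prod F).dualInv x g ∘ₗ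
          LinearMap.inl 𝕜 _ _ = E.dualInv x (g ∘ₗ LinearMap.inl 𝕜 _ _) := by
        intro g
        refine LinearMap.ext fun u => ?_
        obtain ⟨w, rfl⟩ := (E.inv_bijective x).2 u
        rw [dualInv_inv]
        have h : (E.prod F).dualInv x g (E.inv x w, F.inv x 0) = starRingEnd 𝕜 (g (w, 0)) :=
          (E.prod F).dualInv_inv x g (w, 0)
        rw [map_zero] at h
        exact h
      have key2 : ∀ (g : Module.Dual 𝕜 (E.Fib x × F.Fib x)), (E.prod F).dualInv x g ∘ₗ
          LinearMap.inr 𝕜 _ _ = F.dualInv x (g ∘ₗ LinearMap.inr 𝕜 _ _) := by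
        intro g
        refine LinearMap.ext fun u => ?_
        obtain ⟨w, rfl⟩ := (F.inv_bijective x).2 u
        rw [dualInv_inv]
        have h : (E.prod F).dualInv x g (E.inv x 0, F.inv x w) = starRingEnd 𝕜 (g (0, w)) :=
          (E.prod F).dualInv_inv x g (0, w)
        rw [map_zero] at h
        exact h
      exact Prod.ext (Prod.ext rfl (key1 v.2)) (Prod.ext rfl (key2 v.2)))

end ConjBundle

/-- The hyperbolic form of a direct sum. -/
def Isometry.hyperbolicProd (E F : ConjBundle 𝕜 X) :
    Isometry (SymForm.hyperbolic (E.prod F))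
      ((SymForm.hyperbolic E).prod (SymForm.hyperbolic F)) where
  toIso := .hyperbolicProd E F
  map_form x u v := by
    have h : ∀ (f : Module.Dual 𝕜 (E.Fib x × F.Fib x)) (p : E.Fib x × F.Fib x),
        f (p.1, 0) + f (0, p.2) = f p := fun f p => by rw [← map_add]; simp
    change (u.2 (v.1.1, 0) + v.2 (u.1.1, 0)) + (u.2 (0, v.1.2) + v.2 (0, u.1.2)) =
      u.2 v.1 + v.2 u.1
    rw [← h u.2 v.1, ← h v.2 u.1]
    ring

/-- The complexification map `KO_G(X) → KR(X)`, `[F] ↦ [ℂ ⊗ F]`. -/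
def complexification : KOG X →+ KR X :=
  liftK (fun F : ConjBundle ℝ X => F.complexify.cls)
    (fun _ _ f => ConjBundle.cls_congr f.complexifyCongr)
    (fun E F => (ConjBundle.cls_congr (.complexifyProd E F)).trans (ConjBundle.cls_prod _ _))

/-- The map `KR(X) → KO_G(X)` which sends a Real bundle to its underlying equivariant real
bundle. -/
def realification : KR X →+ KOG X :=
  liftK (fun E : ConjBundle ℂ X => E.realify.cls)
    (fun _ _ f => ConjBundle.cls_congr f.realifyCongr)
    (fun E F => (ConjBundle.cls_congr (.realifyProd E F)).trans (ConjBundle.cls_prod _ _))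

/-- The hyperbolic map `KR(X) → GR(X)`, `[E] ↦ [H(E)]`. -/
def hyperbolicMap : KR X →+ GR X :=
  liftK (fun E : ConjBundle ℂ X => (SymForm.hyperbolic E).cls)
    (fun _ _ f => SymForm.cls_congr (.hyperbolicCongr f))
    (fun E F => (SymForm.cls_congr (.hyperbolicProd E F)).trans (SymForm.cls_prod _ _))

lemma complexification_cls (F : ConjBundle ℝ X) : complexification F.cls = F.complexify.cls :=
  liftK_cls _ _ _ F

lemma realification_cls (E : ConjBundle ℂ X) : realification E.cls = E.realify.cls :=
  liftK_cls _ _ _ E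

lemma hyperbolicMap_cls (E : ConjBundle ℂ X) :
    hyperbolicMap E.cls = (SymForm.hyperbolic E).cls :=
  liftK_cls _ _ _ E

end KTheory

end

end RealK

/-!
The complexification of an invariant metric remembers the metric up to isometry, and every Real
symmetric form arises in this way, already before passing to the Grothendieck ring. So the semiring
of isomorphism classes of equivariant real bundles is isomorphic to the semiring of isometry classes
of Real symmetric forms (`complexifyClassEquiv`), and the rest is formal. Four facts carry this.

* *Invariant metrics exist* (`exists_invariantMetric`) and any two of them on a bundle are isometric
  (`nonempty_isometry_of_invariantMetric`). A metric is built by induction over the skeleta. Over a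
  closed ball it is extended from the boundary sphere by means of a partition of unity, and it is
  continuous because continuity on a CW complex can be checked on closed cells. Summing over the
  group makes it invariant. If `θ' u v = θ (B u) v`, the positive square root of `B` carries `θ'` to
  `θ`. The square root is continuous (`continuous_root`): its matrix is locally bounded, and every
  limit of square roots is the unique positive square root of the limit.

* *Every Real symmetric form has a real structure* (`nonempty_realStructure`). Represent the real
  part of the form by an operator `A` with respect to an invariant Hermitian metric. It is antilinear
  and self-adjoint, and `J = A |A|⁻¹` is an antilinear involution for which the form is real and
  positive definite on the fixed vectors. The fixed vectors of `J` form an equivariant real bundle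
  with a metric whose complexification is the given form (`RealStructure.isometry`).

* *The real bundle can be recovered* (`Isometry.nonempty_iso`). Let `N` be a real subbundle of
  `ℂ ⊗ F`, of the same real rank as `F`, on which `re θ_ℂ` is not negative. A vector of `N` with
  vanishing real part is `i ⊗ w`, with square `-θ(w, w)`, so it vanishes. Hence taking real parts is
  an isomorphism from `N` to `F` (`nonempty_iso_of_form_nonneg`). This applies to the image of
  `1 ⊗ F'` under an isometry of complexifications.

* *The Lagrangian relations hold for isometry classes* (`Lagrangian.nonempty_isometry`). The form
  vanishes on a Lagrangian `L`, so the same comparison shows that `L`, as a real bundle, is isomorphic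
  to any `F` with `(E, φ) ≅ (ℂ ⊗ F, θ_ℂ)`. Since `L` is also a Lagrangian of `H(L)`, the forms `φ`
  and `H(L)` are complexifications of metrics on isomorphic bundles. So the ideal defining `GR(X)`
  is zero, the forgetful map is defined on isometry classes, and `H(L)` is the complexification of a
  metric on the real bundle underlying `L` (`nonempty_isometry_hyperbolic`), which gives the
  description of the hyperbolic map.
-/

namespace RealK

open Bundle Set Topology
open scoped TensorProduct

universe u

noncomputable section

open Involution (tau continuous_tau tau_tau)

/-! ### Fields of bilinear forms -/

section FormFields

variable {X : Type u} [TopologicalSpace X]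

/-- A symmetric positive definite bilinear form on a real vector space. -/
def IsMetric {V : Type} [AddCommGroup V] [Module ℝ V] (b : LinearMap.BilinForm ℝ V) : Prop :=
  (∀ u v, b u v = b v u) ∧ ∀ v, v ≠ 0 → 0 < b v v

/-- Metrics form a convex set. -/
lemma IsMetric.sum_smul {V : Type} [AddCommGroup V] [Module ℝ V] {ι : Type*} [Fintype ι]
    {b : ι → LinearMap.BilinForm ℝ V} {c : ι → ℝ} (hc : ∀ i, 0 ≤ c i) (h1 : ∑ i, c i = 1)
    (hb : ∀ i, c i ≠ 0 → IsMetric (b i)) : IsMetric (∑ i, c i • b i) := by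
  have happ : ∀ u v, (∑ i, c i • b i) u v = ∑ i, c i * b i u v := fun u v => by
    simp [LinearMap.sum_apply]
  refine ⟨fun u v => ?_, fun v hv => ?_⟩
  · rw [happ, happ]
    refine Finset.sum_congr rfl fun i _ => ?_
    by_cases h : c i = 0
    · simp [h]
    · rw [(hb i h).1]
  · rw [happ]
    obtain ⟨i, hi⟩ : ∃ i, c i ≠ 0 := by
      by_contra! h
      simp [h] at h1
    refine Finset.sum_pos' (fun j _ => ?_) ⟨i, Finset.mem_univ _, ?_⟩
    · by_cases h : c j = 0
      · simp [h]
      · exact mul_nonneg (hc j) ((hb j h).2 v hv).le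
    · exact mul_pos (lt_of_le_of_ne (hc i) hi.symm) ((hb i hi).2 v hv)

variable (E : VecBundle ℝ X) {K : Type*} [TopologicalSpace K]

/-- Continuity on `s` of a family of bilinear forms on the fibres of a bundle along a map `f`
into the base: the matrix coefficients with respect to all continuous frames are continuous. -/
def ContForm (f : K → X) (θ : ∀ z, LinearMap.BilinForm ℝ (E.Fib (f z))) (s : Set K) : Prop :=
  ∀ (e : E.CFrame), ∀ z ∈ s, f z ∈ e.1.U → ∀ k l,
    ContinuousWithinAt (fun w => θ w (e.1.vec k (f w)) (e.1.vec l (f w))) s z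

variable {E}

/-- The form with given matrix in a frame. -/
def matForm (e : E.CFrame) (x : X) (a : e.1.ι → e.1.ι → ℝ) : LinearMap.BilinForm ℝ (E.Fib x) :=
  ∑ k, ∑ l, a k l • (LinearMap.mul ℝ ℝ).compl₁₂ (e.1.coord k x) (e.1.coord l x)

lemma matForm_apply (e : E.CFrame) (x : X) (a : e.1.ι → e.1.ι → ℝ) (u v : E.Fib x) :
    matForm e x a u v = ∑ k, ∑ l, a k l * (e.1.coord k x u * e.1.coord l x v) := by
  simp [matForm, LinearMap.sum_apply]

/-- A bilinear form is determined by its matrix in a frame. -/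
lemma matForm_eq (e : E.CFrame) {x : X} (hx : x ∈ e.1.U) (b : LinearMap.BilinForm ℝ (E.Fib x)) :
    matForm e x (fun k l => b (e.1.vec k x) (e.1.vec l x)) = b := by
  refine LinearMap.ext fun u => LinearMap.ext fun v => ?_
  rw [matForm_apply]
  conv_rhs => rw [← e.1.sum_coord x hx u, ← e.1.sum_coord x hx v]
  simp only [map_sum, LinearMap.sum_apply, map_smul, LinearMap.smul_apply, smul_eq_mul]
  rw [Finset.sum_comm]
  refine Finset.sum_congr rfl fun k _ => ?_
  rw [Finset.mul_sum]
  exact Finset.sum_congr rfl fun l _ => by ring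

/-- The matrix of a metric defines a metric at every point of the frame. -/
lemma isMetric_matForm (e : E.CFrame) {x y : X} (hx : x ∈ e.1.U) (hy : y ∈ e.1.U)
    {b : LinearMap.BilinForm ℝ (E.Fib y)} (hb : IsMetric b) :
    IsMetric (matForm e x (fun k l => b (e.1.vec k y) (e.1.vec l y))) := by
  have key : ∀ u v : E.Fib x, matForm e x (fun k l => b (e.1.vec k y) (e.1.vec l y)) u v =
      b (∑ k, e.1.coord k x u • e.1.vec k y) (∑ l, e.1.coord l x v • e.1.vec l y) := by
    intro u v
    rw [matForm_apply]
    simp only [map_sum, LinearMap.sum_apply, map_smul, LinearMap.smul_apply, smul_eq_mul]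
    rw [Finset.sum_comm]
    refine Finset.sum_congr rfl fun k _ => ?_
    rw [Finset.mul_sum]
    exact Finset.sum_congr rfl fun l _ => by ring
  refine ⟨fun u v => by rw [key, key, hb.1], fun v hv => ?_⟩
  rw [key]
  refine hb.2 _ fun h0 => hv ?_
  rw [← e.1.sum_coord x hx v]
  refine Finset.sum_eq_zero fun k _ => ?_
  rw [← e.1.coord_sum hy (fun k => e.1.coord k x v) k, h0, map_zero, zero_smul]

lemma isMetric_matForm_one (e : E.CFrame) {x : X} (hx : x ∈ e.1.U) :
    IsMetric (matForm e x (fun k l => if k = l then 1 else 0)) := by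
  have key : ∀ u v : E.Fib x, matForm e x (fun k l => if k = l then 1 else 0) u v =
      ∑ k, e.1.coord k x u * e.1.coord k x v := fun u v => by
    simp [matForm_apply]
  refine ⟨fun u v => by simp only [key, mul_comm], fun v hv => ?_⟩
  rw [key]
  refine lt_of_le_of_ne (Finset.sum_nonneg fun k _ => mul_self_nonneg _) fun h => hv ?_
  rw [← e.1.sum_coord x hx v]
  refine Finset.sum_eq_zero fun k hk => ?_
  rw [mul_self_eq_zero.1 ((Finset.sum_eq_zero_iff_of_nonneg
    fun k _ => mul_self_nonneg _).1 h.symm k hk), zero_smul]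

lemma contForm_matForm (e : E.CFrame) {f : K → X} (hf : Continuous f) {s : Set K}
    (hs : ∀ z ∈ s, f z ∈ e.1.U) {a : K → e.1.ι → e.1.ι → ℝ}
    (ha : ∀ k l, ContinuousOn (fun z => a z k l) s) :
    ContForm E f (fun z => matForm e (f z) (a z)) s := by
  intro g z hz hg i j
  simp only [matForm_apply]
  have hc : ∀ k i, ContinuousWithinAt (fun w => e.1.coord k (f w) (g.1.vec i (f w))) s z := by
    intro k i
    have h1 : ContinuousAt (fun y => e.1.coord k y (g.1.vec i y)) (f z) :=
      (e.2.compat g.2 k i).continuousAt ((e.1.isOpen.inter g.1.isOpen).mem_nhds ⟨hs z hz, hg⟩)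
    exact (ContinuousAt.comp (f := f) h1 hf.continuousAt).continuousWithinAt
  exact tendsto_finsetSum _ fun k _ => tendsto_finsetSum _ fun l _ =>
    (ha k l z hz).mul ((hc k i).mul (hc l j))

/-- Extension of metrics from a closed neighbourhood retract of a compact space: locally the
metric is extended by keeping its matrix constant along the retraction, and the local extensions
are combined by a partition of unity. -/
theorem exists_metric_extension [CompactSpace K] [T2Space K] {f : K → X} (hf : Continuous f)
    {S O : Set K} (hS : IsClosed S) (hO : IsOpen O) (hSO : S ⊆ O) {r : K → K}
    (hr : ContinuousOn r O) (hrS : MapsTo r O S) (hid : ∀ z ∈ S, r z = z)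
    (θ : ∀ z, LinearMap.BilinForm ℝ (E.Fib (f z))) (hθ : ∀ z ∈ S, IsMetric (θ z))
    (hc : ContForm E f θ S) :
    ∃ θ' : ∀ z, LinearMap.BilinForm ℝ (E.Fib (f z)), (∀ z, IsMetric (θ' z)) ∧
      ContForm E f θ' univ ∧ ∀ z ∈ S, θ' z = θ z := by
  have loc : ∀ z : K, ∃ (V : Set K) (η : ∀ z, LinearMap.BilinForm ℝ (E.Fib (f z))),
      z ∈ V ∧ IsOpen V ∧ (∀ w ∈ V, IsMetric (η w)) ∧ ContForm E f η V ∧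
        ∀ w ∈ V ∩ S, η w = θ w := by
    intro z
    obtain ⟨e, he⟩ := E.exists_cframe (f z)
    have hU : IsOpen (f ⁻¹' e.1.U) := e.1.isOpen.preimage hf
    by_cases hz : z ∈ S
    · refine ⟨f ⁻¹' e.1.U ∩ (O ∩ r ⁻¹' (f ⁻¹' e.1.U)), fun w => matForm e (f w) fun k l =>
          θ (r w) (e.1.vec k (f (r w))) (e.1.vec l (f (r w))), ⟨he, hSO hz, ?_⟩,
          hU.inter (hr.isOpen_inter_preimage hO hU), ?_, ?_, ?_⟩
      · change f (r z) ∈ e.1.U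
        rwa [hid z hz]
      · rintro w ⟨hw1, hw2, hw3⟩
        exact isMetric_matForm e hw1 hw3 (hθ _ (hrS hw2))
      · refine contForm_matForm e hf (fun w hw => hw.1) fun k l w hw => ?_
        exact ContinuousWithinAt.comp (t := S) (hc e (r w) (hrS hw.2.1) hw.2.2 k l)
          ((hr w hw.2.1).mono fun _ h => h.2.1) fun _ h => hrS h.2.1
      · rintro w ⟨⟨hw1, -⟩, hw⟩
        have key : ∀ w', w' = w → matForm e (f w) (fun k l =>
            θ w' (e.1.vec k (f w')) (e.1.vec l (f w'))) = θ w := by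
          rintro w' rfl
          exact matForm_eq e hw1 _
        exact key _ (hid w hw)
    · refine ⟨f ⁻¹' e.1.U ∩ Sᶜ, fun w => matForm e (f w) fun k l => if k = l then 1 else 0,
        ⟨he, hz⟩, hU.inter hS.isOpen_compl, fun w hw => isMetric_matForm_one e hw.1,
        contForm_matForm e hf (fun w hw => hw.1) fun k l => continuousOn_const,
        fun w hw => absurd hw.2 hw.1.2⟩
  choose V η hzV hVo hη hηc hηS using loc
  obtain ⟨t, ht⟩ := isCompact_univ.elim_finite_subcover V hVo
    fun z _ => mem_iUnion.2 ⟨z, hzV z⟩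
  let q : Fin t.card → K := fun i => (t.equivFin.symm i : K)
  obtain ⟨ρ, hρV, hρ1, hρ, -⟩ := exists_continuous_sum_one_of_isOpen_isCompact
    (s := fun i => V (q i)) (fun i => hVo _) isCompact_univ (fun z hz => by
      obtain ⟨w, hw, hzw⟩ := mem_iUnion₂.1 (ht hz)
      exact mem_iUnion.2 ⟨t.equivFin ⟨w, hw⟩, by simpa [q] using hzw⟩)
  have hsum : ∀ z, ∑ i, ρ i z = 1 := fun z => by simpa using hρ1 (mem_univ z)
  have hmem : ∀ i z, ρ i z ≠ 0 → z ∈ V (q i) := fun i z h => hρV i (subset_tsupport _ h)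
  refine ⟨fun z => ∑ i, ρ i z • η (q i) z, fun z => ?_, ?_, fun z hz => ?_⟩
  · exact IsMetric.sum_smul (fun i => (hρ i z).1) (hsum z) fun i hi => hη _ _ (hmem i z hi)
  · intro e z _ hz k l
    simp only [LinearMap.sum_apply, LinearMap.smul_apply, smul_eq_mul]
    rw [continuousWithinAt_univ]
    refine tendsto_finsetSum _ fun i _ => ?_
    by_cases hi : z ∈ tsupport (ρ i)
    · have h := (hηc (q i) e z (hρV i hi) hz k l).continuousAt ((hVo _).mem_nhds (hρV i hi))
      exact (ρ i).continuous.continuousAt.mul h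
    · have h0 : (fun w => ρ i w * η (q i) w (e.1.vec k (f w)) (e.1.vec l (f w))) =ᶠ[𝓝 z]
          fun _ => 0 := by
        filter_upwards [(isClosed_tsupport (ρ i)).isOpen_compl.mem_nhds hi] with w hw
        rw [image_eq_zero_of_notMem_tsupport hw, zero_mul]
      exact (continuousAt_const (y := (0 : ℝ))).congr h0.symm
  · have : ∀ i, ρ i z • η (q i) z = ρ i z • θ z := by
      intro i
      by_cases hi : ρ i z = 0
      · simp [hi]
      · rw [hηS _ z ⟨hmem i z hi, hz⟩]
    simp only [this, ← Finset.sum_smul, hsum, one_smul]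

/-- Continuity on a compact image can be checked on the source. -/
lemma continuousWithinAt_range [CompactSpace K] [T2Space X] {f : K → X} (hf : Continuous f)
    {a : X → ℝ} {x : X} (h : ∀ z, f z = x → ContinuousAt (fun w => a (f w)) z) :
    ContinuousWithinAt a (range f) x := by
  intro W hW
  have h1 : f ⁻¹' (a ⁻¹' W) ∈ Filter.comap f (𝓝 x) := by
    rw [hf.isClosedMap.comap_nhds_eq hf, mem_nhdsSet_iff_forall]
    rintro z rfl
    exact h z rfl hW
  obtain ⟨T, hT, hTW⟩ := h1
  rw [Filter.mem_map, mem_nhdsWithin_iff_exists_mem_nhds_inter]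
  refine ⟨T, hT, ?_⟩
  rintro _ ⟨hzT, z, rfl⟩
  exact hTW hzT

lemma ContForm.congr {f : K → X} {θ η : ∀ z, LinearMap.BilinForm ℝ (E.Fib (f z))} {s : Set K}
    (h : ContForm E f θ s) (he : ∀ z ∈ s, η z = θ z) : ContForm E f η s :=
  fun e z hz hze k l => (h e z hz hze k l).congr (fun w hw => by rw [he w hw]) (by rw [he z hz])

end FormFields

/-! ### Metrics on bundles over CW complexes -/

section CW

open Topology.RelCWComplex (cell openCell closedCell cellFrontier skeletonLT)

variable {X : Type u} [TopologicalSpace X] [CWComplex (univ : Set X)]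

/-- The characteristic map of a cell on the closed ball. -/
def charMap {n : ℕ} (i : cell (univ : Set X) n) (z : Metric.closedBall (0 : Fin n → ℝ) 1) : X :=
  RelCWComplex.map n i z

lemma continuous_charMap {n : ℕ} (i : cell (univ : Set X) n) : Continuous (charMap i) :=
  continuousOn_iff_continuous_domRestrict.1 (RelCWComplex.continuousOn n i)

lemma range_charMap {n : ℕ} (i : cell (univ : Set X) n) : range (charMap i) = closedCell n i := by
  ext x
  constructor
  · rintro ⟨z, rfl⟩
    exact ⟨z, z.2, rfl⟩
  · rintro ⟨z, hz, rfl⟩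
    exact ⟨⟨z, hz⟩, rfl⟩

variable [T2Space X] in
/-- Points of open cells of a given dimension do not lie in cells of smaller dimension. -/
lemma charMap_notMem_closedCell {n m : ℕ} (h : m < n) (i : cell (univ : Set X) n)
    (j : cell (univ : Set X) m) {z : Metric.closedBall (0 : Fin n → ℝ) 1} (hz : ‖z.1‖ < 1) :
    charMap i z ∉ closedCell m j := by
  intro hm
  have h1 : charMap i z ∈ (skeletonLT (univ : Set X) (m + 1) : Set X) :=
    RelCWComplex.closedCell_subset_skeletonLT m j hm
  have h2 : charMap i z ∈ openCell n i := ⟨z, by simpa using hz, rfl⟩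
  have h3 : ((m : ℕ∞) + 1) ≤ (n : ℕ∞) := by exact_mod_cast h
  exact (RelCWComplex.disjoint_skeletonLT_openCell h3).le_bot ⟨h1, h2⟩

lemma charMap_inj {n : ℕ} {i j : cell (univ : Set X) n}
    {z w : Metric.closedBall (0 : Fin n → ℝ) 1} (hz : ‖z.1‖ < 1) (hw : ‖w.1‖ < 1)
    (h : charMap i z = charMap j w) : (⟨i, z⟩ : Σ _ : cell (univ : Set X) n, _) = ⟨j, w⟩ := by
  have h1 : charMap i z ∈ openCell n i := ⟨z, by simpa using hz, rfl⟩
  have h2 : charMap i z ∈ openCell n j := h ▸ ⟨w, by simpa using hw, rfl⟩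
  have hij : i = j := by
    by_contra hne
    exact (RelCWComplex.disjoint_openCell_of_ne (C := (univ : Set X)) (i := i) (j := j)
      (by simpa using hne)).le_bot ⟨h1, h2⟩
  subst hij
  have : z = w := Subtype.ext ((RelCWComplex.map n i).injOn
    (by rw [RelCWComplex.source_eq]; simpa using hz)
    (by rw [RelCWComplex.source_eq]; simpa using hw) h)
  rw [this]

variable (E : VecBundle ℝ X) [T2Space X]

/-- A family of bilinear forms on the fibres which is a continuous metric over each closed cell of
dimension less than `n`. -/
def IsSkeletonMetric (n : ℕ) (θ : ∀ x, LinearMap.BilinForm ℝ (E.Fib x)) : Prop :=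
  ∀ m < n, ∀ i : cell (univ : Set X) m,
    (∀ x ∈ closedCell m i, IsMetric (θ x)) ∧ ContForm E (fun x => x) θ (closedCell m i)

variable {E}

/-- A metric over the cells of dimension less than `n` restricts to a continuous metric on the
boundary sphere of an `n`-cell, which is mapped to finitely many such cells. -/
lemma IsSkeletonMetric.cellFrontier {n : ℕ} {θ : ∀ x, LinearMap.BilinForm ℝ (E.Fib x)}
    (h : IsSkeletonMetric E n θ) (i : cell (univ : Set X) n) :
    (∀ x ∈ cellFrontier n i, IsMetric (θ x)) ∧
      ContForm E (fun x => x) θ (cellFrontier n i) := by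
  obtain ⟨I, hI⟩ := CWComplex.cellFrontier_subset_finite_closedCell n i
  refine ⟨fun x hx => ?_, fun e x hx hxe k l => ?_⟩
  · have := hI hx
    simp only [mem_iUnion] at this
    obtain ⟨m, hm, j, -, hj⟩ := this
    exact (h m hm j).1 x hj
  · refine ContinuousWithinAt.mono ?_ hI
    rw [ContinuousWithinAt, ← iUnion_subtype (fun m => m < n) (fun m => ⋃ j ∈ I m, closedCell _ j),
      nhdsWithin_iUnion, Filter.tendsto_iSup]
    rintro ⟨m, hm⟩
    change Filter.Tendsto _ (𝓝[⋃ j ∈ (I m : Set (cell (univ : Set X) m)), closedCell m j] x) _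
    rw [nhdsWithin_biUnion (I m).finite_toSet, Filter.tendsto_iSup]
    intro j
    rw [Filter.tendsto_iSup]
    intro _
    by_cases hxj : x ∈ closedCell m j
    · exact (h m hm j).2 e x hxj hxe k l
    · exact continuousWithinAt_of_notMem_closure
        (by rwa [RelCWComplex.isClosed_closedCell.closure_eq])

/-- Extension of a metric over a cell, along the radial projection to the boundary sphere. -/
lemma IsSkeletonMetric.exists_cell {n : ℕ} {θ : ∀ x, LinearMap.BilinForm ℝ (E.Fib x)}
    (h : IsSkeletonMetric E n θ) (i : cell (univ : Set X) n) :
    ∃ θ' : ∀ z, LinearMap.BilinForm ℝ (E.Fib (charMap i z)), (∀ z, IsMetric (θ' z)) ∧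
      ContForm E (charMap i) θ' univ ∧ ∀ z, ‖z.1‖ = 1 → θ' z = θ (charMap i z) := by
  obtain ⟨h1, h2⟩ := h.cellFrontier i
  have hn : Continuous fun z : Metric.closedBall (0 : Fin n → ℝ) 1 => ‖z.1‖ :=
    continuous_norm.comp continuous_subtype_val
  have hmem : ∀ z : Metric.closedBall (0 : Fin n → ℝ) 1, ‖z.1‖ = 1 →
      charMap i z ∈ RelCWComplex.cellFrontier n i := fun z hz => ⟨z, by simpa using hz, rfl⟩
  have hnorm : ∀ z : Metric.closedBall (0 : Fin n → ℝ) 1, ‖z.1‖ ≠ 0 → ‖‖z.1‖⁻¹ • z.1‖ = 1 := by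
    intro z hz
    rw [norm_smul, norm_inv, norm_norm, inv_mul_cancel₀ hz]
  have hball : ∀ z : Metric.closedBall (0 : Fin n → ℝ) 1,
      ‖z.1‖⁻¹ • z.1 ∈ Metric.closedBall (0 : Fin n → ℝ) 1 := by
    intro z
    by_cases hz : ‖z.1‖ = 0
    · simp [hz]
    · simpa using (hnorm z hz).le
  refine exists_metric_extension (E := E) (continuous_charMap i)
    (S := {z | ‖z.1‖ = 1}) (O := {z | ‖z.1‖ ≠ 0})
    (isClosed_eq hn continuous_const) (isOpen_ne_fun hn continuous_const)
    (fun z hz => by rw [mem_ofPred_eq] at hz ⊢; rw [hz]; exact one_ne_zero)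
    (r := fun z => ⟨‖z.1‖⁻¹ • z.1, hball z⟩) ?_ (fun z hz => hnorm z hz) ?_
    (fun z => θ (charMap i z)) (fun z hz => h1 _ (hmem z hz)) ?_
  · rw [Topology.IsInducing.subtypeVal.continuousOn_iff]
    exact (hn.continuousOn.inv₀ fun z hz => hz).smul continuous_subtype_val.continuousOn
  · intro z hz
    rw [mem_ofPred_eq] at hz
    exact Subtype.ext (by simp [hz])
  · intro e z hz hze k l
    exact ContinuousWithinAt.comp (f := charMap i) (t := RelCWComplex.cellFrontier n i)
      (h2 e _ (hmem z hz) hze k l) (continuous_charMap i).continuousWithinAt fun w hw => hmem w hw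

/-- Extension of a metric over the cells of dimension `n`. -/
lemma IsSkeletonMetric.exists_succ {n : ℕ} {θ : ∀ x, LinearMap.BilinForm ℝ (E.Fib x)}
    (h : IsSkeletonMetric E n θ) : ∃ θ' : ∀ x, LinearMap.BilinForm ℝ (E.Fib x),
      IsSkeletonMetric E (n + 1) θ' ∧
        ∀ m < n, ∀ i : cell (univ : Set X) m, ∀ x ∈ closedCell m i, θ' x = θ x := by
  choose η hη hηc hηS using h.exists_cell
  -- The new form is that of `η` over the open `n`-cells, which are disjoint from each other and from
  -- the cells of smaller dimension, and `θ` elsewhere.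
  have glue : ∀ x, ∃ b : LinearMap.BilinForm ℝ (E.Fib x),
      (∀ (i : cell (univ : Set X) n) z, ‖z.1‖ < 1 → ∀ hx : charMap i z = x, hx ▸ η i z = b) ∧
        ((∃ m < n, ∃ i : cell (univ : Set X) m, x ∈ closedCell m i) → b = θ x) := by
    intro x
    by_cases hx : ∃ (i : cell (univ : Set X) n) (z : _), ‖z.1‖ < 1 ∧ charMap i z = x
    · obtain ⟨i, z, hz, rfl⟩ := hx
      refine ⟨η i z, fun j w hw hjw => ?_, ?_⟩
      · cases charMap_inj hw hz hjw
        rfl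
      · rintro ⟨m, hm, j, hj⟩
        exact absurd hj (charMap_notMem_closedCell hm i j hz)
    · push Not at hx
      exact ⟨θ x, fun i z hz hxz => absurd hxz (hx i z hz), fun _ => rfl⟩
  choose θ' h1 h2 using glue
  have hlow : ∀ m < n, ∀ i : cell (univ : Set X) m, ∀ x ∈ closedCell m i, θ' x = θ x :=
    fun m hm i x hx => h2 x ⟨m, hm, i, hx⟩
  have hcell : ∀ (i : cell (univ : Set X) n) z, θ' (charMap i z) = η i z := by
    intro i z
    have hz1 : ‖z.1‖ ≤ 1 := mem_closedBall_zero_iff.1 z.2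
    rcases hz1.lt_or_eq with hz | hz
    · exact (h1 _ i z hz rfl).symm
    · rw [hηS i z hz]
      obtain ⟨I, hI⟩ := CWComplex.cellFrontier_subset_finite_closedCell n i
      have := hI ⟨z.1, by simpa using hz, rfl⟩
      simp only [mem_iUnion] at this
      obtain ⟨m, hm, j, -, hj⟩ := this
      exact hlow m hm j _ hj
  refine ⟨θ', fun m hm i => ?_, hlow⟩
  rcases Nat.lt_succ_iff_lt_or_eq.1 hm with hm | rfl
  · exact ⟨fun x hx => hlow m hm i x hx ▸ (h m hm i).1 x hx,
      (h m hm i).2.congr fun x hx => hlow m hm i x hx⟩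
  · rw [← range_charMap]
    refine ⟨?_, ?_⟩
    · rintro _ ⟨z, rfl⟩
      rw [hcell]
      exact hη i z
    · intro e x _ hx k l
      refine continuousWithinAt_range (continuous_charMap i) ?_
      rintro z rfl
      simp only [hcell]
      exact continuousWithinAt_univ _ _ |>.1 (hηc i e z trivial hx k l)

/-- Continuity at a point of an open subset of a CW complex can be checked on closed cells. -/
lemma continuousAt_of_closedCell {U : Set X} (hU : IsOpen U) {a : X → ℝ}
    (h : ∀ n (i : cell (univ : Set X) n), ∀ x ∈ closedCell n i, x ∈ U →
      ContinuousWithinAt a (closedCell n i) x) {x : X} (hx : x ∈ U) : ContinuousAt a x := by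
  suffices hc : ContinuousOn a U from hc.continuousAt (hU.mem_nhds hx)
  rw [continuousOn_open_iff hU]
  intro W hW
  rw [← isClosed_compl_iff, CWComplex.closed (univ : Set X) _ (subset_univ _)]
  intro n i
  have hc : ContinuousOn a (closedCell n i ∩ U) := fun y hy =>
    (h n i y hy.1 hy.2).mono inter_subset_left
  obtain ⟨O, hO, hOW⟩ := continuousOn_iff'.1 hc W hW
  have : (U ∩ a ⁻¹' W)ᶜ ∩ closedCell n i = (O ∩ U)ᶜ ∩ closedCell n i := by
    ext y
    have := Set.ext_iff.1 hOW y
    simp only [mem_inter_iff, mem_compl_iff, mem_preimage] at this ⊢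
    tauto
  rw [this]
  exact (hO.inter hU).isClosed_compl.inter RelCWComplex.isClosed_closedCell

variable (E) in
/-- Every real vector bundle over a CW complex has a metric. -/
theorem exists_metric : ∃ θ : ∀ x, LinearMap.BilinForm ℝ (E.Fib x), (∀ x, IsMetric (θ x)) ∧
    ContForm E (fun x => x) θ univ := by
  -- The metrics over the skeleta extend each other, so that they are eventually constant on each
  -- cell.
  let seq : ∀ n, {θ // IsSkeletonMetric E n θ} := fun n =>
    Nat.rec ⟨0, fun m hm => absurd hm (Nat.not_lt_zero m)⟩
      (fun n θ => ⟨θ.2.exists_succ.choose, θ.2.exists_succ.choose_spec.1⟩) n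
  have hseq : ∀ n, ∀ m < n, ∀ i : cell (univ : Set X) m, ∀ x ∈ closedCell m i,
      (seq (n + 1)).1 x = (seq n).1 x := fun n => (seq n).2.exists_succ.choose_spec.2
  have hstab : ∀ m n, m < n → ∀ i : cell (univ : Set X) m, ∀ x ∈ closedCell m i,
      (seq n).1 x = (seq (m + 1)).1 x := by
    intro m n hmn i x hx
    induction n, (hmn : m + 1 ≤ n) using Nat.le_induction with
    | base => rfl
    | succ n hn ih => rw [hseq n m hn i x hx, ih]
  have hcov : ∀ x : X, ∃ m, ∃ i : cell (univ : Set X) m, x ∈ closedCell m i := by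
    intro x
    have := (CWComplex.union (C := (univ : Set X))).symm ▸ mem_univ x
    simpa only [mem_iUnion] using this
  choose N i hi using hcov
  have key : ∀ m (j : cell (univ : Set X) m), ∀ x ∈ closedCell m j,
      (seq (N x + 1)).1 x = (seq (m + 1)).1 x := by
    intro m j x hx
    rw [← hstab m (max m (N x) + 1) (by omega) j x hx,
      ← hstab (N x) (max m (N x) + 1) (by omega) (i x) x (hi x)]
  refine ⟨fun x => (seq (N x + 1)).1 x, fun x => ((seq (N x + 1)).2 _ (Nat.lt_succ_self _)
    (i x)).1 x (hi x), fun e x _ hx k l => ?_⟩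
  rw [continuousWithinAt_univ]
  refine continuousAt_of_closedCell e.1.isOpen (fun m j y hy hye => ?_) hx
  exact ((seq (m + 1)).2 m (Nat.lt_succ_self _) j).2.congr (fun x hx => key m j x hx) e y hy hye k l

end CW

/-! ### Continuity of sections and of bundle maps -/

section Sections

variable {𝕜 : Type} [RCLike 𝕜] {X : Type u} [TopologicalSpace X] {E F : VecBundle 𝕜 X}
  {Y : Type*} {t : Y → X}

/-- Sections converge if their coordinates in a frame do. -/
lemma tendsto_section {l : Filter Y} {x : X} (e : E.CFrame) (he : x ∈ e.1.U)
    (ht : Filter.Tendsto t l (𝓝 x)) {v : ∀ y, E.Fib (t y)} {v₀ : E.Fib x}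
    (h : ∀ k, Filter.Tendsto (fun z => e.1.coord k (t z) (v z)) l (𝓝 (e.1.coord k x v₀))) :
    Filter.Tendsto (fun z => (⟨t z, v z⟩ : TotalSpace Unit E.Fib)) l (𝓝 ⟨x, v₀⟩) := by
  have h1 : Filter.Tendsto (fun z => e.1.assemble (t z, fun k => e.1.coord k (t z) (v z))) l
      (𝓝 (e.1.assemble (x, fun k => e.1.coord k x v₀))) :=
    Filter.Tendsto.comp (g := e.1.assemble)
      (e.2.1.continuousAt ((e.1.isOpen.prod isOpen_univ).mem_nhds ⟨he, trivial⟩))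
      (ht.prodMk_nhds (tendsto_pi_nhds.2 h))
  have h0 : e.1.assemble (x, fun k => e.1.coord k x v₀) = ⟨x, v₀⟩ :=
    congrArg _ (e.1.sum_coord _ he _)
  rw [← h0]
  refine h1.congr' ?_
  filter_upwards [ht (e.1.isOpen.mem_nhds he)] with z hz
  exact congrArg _ (e.1.sum_coord _ hz _)

lemma tendsto_coord {l : Filter Y} {x : X} (e : E.CFrame) (he : x ∈ e.1.U) {v : ∀ y, E.Fib (t y)}
    {v₀ : E.Fib x}
    (hv : Filter.Tendsto (fun z => (⟨t z, v z⟩ : TotalSpace Unit E.Fib)) l (𝓝 ⟨x, v₀⟩))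
    (k : e.1.ι) :
    Filter.Tendsto (fun z => e.1.coord k (t z) (v z)) l (𝓝 (e.1.coord k x v₀)) :=
  Filter.Tendsto.comp (g := fun z : TotalSpace Unit E.Fib => e.1.coord k z.1 z.2)
    ((e.2.2 k).continuousAt ((e.1.isOpen.preimage E.continuous_proj).mem_nhds he)).tendsto hv

lemma tendsto_base {l : Filter Y} {x : X} {v : ∀ y, E.Fib (t y)} {v₀ : E.Fib x}
    (hv : Filter.Tendsto (fun z => (⟨t z, v z⟩ : TotalSpace Unit E.Fib)) l (𝓝 ⟨x, v₀⟩)) :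
    Filter.Tendsto t l (𝓝 x) :=
  (E.continuous_proj.tendsto _).comp hv

variable [TopologicalSpace Y] {y : Y}

lemma continuousAt_section_add {v w : ∀ y, E.Fib (t y)}
    (hv : ContinuousAt (fun z => (⟨t z, v z⟩ : TotalSpace Unit E.Fib)) y)
    (hw : ContinuousAt (fun z => (⟨t z, w z⟩ : TotalSpace Unit E.Fib)) y) :
    ContinuousAt (fun z => (⟨t z, v z + w z⟩ : TotalSpace Unit E.Fib)) y := by
  obtain ⟨e, he⟩ := E.exists_cframe (t y)
  refine tendsto_section e he (tendsto_base hv) fun k => ?_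
  simp only [map_add]
  exact (tendsto_coord e he hv k).add (tendsto_coord e he hw k)

lemma continuousAt_section_smul {c : Y → 𝕜} {v : ∀ y, E.Fib (t y)} (hc : ContinuousAt c y)
    (hv : ContinuousAt (fun z => (⟨t z, v z⟩ : TotalSpace Unit E.Fib)) y) :
    ContinuousAt (fun z => (⟨t z, c z • v z⟩ : TotalSpace Unit E.Fib)) y := by
  obtain ⟨e, he⟩ := E.exists_cframe (t y)
  refine tendsto_section e he (tendsto_base hv) fun k => ?_
  simp only [map_smul, smul_eq_mul]
  exact Filter.Tendsto.mul hc (tendsto_coord e he hv k)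

/-- A frame gives a basis of each fibre. -/
def Frame.basis {Fib : X → Type} [∀ x, AddCommGroup (Fib x)] [∀ x, Module 𝕜 (Fib x)]
    (f : Frame 𝕜 Fib) {y : X} (hy : y ∈ f.U) : Module.Basis f.ι 𝕜 (Fib y) :=
  .ofEquivFun
    { toFun := fun v i => f.coord i y v
      map_add' := fun v w => by ext; simp
      map_smul' := fun c v => by ext; simp
      invFun := fun c => ∑ i, c i • f.vec i y
      left_inv := fun v => f.sum_coord y hy v
      right_inv := fun c => funext fun i => f.coord_sum hy c i }

lemma Frame.card_eq_finrank {Fib : X → Type} [∀ x, AddCommGroup (Fib x)] [∀ x, Module 𝕜 (Fib x)]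
    (f : Frame 𝕜 Fib) {y : X} (hy : y ∈ f.U) : Fintype.card f.ι = Module.finrank 𝕜 (Fib y) :=
  (Module.finrank_eq_card_basis (f.basis hy)).symm

lemma continuousAt_matrix_nonsing_inv {ι : Type*} [Fintype ι] [DecidableEq ι] {a : Y → Matrix ι ι 𝕜}
    (ha : ContinuousAt a y) (hu : IsUnit (a y).det) : ContinuousAt (fun z => (a z)⁻¹) y := by
  refine ContinuousAt.comp (g := fun m : Matrix ι ι 𝕜 => m⁻¹) (continuousAt_matrix_inv _ ?_) ha
  obtain ⟨c, hc⟩ := hu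
  rw [← hc]
  exact NormedRing.inverse_continuousAt c

/-- The inverse of a continuous fibrewise bijective bundle map is continuous, because inversion of
matrices is. -/
theorem continuous_symm_of_continuous (φ : ∀ x, E.Fib x ≃ₗ[𝕜] F.Fib x)
    (h : Continuous
      (fun z : TotalSpace Unit E.Fib => (⟨z.1, φ z.1 z.2⟩ : TotalSpace Unit F.Fib))) :
    Continuous
      (fun z : TotalSpace Unit F.Fib => (⟨z.1, (φ z.1).symm z.2⟩ : TotalSpace Unit E.Fib)) := by
  refine VecBundle.continuous_of_coef_id (fun x => (φ x).symm.toLinearMap) fun x => ?_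
  obtain ⟨e, he⟩ := E.exists_cframe x
  obtain ⟨f, hf⟩ := F.exists_cframe x
  refine ⟨f, e, hf, he, fun k l y hy => ContinuousAt.continuousWithinAt ?_⟩
  obtain ⟨r⟩ : Nonempty (e.1.ι ≃ f.1.ι) := by
    rw [← Fintype.card_eq, e.1.card_eq_finrank he, f.1.card_eq_finrank hf]
    exact (φ x).finrank_eq
  let a : X → Matrix e.1.ι e.1.ι 𝕜 := fun y i j => f.1.coord (r i) y (φ y (e.1.vec j y))
  let b : X → Matrix e.1.ι e.1.ι 𝕜 := fun y i j => e.1.coord i y ((φ y).symm (f.1.vec (r j) y))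
  have hba : ∀ y ∈ f.1.U ∩ e.1.U, b y * a y = 1 := by
    rintro y ⟨hyf, hye⟩
    ext i j
    have h1 := f.1.sum_coord y hyf (φ y (e.1.vec j y))
    rw [← r.sum_comp] at h1
    have h2 := congrArg (fun v => e.1.coord i y ((φ y).symm v)) h1
    simp only [map_sum, map_smul, smul_eq_mul, LinearEquiv.symm_apply_apply,
      e.1.coord_vec y hye] at h2
    rw [Matrix.mul_apply, Matrix.one_apply, ← h2]
    exact Finset.sum_congr rfl fun m _ => mul_comm _ _
  have hU : f.1.U ∩ e.1.U ∈ 𝓝 y := (f.1.isOpen.inter e.1.isOpen).mem_nhds hy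
  have ha : ContinuousAt a y := by
    refine continuousAt_pi.2 fun i => continuousAt_pi.2 fun j => ?_
    refine (VecBundle.coef_of_continuous (t := fun x => x) (fun x => (φ x).toLinearMap) h e f
      (r i) j).continuousAt ?_
    exact (e.1.isOpen.inter f.1.isOpen).mem_nhds ⟨hy.2, hy.1⟩
  have hinv := continuousAt_matrix_nonsing_inv ha (Matrix.isUnit_det_of_left_inverse (hba y hy))
  have hb : ContinuousAt b y := by
    refine hinv.congr ?_
    filter_upwards [hU] with z hz
    exact Matrix.inv_eq_left_inv (hba z hz)
  have := continuousAt_pi.1 (continuousAt_pi.1 hb k) (r.symm l)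
  simp only [b, Equiv.apply_symm_apply] at this
  exact this

/-- A continuous equivariant map of bundles which is bijective on the fibres is an isomorphism. -/
def ConjBundle.Iso.ofContinuous [Involution X] {E F : ConjBundle 𝕜 X}
    (φ : ∀ x, E.Fib x ≃ₗ[𝕜] F.Fib x)
    (h : Continuous
      (fun z : TotalSpace Unit E.Fib => (⟨z.1, φ z.1 z.2⟩ : TotalSpace Unit F.Fib)))
    (hinv : ∀ x v, φ (tau x) (E.inv x v) = F.inv x (φ x v)) : ConjBundle.Iso E F where
  equiv := φ
  continuous_toFun := h
  continuous_invFun := continuous_symm_of_continuous φ h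
  map_inv := hinv

lemma continuous_symm_comp {P : VecBundle 𝕜 X} (φ : ∀ x, E.Fib x ≃ₗ[𝕜] F.Fib x)
    (hφ : Continuous
      (fun z : TotalSpace Unit E.Fib => (⟨z.1, φ z.1 z.2⟩ : TotalSpace Unit F.Fib)))
    (ψ : ∀ x, P.Fib x →ₗ[𝕜] F.Fib x)
    (hψ : Continuous
      (fun z : TotalSpace Unit P.Fib => (⟨z.1, ψ z.1 z.2⟩ : TotalSpace Unit F.Fib))) :
    Continuous
      (fun z : TotalSpace Unit P.Fib => (⟨z.1, (φ z.1).symm (ψ z.1 z.2)⟩ : TotalSpace Unit E.Fib)) :=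
  (continuous_symm_of_continuous φ hφ).comp hψ

lemma continuousAt_symm_vec (φ : ∀ x, E.Fib x ≃ₗ[𝕜] F.Fib x)
    (hφ : Continuous
      (fun z : TotalSpace Unit E.Fib => (⟨z.1, φ z.1 z.2⟩ : TotalSpace Unit F.Fib)))
    (f : F.CFrame) (k : f.1.ι) {x : X} (hx : x ∈ f.1.U) :
    ContinuousAt (fun y => (⟨y, (φ y).symm (f.1.vec k y)⟩ : TotalSpace Unit E.Fib)) x :=
  (continuous_symm_of_continuous φ hφ).continuousAt.comp
    ((f.2.vec k).continuousAt (f.1.isOpen.mem_nhds hx))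

lemma VecBundle.CFrame.continuousAt_vec (e : E.CFrame) (l : e.1.ι) {x : X} (hx : x ∈ e.1.U) :
    ContinuousAt (fun y => (⟨y, e.1.vec l y⟩ : TotalSpace Unit E.Fib)) x :=
  (e.2.vec l).continuousAt (e.1.isOpen.mem_nhds hx)

end Sections

section FormSections

variable {X : Type u} [TopologicalSpace X] {E : VecBundle ℝ X} {Y : Type*}
  {θ : ∀ x, LinearMap.BilinForm ℝ (E.Fib x)}

/-- A continuous family of bilinear forms is continuous on sections. -/
lemma ContForm.tendsto (h : ContForm E (fun x => x) θ univ) {t : Y → X} {l : Filter Y}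
    {x : X} {v w : ∀ y, E.Fib (t y)} {v₀ w₀ : E.Fib x}
    (hv : Filter.Tendsto (fun z => (⟨t z, v z⟩ : TotalSpace Unit E.Fib)) l (𝓝 ⟨x, v₀⟩))
    (hw : Filter.Tendsto (fun z => (⟨t z, w z⟩ : TotalSpace Unit E.Fib)) l (𝓝 ⟨x, w₀⟩)) :
    Filter.Tendsto (fun z => θ (t z) (v z) (w z)) l (𝓝 (θ x v₀ w₀)) := by
  obtain ⟨e, he⟩ := E.exists_cframe x
  have ht := tendsto_base hv
  have h1 : Filter.Tendsto (fun z => matForm e (t z)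
      (fun k l => θ (t z) (e.1.vec k (t z)) (e.1.vec l (t z))) (v z) (w z)) l
      (𝓝 (matForm e x (fun k l => θ x (e.1.vec k x) (e.1.vec l x)) v₀ w₀)) := by
    simp only [matForm_apply]
    refine tendsto_finsetSum _ fun k _ => tendsto_finsetSum _ fun l _ => Filter.Tendsto.mul ?_
      ((tendsto_coord e he hv k).mul (tendsto_coord e he hw l))
    exact Filter.Tendsto.comp (g := fun x => θ x (e.1.vec k x) (e.1.vec l x))
      (continuousWithinAt_univ _ _ |>.1 (h e x trivial he k l)) ht
  rw [matForm_eq e he] at h1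
  refine h1.congr' ?_
  filter_upwards [ht (e.1.isOpen.mem_nhds he)] with z hz
  rw [matForm_eq e hz]

/-- A continuous family of bilinear forms as a continuous map to the dual bundle. -/
lemma ContForm.continuous_toDual (h : ContForm E (fun x => x) θ univ) :
    Continuous[E.topology, E.dual.topology]
      (fun z : TotalSpace Unit E.Fib => (⟨z.1, θ z.1 z.2⟩ : TotalSpace Unit E.dual.Fib)) :=
  VecBundle.continuous_of_coef_id (F := E.dual) θ fun x => by
    obtain ⟨e, he⟩ := E.exists_cframe x
    exact ⟨e, VecBundle.dualFrame e, he, he, fun k l y hy =>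
      (h e y trivial hy.1 l k).mono (subset_univ _)⟩

lemma IsMetric.injective {V : Type} [AddCommGroup V] [Module ℝ V] {b : LinearMap.BilinForm ℝ V}
    (hb : IsMetric b) : Function.Injective b := by
  rw [injective_iff_map_eq_zero]
  intro v hv
  by_contra h0
  have := hb.2 v h0
  rw [hv] at this
  exact lt_irrefl _ this

/-- The isomorphism with the dual space given by a metric. -/
def IsMetric.toDual {V : Type} [AddCommGroup V] [Module ℝ V] [Module.Finite ℝ V]
    {b : LinearMap.BilinForm ℝ V} (hb : IsMetric b) : V ≃ₗ[ℝ] Module.Dual ℝ V :=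
  LinearEquiv.ofInjectiveOfFinrankEq b hb.injective (Subspace.dual_finrank_eq).symm

variable (hθ : ∀ x, IsMetric (θ x)) (hc : ContForm E (fun x => x) θ univ)

include hθ hc in
/-- A continuous family of bilinear forms is represented by a continuous bundle map with respect
to a metric. -/
lemma exists_operator {η : ∀ x, LinearMap.BilinForm ℝ (E.Fib x)}
    (hη : ContForm E (fun x => x) η univ) : ∃ A : ∀ x, E.Fib x →ₗ[ℝ] E.Fib x,
      (∀ x u v, θ x (A x u) v = η x u v) ∧ Continuous
        (fun z : TotalSpace Unit E.Fib => (⟨z.1, A z.1 z.2⟩ : TotalSpace Unit E.Fib)) := by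
  have := E.finite
  refine ⟨fun x => (hθ x).toDual.symm.toLinearMap ∘ₗ η x, fun x u v => ?_,
    continuous_symm_comp (F := E.dual) (fun x => (hθ x).toDual) hc.continuous_toDual η
      hη.continuous_toDual⟩
  exact LinearMap.congr_fun ((hθ x).toDual.apply_symm_apply (η x u)) v

include hθ hc in
/-- The coordinate functions of a frame are represented by continuous sections with respect to a
metric. -/
lemma exists_dual_sections (e : E.CFrame) (k : e.1.ι) : ∃ w : ∀ x, E.Fib x,
    (∀ x v, θ x (w x) v = e.1.coord k x v) ∧
      ∀ x ∈ e.1.U, ContinuousAt (fun y => (⟨y, w y⟩ : TotalSpace Unit E.Fib)) x := by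
  have := E.finite
  refine ⟨fun x => (hθ x).toDual.symm (e.1.coord k x), fun x v =>
    LinearMap.congr_fun ((hθ x).toDual.apply_symm_apply (e.1.coord k x)) v, fun x hx => ?_⟩
  exact continuousAt_symm_vec (F := E.dual) (fun x => (hθ x).toDual) hc.continuous_toDual
    (VecBundle.dualFrame e) k hx

end FormSections

/-! ### Square roots of positive operators -/

section FibreRoot

variable {V W : Type} [AddCommGroup V] [Module ℝ V] [AddCommGroup W] [Module ℝ W]

/-- The spectral theorem for a metric on a finite-dimensional real vector space. -/
lemma IsMetric.exists_eigenbasis [Module.Finite ℝ V] {b : LinearMap.BilinForm ℝ V}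
    (hb : IsMetric b) {B : V →ₗ[ℝ] V} (hB : ∀ u v, b (B u) v = b u (B v)) :
    ∃ (n : ℕ) (w : Module.Basis (Fin n) ℝ V) (c : Fin n → ℝ),
      (∀ i j, b (w i) (w j) = if i = j then 1 else 0) ∧ ∀ i, B (w i) = c i • w i := by
  let core : InnerProductSpace.Core ℝ V :=
    { inner := fun u v => b u v
      conj_inner_symm := fun u v => by simp [hb.1 u v]
      re_inner_nonneg := fun v => by
        by_cases hv : v = 0
        · simp [hv]
        · simpa using (hb.2 v hv).le
      add_left := fun u v w => by simp
      smul_left := fun u v r => by simp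
      definite := fun v hv => by
        by_contra h
        exact (hb.2 v h).ne' hv }
  let : NormedAddCommGroup V := core.toNormedAddCommGroup
  let : InnerProductSpace ℝ V := InnerProductSpace.ofCore core.toCore
  have hs : B.IsSymmetric := hB
  let w := hs.eigenvectorBasis (n := Module.finrank ℝ V) rfl
  refine ⟨_, w.toBasis, hs.eigenvalues rfl, fun i j => ?_, fun i => ?_⟩
  · have := orthonormal_iff_ite.1 w.orthonormal i j
    rw [OrthonormalBasis.coe_toBasis]
    exact this
  · rw [OrthonormalBasis.coe_toBasis]
    exact hs.apply_eigenvectorBasis rfl i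

/-- `S` is a positive semidefinite self-adjoint square root of `B` with respect to `b`. -/
def IsRoot (b : LinearMap.BilinForm ℝ V) (B S : V →ₗ[ℝ] V) : Prop :=
  (∀ v, S (S v) = B v) ∧ (∀ u v, b (S u) v = b u (S v)) ∧ ∀ v, 0 ≤ b (S v) v

lemma IsMetric.exists_isRoot [Module.Finite ℝ V] {b : LinearMap.BilinForm ℝ V}
    (hb : IsMetric b) {B : V →ₗ[ℝ] V} (hB : ∀ u v, b (B u) v = b u (B v))
    (hpos : ∀ v, v ≠ 0 → 0 < b (B v) v) : ∃ S, IsRoot b B S := by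
  obtain ⟨n, w, c, hw, hc⟩ := hb.exists_eigenbasis hB
  have hc0 : ∀ i, 0 ≤ c i := fun i => by
    have := hpos (w i) (w.ne_zero i)
    rw [hc, map_smul, LinearMap.smul_apply, hw] at this
    simpa using this.le
  let S : V →ₗ[ℝ] V := w.constr ℝ fun i => √(c i) • w i
  have hS : ∀ i, S (w i) = √(c i) • w i := fun i => w.constr_basis ℝ _ i
  refine ⟨S, fun v => ?_, fun u v => ?_, fun v => ?_⟩
  · have : S ∘ₗ S = B := w.ext fun i => by
      rw [LinearMap.comp_apply, hS, map_smul, hS, smul_smul, Real.mul_self_sqrt (hc0 i), hc]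
    exact LinearMap.congr_fun this v
  · have : b ∘ₗ S = b.compl₂ S := w.ext fun i => w.ext fun j => by
      rw [LinearMap.comp_apply, LinearMap.compl₂_apply, hS, hS, map_smul, map_smul,
        LinearMap.smul_apply, hw]
      by_cases hij : i = j <;> simp [hij]
    exact LinearMap.congr_fun (LinearMap.congr_fun this u) v
  · have hSv : b (S v) v = ∑ i, √(c i) * (w.repr v i * w.repr v i) := by
      conv_lhs => rw [← w.sum_repr v]
      simp only [map_sum, map_smul, hS, LinearMap.sum_apply, LinearMap.smul_apply, hw, smul_eq_mul]
      refine Finset.sum_congr rfl fun i _ => ?_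
      simp
      ring
    rw [hSv]
    exact Finset.sum_nonneg fun i _ => mul_nonneg (Real.sqrt_nonneg _) (mul_self_nonneg _)

/-- A positive square root acts on the `c`-eigenspace as multiplication by `√c`. -/
lemma IsRoot.apply_eigenvector {b : LinearMap.BilinForm ℝ V} {B S : V →ₗ[ℝ] V} (h : IsRoot b B S)
    (hb : IsMetric b) {c : ℝ} (hc : 0 < c) {v : V} (hv : B v = c • v) : S v = √c • v := by
  rw [← sub_eq_zero]
  by_contra hd
  set d := S v - √c • v with hd'
  have h1 : S d = -(√c • d) := by
    rw [hd', map_sub, map_smul, h.1, hv, smul_sub, smul_smul, Real.mul_self_sqrt hc.le]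
    abel
  have h2 := h.2.2 d
  rw [h1, map_neg, map_smul, LinearMap.neg_apply, LinearMap.smul_apply, smul_eq_mul] at h2
  have := mul_pos (Real.sqrt_pos.2 hc) (hb.2 d hd)
  linarith

/-- Linear maps which intertwine two positive definite operators intertwine their square roots.
No compatibility with the metrics is needed, since eigenvectors are mapped to eigenvectors. -/
lemma IsRoot.intertwine [Module.Finite ℝ V] {b : LinearMap.BilinForm ℝ V}
    {b' : LinearMap.BilinForm ℝ W}
    {B S : V →ₗ[ℝ] V} {B' S' : W →ₗ[ℝ] W} (hb : IsMetric b) (hb' : IsMetric b')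
    (hB : ∀ u v, b (B u) v = b u (B v)) (hpos : ∀ v, v ≠ 0 → 0 < b (B v) v) (h : IsRoot b B S)
    (h' : IsRoot b' B' S') (T : V →ₗ[ℝ] W) (hT : ∀ v, T (B v) = B' (T v)) (v : V) :
    T (S v) = S' (T v) := by
  obtain ⟨n, w, c, hw, hc⟩ := hb.exists_eigenbasis hB
  have hc0 : ∀ i, 0 < c i := fun i => by
    have := hpos (w i) (w.ne_zero i)
    rw [hc, map_smul, LinearMap.smul_apply, hw] at this
    simpa using this
  have : T ∘ₗ S = S' ∘ₗ T := w.ext fun i => by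
    rw [LinearMap.comp_apply, LinearMap.comp_apply, h.apply_eigenvector hb (hc0 i) (hc i),
      h'.apply_eigenvector hb' (hc0 i) (v := T (w i)) (by rw [← hT, hc, map_smul]), map_smul]
  exact LinearMap.congr_fun this v

lemma IsRoot.injective {b : LinearMap.BilinForm ℝ V} {B S : V →ₗ[ℝ] V} (h : IsRoot b B S)
    (hpos : ∀ v, v ≠ 0 → 0 < b (B v) v) {v : V} (hv : S v = 0) : v = 0 := by
  by_contra h0
  have := hpos v h0
  rw [← h.1, hv] at this
  simp at this

/-- The Cauchy-Schwarz inequality. -/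
lemma IsMetric.sq_le {b : LinearMap.BilinForm ℝ V} (hb : IsMetric b) (u v : V) :
    b u v ^ 2 ≤ b u u * b v v := by
  by_cases hv : v = 0
  · simp [hv]
  have hp := hb.2 v hv
  have h0 : 0 ≤ b (b v v • u - b u v • v) (b v v • u - b u v • v) := by
    by_cases h : b v v • u - b u v • v = 0
    · simp [h]
    · exact (hb.2 _ h).le
  simp only [map_sub, map_smul, LinearMap.sub_apply, LinearMap.smul_apply, smul_eq_mul,
    hb.1 v u] at h0
  nlinarith

lemma IsRoot.pos {b : LinearMap.BilinForm ℝ V} {B S : V →ₗ[ℝ] V} (h : IsRoot b B S)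
    (hpos : ∀ v, v ≠ 0 → 0 < b (B v) v) {v : V} (hv : v ≠ 0) :
    0 < b (S v) v := by
  refine lt_of_le_of_ne (h.2.2 v) fun h0 => ?_
  -- The form `b (S ·) ·` is positive semidefinite, so that `b (S (v + t S v)) (v + t S v)` is a
  -- nonnegative function of `t` with derivative `2 b (S v) (S v)` at a zero.
  have hB := hpos v hv
  rw [← h.1, h.2.1] at hB
  set p := b (S v) (S v) with hp
  set q := b (S (S v)) (S v) with hq
  have hq0 : 0 ≤ q := h.2.2 _
  have key : ∀ t : ℝ, 0 ≤ 2 * t * p + t ^ 2 * q := by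
    intro t
    have h1 := h.2.2 (v + t • S v)
    simp only [map_add, map_smul, LinearMap.add_apply, LinearMap.smul_apply, smul_eq_mul,
      ← h0, ← hp, ← hq] at h1
    rw [h.2.1 (S v) v] at h1
    nlinarith
  have h2 := key (-(p / (q + 1)))
  have h3 : 2 * -(p / (q + 1)) * p + (-(p / (q + 1))) ^ 2 * q =
      -(p ^ 2 * (q + 2)) / (q + 1) ^ 2 := by
    field_simp
    ring
  rw [h3] at h2
  have : -(p ^ 2 * (q + 2)) / (q + 1) ^ 2 < 0 := by
    apply div_neg_of_neg_of_pos
    · have : 0 < p ^ 2 * (q + 2) := by positivity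
      linarith
    · positivity
  linarith

end FibreRoot

section BundleRoot

variable {X : Type u} [TopologicalSpace X] {E : VecBundle ℝ X}
  {θ : ∀ x, LinearMap.BilinForm ℝ (E.Fib x)} (hθ : ∀ x, IsMetric (θ x))
  (hc : ContForm E (fun x => x) θ univ) {B S : ∀ x, E.Fib x →ₗ[ℝ] E.Fib x}
  (hB : ∀ x u v, θ x (B x u) v = θ x u (B x v)) (hpos : ∀ x v, v ≠ 0 → 0 < θ x (B x v) v)
  (hBc : Continuous
    (fun z : TotalSpace Unit E.Fib => (⟨z.1, B z.1 z.2⟩ : TotalSpace Unit E.Fib)))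
  (hS : ∀ x, IsRoot (θ x) (B x) (S x))

include hθ hc hBc hS in
/-- The coefficients of a square root are locally bounded, because `S v` and `B v` satisfy
`θ (S v) (S v) = θ (B v) v`. -/
lemma exists_bound_root_coef (e : E.CFrame) {x : X} (hx : x ∈ e.1.U) (k l : e.1.ι) :
    ∃ C : ℝ, ∀ᶠ y in 𝓝 x, |e.1.coord k y (S y (e.1.vec l y))| ≤ C := by
  obtain ⟨w, hw, hwc⟩ := exists_dual_sections hθ hc e k
  have h1 : ContinuousAt (fun y => θ y (w y) (w y) * θ y (B y (e.1.vec l y)) (e.1.vec l y)) x :=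
    Filter.Tendsto.mul (hc.tendsto (t := fun y => y) (hwc x hx) (hwc x hx))
      (hc.tendsto (t := fun y => y) (v := fun y => B y (e.1.vec l y))
        (hBc.continuousAt.comp (f := fun y => (⟨y, e.1.vec l y⟩ : TotalSpace Unit E.Fib))
          (e.continuousAt_vec l hx)) (e.continuousAt_vec l hx))
  refine ⟨√(θ x (w x) (w x) * θ x (B x (e.1.vec l x)) (e.1.vec l x) + 1), ?_⟩
  filter_upwards [h1.eventually_lt_const (lt_add_one _)] with y hy
  refine Real.abs_le_sqrt (le_trans ?_ hy.le)
  rw [← hw, ← (hS y).1, (hS y).2.1]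
  exact (hθ y).sq_le _ _

include hθ hc hB hpos hBc hS in
/-- The fibrewise positive square root of a continuous positive operator is continuous: its
coefficients are bounded, and a limit of square roots is a square root. -/
theorem continuous_root : Continuous
    (fun z : TotalSpace Unit E.Fib => (⟨z.1, S z.1 z.2⟩ : TotalSpace Unit E.Fib)) := by
  have := E.finite
  refine VecBundle.continuous_of_coef_id S fun x₀ => ?_
  obtain ⟨e, he⟩ := E.exists_cframe x₀
  refine ⟨e, e, he, he, fun k l x hx => ContinuousAt.continuousWithinAt ?_⟩
  replace hx := hx.1
  let M : X → e.1.ι → e.1.ι → ℝ := fun y k l => e.1.coord k y (S y (e.1.vec l y))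
  suffices hM : ContinuousAt M x from continuousAt_pi.1 (continuousAt_pi.1 hM k) l
  choose C hC using fun k l => exists_bound_root_coef hθ hc hBc hS e hx k l
  have hK : IsCompact (Set.pi univ fun k => Set.pi univ fun l => Icc (-C k l) (C k l)) :=
    isCompact_univ_pi fun k => isCompact_univ_pi fun l => isCompact_Icc
  refine hK.tendsto_nhds_of_unique_mapClusterPt ?_ fun N _ hN => ?_
  · have := Filter.eventually_all.2 fun k => Filter.eventually_all.2 fun l => hC k l
    filter_upwards [this] with y hy
    exact fun k _ l _ => abs_le.1 (hy k l)
  obtain ⟨U, hU, hUN⟩ := mapClusterPt_iff_ultrafilter.1 hN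
  -- A vector of coordinates defines a section near `x`.
  let sec : (e.1.ι → ℝ) → ∀ y, E.Fib y := fun c y => ∑ i, c i • e.1.vec i y
  have hsec : ∀ (c : X → e.1.ι → ℝ) (c₀), Filter.Tendsto c U (𝓝 c₀) →
      Filter.Tendsto (fun y => (⟨y, sec (c y) y⟩ : TotalSpace Unit E.Fib)) U
        (𝓝 ⟨x, sec c₀ x⟩) := fun c c₀ h =>
    (e.2.1.continuousAt ((e.1.isOpen.prod isOpen_univ).mem_nhds
      (show (x, c₀) ∈ e.1.U ×ˢ univ from ⟨hx, trivial⟩))).tendsto.comp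
      (Filter.Tendsto.prodMk_nhds hU h)
  have hSsec : ∀ y ∈ e.1.U, ∀ c, S y (sec c y) = sec (Matrix.mulVec (M y) c) y := by
    intro y hy c
    rw [← e.1.sum_coord y hy (S y (sec c y))]
    refine Finset.sum_congr rfl fun i _ => ?_
    simp only [sec, map_sum, map_smul, smul_eq_mul, Matrix.mulVec, dotProduct, M]
    congr 1
    exact Finset.sum_congr rfl fun j _ => mul_comm _ _
  have hmul : ∀ c : X → e.1.ι → ℝ, ∀ c₀, Filter.Tendsto c U (𝓝 c₀) →
      Filter.Tendsto (fun y => Matrix.mulVec (M y) (c y)) U (𝓝 (Matrix.mulVec N c₀)) := by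
    intro c c₀ h
    refine tendsto_pi_nhds.2 fun i => tendsto_finsetSum _ fun j _ => ?_
    exact (tendsto_pi_nhds.1 (tendsto_pi_nhds.1 hUN i) j).mul (tendsto_pi_nhds.1 h j)
  have hUe : ∀ᶠ y in (U : Filter X), y ∈ e.1.U := hU (e.1.isOpen.mem_nhds hx)
  have hconst : ∀ c : e.1.ι → ℝ, Filter.Tendsto (fun _ : X => c) U (𝓝 c) :=
    fun c => tendsto_const_nhds
  have hSlim : ∀ c, Filter.Tendsto (fun y => (⟨y, S y (sec c y)⟩ : TotalSpace Unit E.Fib)) U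
      (𝓝 ⟨x, sec (Matrix.mulVec N c) x⟩) := by
    intro c
    refine (hsec _ _ (hmul _ _ (hconst c))).congr' ?_
    filter_upwards [hUe] with y hy
    rw [hSsec y hy]
  -- The limit matrix as an endomorphism of the fibre over `x`.
  let S' : E.Fib x →ₗ[ℝ] E.Fib x := (e.1.basis hx).equivFun.symm.toLinearMap ∘ₗ
    Matrix.mulVecLin N ∘ₗ (e.1.basis hx).equivFun.toLinearMap
  have hbasis : ∀ c, (e.1.basis hx).equivFun.symm c = sec c x := fun c => rfl
  have hS' : ∀ c, S' (sec c x) = sec (Matrix.mulVec N c) x := by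
    intro c
    rw [← hbasis, ← hbasis]
    change (e.1.basis hx).equivFun.symm (Matrix.mulVec N ((e.1.basis hx).equivFun
      ((e.1.basis hx).equivFun.symm c))) = _
    rw [LinearEquiv.apply_symm_apply]
  have hsurj : ∀ v : E.Fib x, ∃ c, sec c x = v := fun v => ⟨_, e.1.sum_coord x hx v⟩
  have hroot : IsRoot (θ x) (B x) S' := by
    refine ⟨fun v => ?_, fun u v => ?_, fun v => ?_⟩
    · obtain ⟨c, rfl⟩ := hsurj v
      rw [hS', hS']
      have h1 := hsec _ _ (hmul _ _ (hmul _ _ (hconst c)))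
      have h2 : Filter.Tendsto (fun y => (⟨y, B y (sec c y)⟩ : TotalSpace Unit E.Fib)) U
          (𝓝 ⟨x, B x (sec c x)⟩) := (hBc.tendsto _).comp (hsec _ _ (hconst c))
      have h3 : Filter.Tendsto (fun y => (⟨y, B y (sec c y)⟩ : TotalSpace Unit E.Fib)) U
          (𝓝 ⟨x, sec (Matrix.mulVec N (Matrix.mulVec N c)) x⟩) := by
        refine h1.congr' ?_
        filter_upwards [hUe] with y hy
        rw [← (hS y).1, hSsec y hy, hSsec y hy]
      rw [← e.1.sum_coord x hx (B x _), ← e.1.sum_coord x hx (sec _ x)]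
      refine Finset.sum_congr rfl fun k _ => ?_
      congr 1
      exact tendsto_nhds_unique (tendsto_coord (t := fun y => y) e hx h3 k)
        (tendsto_coord (t := fun y => y) e hx h2 k)
    · obtain ⟨c, rfl⟩ := hsurj u
      obtain ⟨d, rfl⟩ := hsurj v
      rw [hS', hS']
      refine tendsto_nhds_unique
        (hc.tendsto (t := fun y => y) (hSlim c) (hsec _ _ (hconst d))) ?_
      simp only [(hS _).2.1]
      exact hc.tendsto (t := fun y => y) (hsec _ _ (hconst c)) (hSlim d)
    · obtain ⟨c, rfl⟩ := hsurj v
      rw [hS']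
      exact ge_of_tendsto' (hc.tendsto (t := fun y => y) (hSlim c) (hsec _ _ (hconst c)))
        fun y => (hS y).2.2 _
  have hSS' : ∀ v, S' v = S x v := fun v =>
    hroot.intertwine (hθ x) (hθ x) (hB x) (hpos x) (hS x) LinearMap.id (fun _ => rfl) v
  have hNM : ∀ c, Matrix.mulVec N c = Matrix.mulVec (M x) c := by
    intro c
    refine (e.1.basis hx).equivFun.symm.injective ?_
    rw [hbasis, hbasis, ← hS', hSS', hSsec x hx]
  exact Matrix.mulVec_injective (funext hNM)

end BundleRoot

/-! ### Invariant metrics -/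

section Invariant

lemma total_form {X : Type u} {V : X → Type} [∀ x, AddCommGroup (V x)] [∀ x, Module ℝ (V x)]
    (θ : ∀ x, LinearMap.BilinForm ℝ (V x)) {x y : X} {a b : V y} {v w : V x}
    (h1 : (⟨y, a⟩ : TotalSpace Unit V) = ⟨x, v⟩) (h2 : (⟨y, b⟩ : TotalSpace Unit V) = ⟨x, w⟩) :
    θ y a b = θ x v w := by
  cases h1; cases h2; rfl

variable {X : Type u} [TopologicalSpace X]

section VB

variable {E F : VecBundle ℝ X} {θ η : ∀ x, LinearMap.BilinForm ℝ (E.Fib x)}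

/-- Continuity of a family of bilinear forms can be checked in one frame around each point. -/
lemma contForm_of_frame (h : ∀ x, ∃ e : E.CFrame, x ∈ e.1.U ∧ ∀ k l,
    ContinuousOn (fun y => θ y (e.1.vec k y) (e.1.vec l y)) e.1.U) :
    ContForm E (fun x => x) θ univ := by
  intro g x _ hg k l
  obtain ⟨e, he, hc⟩ := h x
  have h1 := (contForm_matForm e continuous_id (fun _ hz => hz) hc).congr (η := θ)
    (fun z hz => (matForm_eq e hz _).symm) g x he hg k l
  exact (h1.continuousAt (e.1.isOpen.mem_nhds he)).continuousWithinAt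

lemma ContForm.add (hθ : ContForm E (fun x => x) θ univ) (hη : ContForm E (fun x => x) η univ) :
    ContForm E (fun x => x) (fun x => θ x + η x) univ :=
  fun e x hx hxe k l => (hθ e x hx hxe k l).add (hη e x hx hxe k l)

/-- Pull-back of a continuous family of bilinear forms along a bundle map. -/
lemma ContForm.comp {θ : ∀ x, LinearMap.BilinForm ℝ (F.Fib x)}
    (hθ : ContForm F (fun x => x) θ univ) {t : X → X} (T : ∀ x, E.Fib x →ₗ[ℝ] F.Fib (t x))
    (hT : Continuous
      (fun z : TotalSpace Unit E.Fib => (⟨t z.1, T z.1 z.2⟩ : TotalSpace Unit F.Fib))) :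
    ContForm E (fun x => x) (fun x => (θ (t x)).compl₁₂ (T x) (T x)) univ := by
  intro e x _ hxe k l
  have h : ∀ k, ContinuousAt (fun y => (⟨t y, T y (e.1.vec k y)⟩ : TotalSpace Unit F.Fib)) x :=
    fun k => hT.continuousAt.comp (f := fun y => (⟨y, e.1.vec k y⟩ : TotalSpace Unit E.Fib))
      (e.continuousAt_vec k hxe)
  have h1 : ContinuousAt (fun y => θ (t y) (T y (e.1.vec k y)) (T y (e.1.vec l y))) x :=
    hθ.tendsto (h k) (h l)
  exact h1.continuousWithinAt

lemma IsMetric.add_compl₁₂ {V W : Type} [AddCommGroup V] [Module ℝ V] [AddCommGroup W] [Module ℝ W]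
    {b : LinearMap.BilinForm ℝ V} {c : LinearMap.BilinForm ℝ W} (hb : IsMetric b)
    (hc : IsMetric c) (T : V →ₗ[ℝ] W) : IsMetric (b + c.compl₁₂ T T) := by
  refine ⟨fun u v => ?_, fun v hv => ?_⟩
  · simp [hb.1 u v, hc.1 (T u)]
  · have h2 : 0 ≤ c (T v) (T v) := by
      by_cases h : T v = 0
      · simp [h]
      · exact (hc.2 _ h).le
    have := hb.2 v hv
    simp only [LinearMap.add_apply, LinearMap.compl₁₂_apply]
    linarith

end VB

variable [Involution X]

lemma SymForm.contForm {E : ConjBundle ℝ X} (φ : SymForm E) :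
    ContForm E.toVecBundle (fun x => x) φ.form univ :=
  contForm_of_frame fun x => by
    obtain ⟨e, he⟩ := E.exists_cframe x
    exact ⟨e, he, fun k l => φ.coef e l k⟩

lemma InvariantMetric.isMetric {E : ConjBundle ℝ X} (θ : InvariantMetric E) (x : X) :
    IsMetric (θ.form x) :=
  ⟨θ.form_symm x, θ.form_pos x⟩

/-- The involution of an equivariant real bundle as a linear map. -/
def ConjBundle.linInv (E : ConjBundle ℝ X) (x : X) : E.Fib x →ₗ[ℝ] E.Fib (tau x) where
  toFun := E.inv x
  map_add' := map_add _
  map_smul' c v := by simp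

/-- A continuous invariant family of metrics as an invariant metric. -/
def InvariantMetric.ofMetric {E : ConjBundle ℝ X} (θ : ∀ x, LinearMap.BilinForm ℝ (E.Fib x))
    (hθ : ∀ x, IsMetric (θ x)) (hc : ContForm E.toVecBundle (fun x => x) θ univ)
    (hinv : ∀ x v w, θ (tau x) (E.inv x v) (E.inv x w) = θ x v w) : InvariantMetric E where
  toSymForm := SymForm.ofCoef θ
    (fun x => by
      obtain ⟨e, he⟩ := E.exists_cframe x
      exact ⟨e, he, fun k l y hy => (hc e y trivial hy l k).mono (subset_univ _)⟩)
    (fun x => by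
      have := E.finite x
      exact (hθ x).toDual.bijective)
    (fun x v w => by simpa using hinv x v w)
    (fun x => (hθ x).1)
  form_pos x := (hθ x).2

/-- Invariant metrics exist over CW complexes: the sum of a metric and its transform under the
involution is invariant. -/
theorem exists_invariantMetric [T2Space X] [CWComplex (univ : Set X)] (E : ConjBundle ℝ X) :
    Nonempty (InvariantMetric E) := by
  obtain ⟨θ, hθ, hc⟩ := exists_metric E.toVecBundle
  refine ⟨InvariantMetric.ofMetric (fun x => θ x + (θ (tau x)).compl₁₂ (E.linInv x) (E.linInv x))
    (fun x => (hθ x).add_compl₁₂ (hθ _) _) (hc.add (hc.comp E.linInv E.continuous_inv))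
    fun x v w => ?_⟩
  have h := total_form θ (E.inv_inv x v) (E.inv_inv x w)
  change θ (tau x) (E.inv x v) (E.inv x w) +
    θ (tau (tau x)) (E.inv (tau x) (E.inv x v)) (E.inv (tau x) (E.inv x w)) =
    θ x v w + θ (tau x) (E.inv x v) (E.inv x w)
  rw [h, add_comm]

/-- Any two invariant metrics on a bundle are isometric: if `θ' u v = θ (B u) v`, then the square
root of `B` is an isometry from `θ'` to `θ`. -/
theorem nonempty_isometry_of_invariantMetric {E : ConjBundle ℝ X} (θ θ' : InvariantMetric E) :
    Nonempty (Isometry θ'.toSymForm θ.toSymForm) := by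
  have := E.finite
  obtain ⟨B, hB, hBc⟩ := exists_operator θ.isMetric θ.contForm θ'.contForm
  have hsym : ∀ x u v, θ.form x (B x u) v = θ.form x u (B x v) := fun x u v => by
    rw [hB, θ'.form_symm, ← hB, θ.form_symm]
  have hpos : ∀ x v, v ≠ 0 → 0 < θ.form x (B x v) v := fun x v hv => by
    rw [hB]
    exact θ'.form_pos x v hv
  have hinv : ∀ x v, E.linInv x (B x v) = B (tau x) (E.linInv x v) := by
    intro x v
    refine (θ.isMetric (tau x)).injective (LinearMap.ext fun w => ?_)
    obtain ⟨w, rfl⟩ := (E.inv_bijective x).2 w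
    have h1 := θ.form_inv_inv x (B x v) w
    have h2 := θ'.form_inv_inv x v w
    rw [conj_trivial] at h1 h2
    change θ.form (tau x) (E.inv x (B x v)) (E.inv x w) = θ.form _ (B _ (E.inv x v)) _
    rw [h1, hB, hB, h2]
  choose S hS using fun x => (θ.isMetric x).exists_isRoot (hsym x) (hpos x)
  have hSc := continuous_root θ.isMetric θ.contForm hsym hpos hBc hS
  have hbij : ∀ x, Function.Bijective (S x) := fun x => by
    have hi : Function.Injective (S x) :=
      (injective_iff_map_eq_zero _).2 fun v hv => (hS x).injective (hpos x) hv
    exact ⟨hi, LinearMap.injective_iff_surjective.1 hi⟩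
  refine ⟨{ toIso := .ofContinuous (fun x => LinearEquiv.ofBijective (S x) (hbij x)) hSc
              fun x v => ?_
            map_form := fun x u v => ?_ }⟩
  · exact ((hS x).intertwine (θ.isMetric x) (θ.isMetric _) (hsym x) (hpos x) (hS (tau x))
      (E.linInv x) (hinv x) v).symm
  · change θ.form x (S x u) (S x v) = _
    rw [← (hS x).2.1, (hS x).1, hB]

end Invariant

/-! ### Real structures adapted to a symmetric form -/

section RealStructure

variable {X : Type u} [TopologicalSpace X] [Involution X]

/-- The real part of a complex bilinear form. -/
def reForm {V : Type} [AddCommGroup V] [Module ℂ V] (b : LinearMap.BilinForm ℂ V) :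
    LinearMap.BilinForm ℝ V :=
  LinearMap.mk₂ ℝ (fun u v => (b u v).re) (fun a b c => by simp) (fun r a b => by simp)
    (fun a b c => by simp) (fun r a b => by simp)

lemma reForm_apply {V : Type} [AddCommGroup V] [Module ℂ V] (b : LinearMap.BilinForm ℂ V)
    (u v : V) : reForm b u v = (b u v).re := rfl

lemma SymForm.contForm_reForm {E : ConjBundle ℂ X} (φ : SymForm E) :
    ContForm E.realify.toVecBundle (fun x => x) (fun x => reForm (φ.form x)) univ :=
  contForm_of_frame fun x => by
    obtain ⟨e, he⟩ := E.exists_cframe x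
    have hc := fun k l => φ.coef e l k
    refine ⟨VecBundle.realifyFrame e, he, ?_⟩
    rintro (k | k) (l | l)
    · exact Complex.continuous_re.comp_continuousOn (hc k l)
    · refine (Complex.continuous_im.comp_continuousOn (hc k l)).neg.congr fun y hy => ?_
      simp [reForm_apply]
    · refine (Complex.continuous_im.comp_continuousOn (hc k l)).neg.congr fun y hy => ?_
      simp [reForm_apply]
    · refine (Complex.continuous_re.comp_continuousOn (hc k l)).neg.congr fun y hy => ?_
      simp [reForm_apply, ← mul_assoc]

/-- Multiplication by `i` on a complex vector space as a real linear map. -/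
def mulI (V : Type) [AddCommGroup V] [Module ℂ V] : V →ₗ[ℝ] V where
  toFun v := Complex.I • v
  map_add' := smul_add _
  map_smul' := fun c v => smul_comm _ c v

lemma mulI_mulI {V : Type} [AddCommGroup V] [Module ℂ V] (v : V) : mulI V (mulI V v) = -v := by
  simp [mulI, smul_smul]

lemma continuous_mulI {X : Type u} [TopologicalSpace X] (E : VecBundle ℂ X) : Continuous
    (fun z : TotalSpace Unit E.Fib => (⟨z.1, mulI _ z.2⟩ : TotalSpace Unit E.Fib)) :=
  continuous_iff_continuousAt.2 fun _ =>
    continuousAt_section_smul (t := fun z : TotalSpace Unit E.Fib => z.1) (v := fun z => z.2)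
      continuousAt_const continuousAt_id

/-- Over a CW complex, a Real bundle has an invariant Hermitian metric; only its real part is
recorded. -/
lemma exists_hermitian [T2Space X] [CWComplex (univ : Set X)] (E : ConjBundle ℂ X) :
    ∃ g : InvariantMetric E.realify, ∀ x u v,
      g.form x (mulI (E.Fib x) u) (mulI (E.Fib x) v) = g.form x u v := by
  obtain ⟨θ⟩ := exists_invariantMetric E.realify
  refine ⟨InvariantMetric.ofMetric
    (fun x => θ.form x + (θ.form x).compl₁₂ (mulI (E.Fib x)) (mulI (E.Fib x)))
    (fun x => (θ.isMetric x).add_compl₁₂ (θ.isMetric x) _)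
    (θ.contForm.add (θ.contForm.comp (E := E.realify.toVecBundle) (t := fun x => x)
      (fun x => mulI (E.Fib x)) (continuous_mulI E.toVecBundle)))
    fun x v w => ?_, fun x u v => ?_⟩
  · have hI : ∀ v : E.Fib x, mulI _ (E.inv x v) = -E.inv x (mulI _ v) := fun v => by
      simp [mulI, (E.inv x).map_smulₛₗ]
    have h : ∀ v w : E.Fib x, θ.form (tau x) (E.inv x v) (E.inv x w) = θ.form x v w := fun v w => by
      have := θ.form_inv_inv x v w
      rwa [conj_trivial] at this
    change θ.form (tau x) (E.inv x v) (E.inv x w) +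
      θ.form (tau x) (mulI _ (E.inv x v)) (mulI _ (E.inv x w)) =
      θ.form x v w + θ.form x (mulI _ v) (mulI _ w)
    rw [hI, hI, map_neg, map_neg, LinearMap.neg_apply, neg_neg, h, h]
  · change θ.form x (mulI _ u) (mulI _ v) + θ.form x (mulI _ (mulI _ u)) (mulI _ (mulI _ v)) =
      θ.form x u v + θ.form x (mulI _ u) (mulI _ v)
    rw [mulI_mulI, mulI_mulI, map_neg, map_neg, LinearMap.neg_apply, neg_neg, add_comm]

/-- A real structure on a Real bundle with a symmetric form: a continuous antilinear involution of
the fibres which commutes with the involution of the bundle, such that the form is real and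
positive definite on the fixed vectors. -/
structure RealStructure {E : ConjBundle ℂ X} (φ : SymForm E) where
  J : ∀ x, E.Fib x →ₛₗ[starRingEnd ℂ] E.Fib x
  continuous_J : Continuous
    (fun z : TotalSpace Unit E.Fib => (⟨z.1, J z.1 z.2⟩ : TotalSpace Unit E.Fib))
  J_J : ∀ x v, J x (J x v) = v
  J_inv : ∀ x v, J (tau x) (E.inv x v) = E.inv x (J x v)
  form_im : ∀ x u v, J x u = u → J x v = v → (φ.form x u v).im = 0
  form_re : ∀ x v, J x v = v → v ≠ 0 → 0 < (φ.form x v v).re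

/-- A real linear endomorphism of a complex vector space which anticommutes with `i`, as an
antilinear map. -/
def antilinearOf {V : Type} [AddCommGroup V] [Module ℂ V] (T : V →ₗ[ℝ] V)
    (h : ∀ v, T (mulI V v) = -mulI V (T v)) : V →ₛₗ[starRingEnd ℂ] V where
  toFun := T
  map_add' := map_add T
  map_smul' c v := by
    have h' : T (Complex.I • v) = -(Complex.I • T v) := h v
    conv_lhs => rw [← Complex.re_add_im c, add_smul, mul_smul, Complex.coe_smul, Complex.coe_smul,
      map_add, map_smul, map_smul, h']
    conv_rhs => rw [← Complex.re_add_im c, map_add, map_mul, Complex.conj_ofReal,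
      Complex.conj_ofReal, Complex.conj_I, add_smul, mul_smul, Complex.coe_smul, Complex.coe_smul,
      neg_smul]

/-- Every Real symmetric form over a CW complex has a real structure: with respect to an invariant
Hermitian metric `g`, the real part of the form is represented by an antilinear self-adjoint
operator `A`, and `A |A|⁻¹` is a real structure, where `|A|` is the square root of `A²`. -/
theorem nonempty_realStructure [T2Space X] [CWComplex (univ : Set X)] {E : ConjBundle ℂ X}
    (φ : SymForm E) : Nonempty (RealStructure φ) := by
  have hfin : ∀ x, Module.Finite ℝ (E.Fib x) := E.realify.finite
  obtain ⟨g, hgI⟩ := exists_hermitian E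
  have hg := g.isMetric
  obtain ⟨A, hA, hAc⟩ := exists_operator hg g.contForm φ.contForm_reForm
  have hre : ∀ x u v, g.form x (A x u) v = (φ.form x u v).re := hA
  have hφI : ∀ x (u v : E.Fib x), φ.form x (mulI _ u) v = Complex.I * φ.form x u v :=
    fun x u v => by simp [mulI]
  have hφI' : ∀ x (u v : E.Fib x), φ.form x u (mulI _ v) = Complex.I * φ.form x u v :=
    fun x u v => by simp [mulI]
  have hgI' : ∀ x (u v : E.Fib x), g.form x (mulI _ u) v = -g.form x u (mulI _ v) :=
    fun x u v => by
      rw [← hgI x u, mulI_mulI, map_neg, neg_neg]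
  have hsymA : ∀ x u v, g.form x (A x u) v = g.form x u (A x v) := fun x u v => by
    rw [hre, φ.form_symm, ← hre, g.form_symm]
  -- `A` is antilinear: the form is `ℂ`-bilinear, while `g` is the real part of a Hermitian form.
  have hAI : ∀ x (v : E.Fib x), A x (mulI _ v) = -mulI _ (A x v) := fun x v => by
    refine (hg x).injective (LinearMap.ext fun w => ?_)
    rw [map_neg, LinearMap.neg_apply, hgI', neg_neg, hre, hre, hφI, hφI']
  have hAσ : ∀ x (v : E.Fib x), E.realify.linInv x (A x v) = A (tau x) (E.realify.linInv x v) := by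
    intro x v
    refine (hg (tau x)).injective (LinearMap.ext fun w => ?_)
    obtain ⟨w, rfl⟩ := (E.inv_bijective x).2 w
    have h1 := g.form_inv_inv x (A x v) w
    rw [conj_trivial] at h1
    refine h1.trans ?_
    rw [hre, hre]
    have h2 := φ.form_inv_inv x v w
    exact ((congrArg Complex.re h2).trans (Complex.conj_re _)).symm
  have hAinj : ∀ x v, A x v = 0 → v = 0 := fun x v hv => by
    refine (injective_iff_map_eq_zero _).1 (φ.bijective_form x).1 v (LinearMap.ext fun w => ?_)
    have h1 := hre x v w
    have h2 := hre x v (mulI _ w)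
    rw [hφI'] at h2
    rw [hv, map_zero, LinearMap.zero_apply] at h1 h2
    refine Complex.ext h1.symm ?_
    simpa using h2.symm
  let B : ∀ x, E.Fib x →ₗ[ℝ] E.Fib x := fun x => A x ∘ₗ A x
  have hB : ∀ x u v, g.form x (B x u) v = g.form x u (B x v) := fun x u v => by
    simp only [B, LinearMap.comp_apply, hsymA]
  have hpos : ∀ x v, v ≠ 0 → 0 < g.form x (B x v) v := fun x v hv => by
    simp only [B, LinearMap.comp_apply, hsymA]
    rw [← hsymA]
    exact (hg x).2 _ fun h => hv (hAinj x v h)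
  choose S hS using fun x => (hg x).exists_isRoot (hB x) (hpos x)
  have hSc := continuous_root hg g.contForm hB hpos (hAc.comp hAc) hS
  have hSinj : ∀ x, Function.Injective (S x) := fun x =>
    (injective_iff_map_eq_zero _).2 fun v hv => (hS x).injective (hpos x) hv
  let Se : ∀ x, E.Fib x ≃ₗ[ℝ] E.Fib x := fun x =>
    LinearEquiv.ofBijective (S x) ⟨hSinj x, LinearMap.injective_iff_surjective.1 (hSinj x)⟩
  have hSA : ∀ x v, A x (S x v) = S x (A x v) := fun x =>
    (hS x).intertwine (hg x) (hg x) (hB x) (hpos x) (hS x) (A x) fun v => rfl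
  have hSI : ∀ x (v : E.Fib x), mulI _ (S x v) = S x (mulI _ v) := fun x =>
    (hS x).intertwine (hg x) (hg x) (hB x) (hpos x) (hS x) (mulI (E.Fib x)) fun v => by
      simp only [B, LinearMap.comp_apply, hAI, map_neg, neg_neg]
  have hSσ : ∀ x v, E.realify.linInv x (S x v) = S (tau x) (E.realify.linInv x v) := fun x =>
    (hS x).intertwine (hg x) (hg _) (hB x) (hpos x) (hS _) (E.realify.linInv x) fun v => by
      simp only [B, LinearMap.comp_apply, hAσ]
  -- Since `S` commutes with `A`, the map `J = S⁻¹ A` is an involution.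
  let J : ∀ x, E.Fib x →ₗ[ℝ] E.Fib x := fun x => (Se x).symm.toLinearMap ∘ₗ A x
  have hSJ : ∀ x v, S x (J x v) = A x v := fun x v => (Se x).apply_symm_apply (A x v)
  have hJI : ∀ x (v : E.Fib x), J x (mulI _ v) = -mulI _ (J x v) := fun x v => by
    apply hSinj x
    rw [hSJ, map_neg, ← hSI, hSJ, hAI]
  have hJA : ∀ x v, J x v = v → A x v = S x v := fun x v hv => by rw [← hSJ, hv]
  -- On fixed vectors `A` agrees with `S`, so that the real part of the form is `g (S ·) ·`. The
  -- imaginary part is both symmetric and antisymmetric there.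
  have him : ∀ x u v, J x u = u → (φ.form x u v).im = g.form x (mulI _ (S x u)) v := by
    intro x u v hu
    rw [← hJA x u hu, ← neg_neg (mulI (E.Fib x) (A x u)), ← hAI, map_neg, LinearMap.neg_apply,
      hre, hφI]
    simp
  refine ⟨{ J := fun x => antilinearOf (J x) (hJI x)
            continuous_J := continuous_symm_comp (E := E.realify.toVecBundle)
              (F := E.realify.toVecBundle) (P := E.realify.toVecBundle) Se hSc A hAc
            J_J := fun x v => ?_
            J_inv := fun x v => ?_
            form_im := fun x u v hu hv => ?_
            form_re := fun x v hv h0 => ?_ }⟩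
  · apply hSinj x
    apply hSinj x
    change S x (S x (J x (J x v))) = _
    rw [hSJ, ← hSA, hSJ, (hS x).1]
    rfl
  · apply hSinj (tau x)
    change S _ (J _ (E.inv x v)) = S _ (E.realify.linInv x (J x v))
    rw [hSJ, ← hSσ, hSJ, hAσ]
    rfl
  · have h1 := him x u v hu
    have h2 := him x v u hv
    have h3 := h2
    rw [φ.form_symm] at h3
    rw [φ.form_symm, h1, hgI', (hS x).2.1, ← hSI, g.form_symm] at h2
    linarith
  · rw [← hre, hJA x v hv]
    exact (hS x).pos (hpos x) h0

end RealStructure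

/-! ### The real bundle of a real structure -/

section Perturb

variable {𝕜 : Type} [RCLike 𝕜] {X : Type u} [TopologicalSpace X] {E : VecBundle 𝕜 X}

/-- Continuous sections which form a basis of the fibre over one point form a frame near it. -/
lemma exists_cframe_of_sections (e : E.CFrame) (s : e.1.ι → ∀ y, E.Fib y)
    (hs : ∀ i, ∀ y ∈ e.1.U, ContinuousAt (fun y => (⟨y, s i y⟩ : TotalSpace Unit E.Fib)) y)
    {x : X} (hx : x ∈ e.1.U) (b : Module.Basis e.1.ι 𝕜 (E.Fib x)) (hb : ∀ i, s i x = b i) :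
    ∃ g : E.CFrame, x ∈ g.1.U ∧ ∀ i, ∃ j, g.1.vec i = s j := by
  let m : X → Matrix e.1.ι e.1.ι 𝕜 := fun y j i => e.1.coord j y (s i y)
  have hm : ContinuousOn m e.1.U := fun y hy => by
    refine ContinuousAt.continuousWithinAt ?_
    exact continuousAt_pi.2 fun j => continuousAt_pi.2 fun i =>
      tendsto_coord (t := fun y => y) e hy (hs i y hy) j
  have hsm : ∀ y ∈ e.1.U, ∀ i, s i y = ∑ j, m y j i • e.1.vec j y := fun y hy i =>
    (e.1.sum_coord y hy _).symm
  have hdet : ContinuousOn (fun y => (m y).det) e.1.U :=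
    Continuous.comp_continuousOn (continuous_id.matrix_det) hm
  let V : Set X := e.1.U ∩ (fun y => (m y).det) ⁻¹' {0}ᶜ
  have hV : IsOpen V := hdet.isOpen_inter_preimage e.1.isOpen isOpen_compl_singleton
  have hunit : ∀ y ∈ V, IsUnit (m y).det := fun y hy => isUnit_iff_ne_zero.2 hy.2
  let f : Frame 𝕜 E.Fib :=
    { U := V
      isOpen := hV
      ι := e.1.ι
      vec := s
      coord := fun i y => ∑ j, (m y)⁻¹ i j • e.1.coord j y
      coord_vec := fun y hy i j => by
        have := congrFun (congrFun (Matrix.nonsing_inv_mul (m y) (hunit y hy)) i) j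
        rw [Matrix.one_apply] at this
        rw [← this, Matrix.mul_apply, LinearMap.sum_apply]
        rfl
      sum_coord := fun y hy v => by
        conv_rhs => rw [← e.1.sum_coord y hy.1 v]
        simp only [hsm y hy.1, Finset.smul_sum, smul_smul]
        rw [Finset.sum_comm]
        refine Finset.sum_congr rfl fun j _ => ?_
        rw [← Finset.sum_smul]
        congr 1
        have := congrFun (congrArg (fun a => Matrix.mulVec a fun j => e.1.coord j y v)
          (Matrix.mul_nonsing_inv (m y) (hunit y hy))) j
        simp only [← Matrix.mulVec_mulVec, Matrix.one_mulVec] at this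
        rw [← this]
        simp only [Matrix.mulVec, dotProduct, LinearMap.sum_apply, LinearMap.smul_apply,
          smul_eq_mul]
        exact Finset.sum_congr rfl fun i _ => mul_comm _ _ }
  refine ⟨⟨f, ?_, fun i => ?_⟩, ⟨hx, ?_⟩, fun i => ⟨i, rfl⟩⟩
  · have h1 : ContinuousOn (fun p : X × (e.1.ι → 𝕜) =>
        e.1.assemble (p.1, Matrix.mulVec (m p.1) p.2)) (V ×ˢ univ) := by
      refine e.2.1.comp (t := e.1.U ×ˢ univ) (continuousOn_fst.prodMk ?_)
        fun p hp => ⟨hp.1.1, trivial⟩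
      refine continuousOn_pi.2 fun i => continuousOn_finsetSum _ fun j _ => ContinuousOn.mul ?_ ?_
      · exact (continuousOn_pi.1 (continuousOn_pi.1 hm i) j).comp continuousOn_fst
          fun p hp => hp.1.1
      · exact Continuous.continuousOn (by fun_prop)
    refine h1.congr fun p hp => ?_
    refine congrArg (fun v => (⟨p.1, v⟩ : TotalSpace Unit E.Fib)) ?_
    change ∑ i, p.2 i • s i p.1 = _
    simp only [hsm p.1 hp.1.1, Finset.smul_sum, smul_smul, Matrix.mulVec, dotProduct,
      Finset.sum_smul]
    rw [Finset.sum_comm]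
    exact Finset.sum_congr rfl fun i _ => Finset.sum_congr rfl fun j _ => by rw [mul_comm]
  · have h1 : ∀ j, ContinuousOn (fun z : TotalSpace Unit E.Fib => (m z.1)⁻¹ i j)
        (TotalSpace.proj ⁻¹' V) := fun j => by
      have h2 : ContinuousOn (fun y => (m y)⁻¹) V := fun y hy =>
        (continuousAt_matrix_nonsing_inv (hm.continuousAt (e.1.isOpen.mem_nhds hy.1))
          (hunit y hy)).continuousWithinAt
      exact (continuousOn_pi.1 (continuousOn_pi.1 h2 i) j).comp
        E.continuous_proj.continuousOn fun z hz => hz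
    have h3 : ContinuousOn (fun z : TotalSpace Unit E.Fib =>
        ∑ j, (m z.1)⁻¹ i j * e.1.coord j z.1 z.2) (TotalSpace.proj ⁻¹' V) :=
      continuousOn_finsetSum _ fun j _ => (h1 j).mul ((e.2.2 j).mono fun z hz => hz.1)
    refine h3.congr fun z hz => ?_
    change (∑ j, (m z.1)⁻¹ i j • e.1.coord j z.1) z.2 = _
    rw [LinearMap.sum_apply]
    rfl
  · have h1 : m x = (e.1.basis hx).toMatrix b := by
      ext j i
      change e.1.coord j x (s i x) = _
      rw [hb]
      rfl
    have h2 : IsUnit (m x).det := by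
      rw [h1]
      exact Matrix.isUnit_det_of_right_inverse ((e.1.basis hx).toMatrix_mul_toMatrix_flip b)
    exact h2.ne_zero

end Perturb

section Fixed

variable {V : Type} [AddCommGroup V] [Module ℂ V]

/-- The real vector space of fixed vectors of an antilinear map. -/
def fixedSub (J : V →ₛₗ[starRingEnd ℂ] V) : Submodule ℝ V where
  carrier := {v | J v = v}
  add_mem' {u v} hu hv := by
    change J (u + v) = u + v
    rw [map_add, hu, hv]
  zero_mem' := map_zero J
  smul_mem' c v hv := by
    change J ((c : ℂ) • v) = (c : ℂ) • v
    rw [J.map_smulₛₗ, Complex.conj_ofReal, hv]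

lemma mem_fixedSub {J : V →ₛₗ[starRingEnd ℂ] V} {v : V} : v ∈ fixedSub J ↔ J v = v := Iff.rfl

variable (J : V →ₛₗ[starRingEnd ℂ] V) (hJ : ∀ v, J (J v) = v)

/-- The projection `v ↦ (v + J v) / 2` to the fixed vectors of an antilinear involution. -/
def fixProj (v : V) : fixedSub J :=
  ⟨(2⁻¹ : ℂ) • (v + J v), by
    have h : starRingEnd ℂ (2⁻¹ : ℂ) = 2⁻¹ := by rw [map_inv₀, map_ofNat]
    rw [mem_fixedSub, J.map_smulₛₗ, map_add, hJ, add_comm (J v), h]⟩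

lemma fixProj_of_fixed {v : V} (hv : J v = v) : (fixProj J hJ v : V) = v := by
  change (2⁻¹ : ℂ) • (v + J v) = v
  rw [hv, ← two_smul ℂ v, smul_smul]
  norm_num

include hJ in
lemma span_fixedSub : (⊤ : Submodule ℂ V) ≤ Submodule.span ℂ (fixedSub J : Set V) := by
  intro v _
  -- A vector is the sum of its real part and `i` times its imaginary part with respect to `J`.
  have h : v = (fixProj J hJ v : V) +
      Complex.I • (fixProj J hJ (-(Complex.I • v)) : V) := by
    change v = (2⁻¹ : ℂ) • (v + J v) +
      Complex.I • ((2⁻¹ : ℂ) • (-(Complex.I • v) + J (-(Complex.I • v))))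
    rw [map_neg, J.map_smulₛₗ, Complex.conj_I]
    simp only [neg_smul, neg_neg, smul_add, smul_neg, smul_smul]
    have h1 : Complex.I * (2⁻¹ * Complex.I) = -2⁻¹ := by
      rw [mul_left_comm, Complex.I_mul_I]
      ring
    rw [h1, neg_smul, neg_smul, neg_neg]
    have h2 : (2⁻¹ : ℂ) • v + (2⁻¹ : ℂ) • v = v := by
      rw [← add_smul]
      norm_num
    calc v = (2⁻¹ : ℂ) • v + (2⁻¹ : ℂ) • v := h2.symm
      _ = _ := by abel
  rw [h]
  exact add_mem (Submodule.subset_span (fixProj J hJ v).2)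
    (Submodule.smul_mem _ _ (Submodule.subset_span (fixProj J hJ _).2))

end Fixed

namespace RealStructure

variable {X : Type u} [TopologicalSpace X] [Involution X] {E : ConjBundle ℂ X} {φ : SymForm E}
  (R : RealStructure φ)

/-- The frames of the bundle which consist of fixed vectors of the real structure. -/
abbrev FixedFrame := {g : E.CFrame // ∀ i, ∀ y ∈ g.1.U, R.J y (g.1.vec i y) = g.1.vec i y}

/-- The fibres of the bundle of fixed vectors. -/
abbrev FixFib (x : X) : Type := fixedSub (R.J x)

/-- A frame of fixed vectors as a frame of the real bundle of fixed vectors. The coordinates of a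
fixed vector are real. -/
@[reducible]
def toFrame (g : R.FixedFrame) : Frame ℝ R.FixFib where
  U := g.1.1.U
  isOpen := g.1.1.isOpen
  ι := g.1.1.ι
  vec i y := fixProj (R.J y) (R.J_J y) (g.1.1.vec i y)
  coord i y := Complex.reLm ∘ₗ (g.1.1.coord i y).restrictScalars ℝ ∘ₗ (fixedSub (R.J y)).subtype
  coord_vec y hy i j := by
    simp only [LinearMap.comp_apply, Submodule.subtype_apply, LinearMap.restrictScalars_apply]
    rw [fixProj_of_fixed _ _ (g.2 j y hy), g.1.1.coord_vec y hy]
    split_ifs <;> simp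
  sum_coord y hy v := by
    have h1 := g.1.1.sum_coord y hy (v : E.Fib y)
    have h2 : ∀ i, starRingEnd ℂ (g.1.1.coord i y v) = g.1.1.coord i y v := by
      intro i
      have h3 : (v : E.Fib y) = ∑ j, starRingEnd ℂ (g.1.1.coord j y v) • g.1.1.vec j y := by
        conv_lhs => rw [← mem_fixedSub.1 v.2, ← h1, map_sum]
        exact Finset.sum_congr rfl fun j _ => by rw [(R.J y).map_smulₛₗ, g.2 j y hy]
      conv_rhs => rw [h3, g.1.1.coord_sum hy]
    refine Subtype.ext ?_
    rw [← h1, AddSubmonoidClass.coe_finsetSum]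
    refine Finset.sum_congr rfl fun i _ => ?_
    rw [Submodule.coe_smul, fixProj_of_fixed _ _ (g.2 i y hy), ← Complex.coe_smul]
    congr 1
    exact Complex.conj_eq_iff_re.1 (h2 i)

lemma coe_toFrame_vec (g : R.FixedFrame) {y : X} (hy : y ∈ g.1.1.U) (i : g.1.1.ι) :
    ((R.toFrame g).vec i y : E.Fib y) = g.1.1.vec i y :=
  fixProj_of_fixed (R.J y) (R.J_J y) (g.2 i y hy)

/-- There are frames of fixed vectors: a basis of a fibre which consists of fixed vectors is
extended to sections, which are then projected to the fixed vectors. -/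
lemma exists_fixedFrame (x : X) : ∃ g : R.FixedFrame, x ∈ g.1.1.U := by
  obtain ⟨e, he⟩ := E.exists_cframe x
  have := E.finite x
  let b₀ := Module.Basis.ofSpan (span_fixedSub (R.J x) (R.J_J x))
  have hb₀ : ∀ i, R.J x (b₀ i) = b₀ i := fun i =>
    Module.Basis.ofSpan_subset (span_fixedSub (R.J x) (R.J_J x)) ⟨i, rfl⟩
  let b := b₀.reindex (b₀.indexEquiv (e.1.basis he))
  have hb : ∀ i, R.J x (b i) = b i := fun i => by
    rw [Module.Basis.reindex_apply]
    exact hb₀ _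
  let s₀ : e.1.ι → ∀ y, E.Fib y := fun i y => (e.1.assemble (y, fun j => e.1.coord j x (b i))).2
  have hs₀ : ∀ i, ∀ y ∈ e.1.U,
      ContinuousAt (fun y => (⟨y, s₀ i y⟩ : TotalSpace Unit E.Fib)) y := fun i y hy =>
    ContinuousAt.comp (g := e.1.assemble) (f := fun y => (y, fun j => e.1.coord j x (b i)))
      (e.2.1.continuousAt ((e.1.isOpen.prod isOpen_univ).mem_nhds ⟨hy, trivial⟩))
      (by fun_prop)
  obtain ⟨g, hg, hgs⟩ := exists_cframe_of_sections e
    (fun i y => (fixProj (R.J y) (R.J_J y) (s₀ i y) : E.Fib y))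
    (fun i y hy => continuousAt_section_smul (t := fun y => y) continuousAt_const
      (continuousAt_section_add (t := fun y => y) (hs₀ i y hy)
        (R.continuous_J.continuousAt.comp
          (f := fun y => (⟨y, s₀ i y⟩ : TotalSpace Unit E.Fib)) (hs₀ i y hy)))) he b
    fun i => by
      have : s₀ i x = b i := e.1.sum_coord x he _
      rw [this]
      exact fixProj_of_fixed _ _ (hb i)
  refine ⟨⟨g, fun i y _ => ?_⟩, hg⟩
  obtain ⟨j, hj⟩ := hgs i
  rw [hj]
  exact (fixProj (R.J y) (R.J_J y) (s₀ j y)).2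

lemma compat_toFrame (g h : R.FixedFrame) : (R.toFrame g).Compat (R.toFrame h) := by
  intro k l
  refine (Complex.continuous_re.comp_continuousOn (g.1.2.compat h.1.2 k l)).congr fun y hy => ?_
  exact congrArg (fun v => (g.1.1.coord k y v).re) (R.coe_toFrame_vec h hy.2 l)

/-- The real vector bundle of fixed vectors. -/
@[reducible]
def fixVB : VecBundle ℝ X :=
  VecBundle.ofAtlas R.FixFib R.toFrame R.exists_fixedFrame R.compat_toFrame

/-- A frame of fixed vectors as a continuous frame of the bundle of fixed vectors. -/
@[reducible]
def toCFrame (g : R.FixedFrame) : R.fixVB.CFrame :=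
  VecBundle.ofAtlasFrame R.toFrame R.exists_fixedFrame R.compat_toFrame g

/-- The involution of the bundle restricts to the fixed vectors. -/
@[reducible]
def fixInv (x : X) : R.FixFib x →ₛₗ[starRingEnd ℝ] R.FixFib (tau x) where
  toFun v := ⟨E.inv x v, by rw [mem_fixedSub, R.J_inv, mem_fixedSub.1 v.2]⟩
  map_add' u v := Subtype.ext (map_add (E.inv x) u.1 v.1)
  map_smul' c v := Subtype.ext (by
    have h := (E.inv x).map_smulₛₗ (c : ℂ) v.1
    rw [Complex.conj_ofReal] at h
    exact h)

lemma total_fixed {x y : X} {a : R.FixFib y} {v : R.FixFib x}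
    (h : (⟨y, a.1⟩ : TotalSpace Unit E.Fib) = ⟨x, v.1⟩) :
    (⟨y, a⟩ : TotalSpace Unit R.FixFib) = ⟨x, v⟩ := by
  obtain ⟨a, ha⟩ := a
  obtain ⟨v, hv⟩ := v
  cases h
  rfl

/-- The equivariant real bundle of fixed vectors. -/
@[reducible]
def fixBundle : ConjBundle ℝ X where
  toVecBundle := R.fixVB
  inv := R.fixInv
  continuous_inv := by
    refine VecBundle.continuous_of_coef (E := R.fixVB) (F := R.fixVB) RCLike.continuous_conj
      continuous_tau R.fixInv fun x => ?_
    obtain ⟨g, hg⟩ := R.exists_fixedFrame x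
    obtain ⟨g', hg'⟩ := R.exists_fixedFrame (tau x)
    refine ⟨R.toCFrame g, R.toCFrame g', hg, hg', fun k l => ?_⟩
    refine (Complex.continuous_re.comp_continuousOn (E.coef_inv g.1 g'.1 k l)).congr fun y hy => ?_
    exact congrArg (fun v => (g'.1.1.coord k (tau y) (E.inv y v)).re)
      (R.coe_toFrame_vec g hy.1 l)
  inv_inv x v := R.total_fixed (E.inv_inv x v.1)

/-- The symmetric form restricts to a metric on the bundle of fixed vectors. -/
def metric : InvariantMetric R.fixBundle :=
  InvariantMetric.ofMetric (E := R.fixBundle)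
    (fun x => (reForm (φ.form x)).domRestrict₁₂ (fixedSub (R.J x)) (fixedSub (R.J x)))
    (fun x => ⟨fun u v => congrArg Complex.re (φ.form_symm x u v), fun v hv =>
      R.form_re x v v.2 fun h => hv (Subtype.ext h)⟩)
    (contForm_of_frame (E := R.fixVB) fun x => by
      obtain ⟨g, hg⟩ := R.exists_fixedFrame x
      refine ⟨R.toCFrame g, hg, fun k l => ?_⟩
      refine (Complex.continuous_re.comp_continuousOn (φ.coef g.1 l k)).congr fun y hy => ?_
      exact congrArg₂ (fun v w => (φ.form y v w).re) (R.coe_toFrame_vec g hy k)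
        (R.coe_toFrame_vec g hy l))
    (fun x v w => (congrArg Complex.re (φ.form_inv_inv x v.1 w.1)).trans (Complex.conj_re _))

/-- The map `c ⊗ v ↦ c v` from the complexification of the space of fixed vectors. -/
def complexMap (x : X) : ℂ ⊗[ℝ] R.FixFib x →ₗ[ℂ] E.Fib x :=
  LinearMap.liftBaseChange ℂ (fixedSub (R.J x)).subtype

lemma complexMap_tmul (x : X) (c : ℂ) (v : R.FixFib x) :
    R.complexMap x (c ⊗ₜ v) = c • (v : E.Fib x) :=
  LinearMap.liftBaseChange_tmul ℂ _ c v

lemma complexMap_bijective (x : X) : Function.Bijective (R.complexMap x) := by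
  obtain ⟨g, hg⟩ := R.exists_fixedFrame x
  have key : ∀ c : g.1.1.ι → ℂ, R.complexMap x (∑ i, c i • ((1 : ℂ) ⊗ₜ (R.toFrame g).vec i x)) =
      ∑ i, c i • g.1.1.vec i x := fun c => by
    rw [map_sum]
    refine Finset.sum_congr rfl fun i _ => ?_
    rw [map_smul, complexMap_tmul, one_smul]
    exact congrArg _ (R.coe_toFrame_vec g hg i)
  constructor
  · rw [injective_iff_map_eq_zero]
    intro t ht
    have h := (R.toFrame g).complexify.sum_coord x hg t
    rw [← h] at ht
    have ht' := (key fun i => (R.toFrame g).complexify.coord i x t).symm.trans ht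
    rw [← h]
    refine Finset.sum_eq_zero fun i _ => ?_
    have h1 := g.1.1.coord_sum hg (fun i => (R.toFrame g).complexify.coord i x t) i
    rw [ht', map_zero] at h1
    rw [← h1, zero_smul]
  · exact fun v => ⟨_, (key fun i => g.1.1.coord i x v).trans (g.1.1.sum_coord x hg v)⟩

/-- A symmetric form with a real structure is isometric to the complexification of its metric on the
bundle of fixed vectors. -/
def isometry : Isometry R.metric.toSymForm.complexify φ where
  toIso := .ofContinuous (E := R.fixBundle.complexify)
    (fun x => LinearEquiv.ofBijective (R.complexMap x) (R.complexMap_bijective x))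
    (VecBundle.continuous_of_coef_id (E := R.fixVB.complexify) R.complexMap fun x => by
      obtain ⟨g, hg⟩ := R.exists_fixedFrame x
      refine ⟨VecBundle.complexifyFrame (R.toCFrame g), g.1, hg, hg, fun k l => ?_⟩
      refine ((g.1.2.compat g.1.2 k l).mono fun y hy => ⟨hy.2, hy.2⟩).congr fun y hy => ?_
      change g.1.1.coord k y (R.complexMap y ((1 : ℂ) ⊗ₜ (R.toFrame g).vec l y)) = _
      rw [complexMap_tmul, one_smul]
      exact congrArg (g.1.1.coord k y) (R.coe_toFrame_vec g hy.2 l))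
    fun x v => by
      change R.complexMap (tau x) (R.fixBundle.complexifyInv x v) = E.inv x (R.complexMap x v)
      induction v using TensorProduct.induction_on with
      | zero => simp only [map_zero]
      | add a b ha hb => simp only [map_add, ha, hb]
      | tmul c v =>
        rw [ConjBundle.complexifyInv_tmul, complexMap_tmul, complexMap_tmul, (E.inv x).map_smulₛₗ]
        rfl
  map_form x u v := by
    change φ.form x (R.complexMap x u) (R.complexMap x v) =
      (R.metric.form x).baseChange ℂ u v
    induction u using TensorProduct.induction_on with
    | zero => simp only [map_zero, LinearMap.zero_apply]
    | add a b ha hb => simp only [map_add, LinearMap.add_apply, ha, hb]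
    | tmul a b =>
      induction v using TensorProduct.induction_on with
      | zero => simp only [map_zero]
      | add a b ha hb => simp only [map_add, ha, hb]
      | tmul c d =>
        have h : φ.form x b d = (R.metric.form x b d : ℂ) :=
          Complex.ext rfl (R.form_im x b d b.2 d.2)
        rw [complexMap_tmul, complexMap_tmul, LinearMap.BilinForm.baseChange_tmul, map_smul,
          map_smul, LinearMap.smul_apply, h, smul_eq_mul, smul_eq_mul, Complex.real_smul]
        ring

end RealStructure

/-! ### Real parts, and the comparison of subbundles -/

section Comparison

variable {X : Type u} [TopologicalSpace X]

/-- The real part `c ⊗ v ↦ re c • v` of a vector of a complexified space. -/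
def tensorRe (V : Type) [AddCommGroup V] [Module ℝ V] : ℂ ⊗[ℝ] V →ₗ[ℝ] V :=
  (TensorProduct.lid ℝ V).toLinearMap ∘ₗ Complex.reLm.rTensor V

/-- The imaginary part `c ⊗ v ↦ im c • v` of a vector of a complexified space. -/
def tensorIm (V : Type) [AddCommGroup V] [Module ℝ V] : ℂ ⊗[ℝ] V →ₗ[ℝ] V :=
  (TensorProduct.lid ℝ V).toLinearMap ∘ₗ Complex.imLm.rTensor V

/-- The topology on the total space of a complexified bundle. -/
instance complexifyTopology (F : VecBundle ℝ X) :
    TopologicalSpace (TotalSpace Unit fun x => ℂ ⊗[ℝ] F.Fib x) :=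
  F.complexify.topology

section Parts

variable {V : Type} [AddCommGroup V] [Module ℝ V]

lemma tensorRe_tmul (c : ℂ) (v : V) : tensorRe V (c ⊗ₜ v) = c.re • v := rfl

lemma tensorIm_tmul (c : ℂ) (v : V) : tensorIm V (c ⊗ₜ v) = c.im • v := rfl

lemma tensorRe_add_tensorIm (t : ℂ ⊗[ℝ] V) :
    (1 : ℂ) ⊗ₜ[ℝ] tensorRe V t + Complex.I ⊗ₜ[ℝ] tensorIm V t = t := by
  induction t using TensorProduct.induction_on with
  | zero => simp only [map_zero, TensorProduct.tmul_zero, add_zero]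
  | add a b ha hb =>
    conv_rhs => rw [← ha, ← hb]
    simp only [map_add, TensorProduct.tmul_add]
    abel
  | tmul c v =>
    rw [tensorRe_tmul, tensorIm_tmul, ← TensorProduct.smul_tmul, ← TensorProduct.smul_tmul,
      ← TensorProduct.add_tmul]
    congr 1
    simp only [Complex.real_smul, mul_one]
    exact Complex.re_add_im c

lemma tensorRe_coord {Fib : X → Type} [∀ x, AddCommGroup (Fib x)] [∀ x, Module ℝ (Fib x)]
    (e : Frame ℝ Fib) (k : e.ι) (y : X) (t : ℂ ⊗[ℝ] Fib y) :
    e.coord k y (tensorRe _ t) = (e.complexify.coord k y t).re := by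
  induction t using TensorProduct.induction_on with
  | zero => simp only [map_zero, Complex.zero_re]
  | add a b ha hb => simp only [map_add, ha, hb, Complex.add_re]
  | tmul c v => simp [tensorRe_tmul, mul_comm]

end Parts

lemma continuous_one_tmul (F : VecBundle ℝ X) :
    Continuous (fun z : TotalSpace Unit F.Fib =>
      (⟨z.1, (1 : ℂ) ⊗ₜ z.2⟩ : TotalSpace Unit fun x => ℂ ⊗[ℝ] F.Fib x)) := by
  refine continuous_iff_continuousAt.2 fun z => ?_
  obtain ⟨e, he⟩ := F.exists_cframe z.1
  refine tendsto_section (E := F.complexify) (VecBundle.complexifyFrame e) he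
    F.continuous_proj.continuousAt fun k => ?_
  have h := (Complex.continuous_ofReal.tendsto _).comp
    (tendsto_coord e he (v := fun z : TotalSpace Unit F.Fib => z.2) (v₀ := z.2) Filter.tendsto_id k)
  simpa [Function.comp_def] using h

variable [Involution X]

/-- Let `N` be a subbundle of the real bundle underlying `ℂ ⊗ F`, of the same rank as `F`, on which
the real part of the complexified metric is not negative. A vector of `N` with vanishing real part
has the form `i ⊗ w` and its square is `-θ(w, w)`. Hence the real part is injective on `N`. -/
theorem nonempty_iso_of_form_nonneg {F N : ConjBundle ℝ X} (θ : InvariantMetric F)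
    (j : ∀ x, N.Fib x →ₗ[ℝ] ℂ ⊗[ℝ] F.Fib x) (hc : Continuous (fun z : TotalSpace Unit N.Fib =>
      (⟨z.1, j z.1 z.2⟩ : TotalSpace Unit fun x => ℂ ⊗[ℝ] F.Fib x)))
    (hinv : ∀ x v, j (tau x) (N.inv x v) = F.complexifyInv x (j x v))
    (hinj : ∀ x, Function.Injective (j x))
    (hpos : ∀ x v, 0 ≤ ((θ.form x).baseChange ℂ (j x v) (j x v)).re)
    (hrank : ∀ x, Module.finrank ℝ (N.Fib x) = Module.finrank ℝ (F.Fib x)) :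
    Nonempty (ConjBundle.Iso N F) := by
  have hN := N.finite
  have hF := F.finite
  have h1 : ∀ x, Function.Injective (tensorRe (F.Fib x) ∘ₗ j x) := fun x => by
    rw [injective_iff_map_eq_zero]
    intro v hv
    have h2 := tensorRe_add_tensorIm (j x v)
    rw [LinearMap.comp_apply] at hv
    rw [hv, TensorProduct.tmul_zero, zero_add] at h2
    have h3 := hpos x v
    rw [← h2, LinearMap.BilinForm.baseChange_tmul, Complex.I_mul_I, Complex.smul_re,
      Complex.neg_re, Complex.one_re, smul_eq_mul] at h3
    have h4 : tensorIm (F.Fib x) (j x v) = 0 := by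
      by_contra h
      have := θ.form_pos x _ h
      linarith
    rw [h4, TensorProduct.tmul_zero] at h2
    exact hinj x (h2.symm.trans (map_zero _).symm)
  refine ⟨.ofContinuous (fun x => LinearEquiv.ofInjectiveOfFinrankEq _ (h1 x) (hrank x)) ?_ ?_⟩
  · refine VecBundle.continuous_of_coef_id (fun x => tensorRe (F.Fib x) ∘ₗ j x) fun x => ?_
    obtain ⟨n, hn⟩ := N.exists_cframe x
    obtain ⟨e, he⟩ := F.exists_cframe x
    refine ⟨n, e, hn, he, fun k l => ?_⟩
    have h2 := ((VecBundle.complexifyFrame e).2.2 k).comp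
      (hc.comp_continuousOn ((n.2.vec l).mono (inter_subset_left (t := e.1.U))))
      fun y hy => hy.2
    exact (Complex.continuous_re.comp_continuousOn h2).congr fun y hy => tensorRe_coord e.1 k y _
  · intro x v
    change tensorRe _ (j (tau x) (N.inv x v)) = F.inv x (tensorRe _ (j x v))
    rw [hinv]
    induction j x v using TensorProduct.induction_on with
    | zero => simp only [map_zero]
    | add a b ha hb => simp only [map_add, ha, hb]
    | tmul c w =>
      rw [ConjBundle.complexifyInv_tmul, tensorRe_tmul, tensorRe_tmul, Complex.conj_re,
        (F.inv x).map_smulₛₗ, conj_trivial]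

/-- The equivariant bundle with metric is determined by its complexification. -/
theorem Isometry.nonempty_iso {F F' : ConjBundle ℝ X} {θ : InvariantMetric F}
    {θ' : InvariantMetric F'} (f : Isometry θ.toSymForm.complexify θ'.toSymForm.complexify) :
    Nonempty (ConjBundle.Iso F F') := by
  have hF := F.finite
  have hF' := F'.finite
  refine nonempty_iso_of_form_nonneg θ'
    (fun x => (f.equiv x).toLinearMap.restrictScalars ℝ ∘ₗ TensorProduct.mk ℝ ℂ (F.Fib x) 1)
    (f.continuous_toFun.comp (continuous_one_tmul F.toVecBundle)) (fun x v => ?_) (fun x => ?_)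
    (fun x v => ?_) fun x => ?_
  · refine Eq.trans ?_ (f.map_inv x (1 ⊗ₜ v))
    exact congrArg (fun c : ℂ => f.equiv (tau x) (c ⊗ₜ F.inv x v)) (map_one (starRingEnd ℂ)).symm
  · refine (f.equiv x).injective.comp fun v w h => ?_
    have h1 := congrArg (tensorRe _) h
    simpa [tensorRe_tmul] using h1
  · have h := f.map_form x (1 ⊗ₜ v) (1 ⊗ₜ v)
    refine le_of_le_of_eq ?_ (congrArg Complex.re h).symm
    have h1 : ((θ.form x).baseChange ℂ (1 ⊗ₜ v) (1 ⊗ₜ v)).re = θ.form x v v := by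
      rw [LinearMap.BilinForm.baseChange_tmul]
      simp
    rw [h1]
    by_cases hv : v = 0
    · simp [hv]
    · exact (θ.form_pos x v hv).le
  · rw [← Module.finrank_baseChange (R := ℂ), (f.equiv x).finrank_eq, Module.finrank_baseChange]

lemma Lagrangian.two_mul_finrank {E : ConjBundle ℂ X} {φ : SymForm E} (L : Lagrangian φ) (x : X) :
    2 * Module.finrank ℂ (L.bundle.Fib x) = Module.finrank ℂ (E.Fib x) := by
  have hE := E.finite x
  have h : (φ.form x).orthogonal (LinearMap.range (L.incl x)) = LinearMap.range (L.incl x) := by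
    ext v
    rw [L.mem_range_iff, LinearMap.BilinForm.mem_orthogonal_iff]
    exact forall₂_congr fun w hw => by rw [φ.form_symm]
  have h1 := LinearMap.BilinForm.finrank_add_finrank_orthogonal' (B := φ.form x)
    (LinearMap.range (L.incl x))
  rw [h, LinearMap.ker_eq_bot.2 (φ.bijective_form x).1, inf_bot_eq, finrank_bot, add_zero,
    LinearMap.finrank_range_of_inj (L.incl_injective x)] at h1
  rw [two_mul, h1]

/-- The real bundle underlying a Lagrangian of `ℂ ⊗ F` is isomorphic to `F`. -/
theorem Lagrangian.nonempty_iso {E : ConjBundle ℂ X} {φ : SymForm E} (L : Lagrangian φ)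
    {F : ConjBundle ℝ X} {θ : InvariantMetric F} (f : Isometry φ θ.toSymForm.complexify) :
    Nonempty (ConjBundle.Iso L.bundle.realify F) := by
  have hF := F.finite
  refine nonempty_iso_of_form_nonneg θ
    (fun x => (f.equiv x).toLinearMap.restrictScalars ℝ ∘ₗ (L.incl x).restrictScalars ℝ)
    (f.continuous_toFun.comp L.continuous_incl) (fun x v => ?_) (fun x => ?_)
    (fun x v => ?_) fun x => ?_
  · refine Eq.trans ?_ (f.map_inv x (L.incl x v))
    exact congrArg (f.equiv (tau x)) (L.incl_inv x v)
  · exact (f.equiv x).injective.comp (L.incl_injective x)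
  · have h := f.map_form x (L.incl x v) (L.incl x v)
    rw [(L.mem_range_iff x _).1 ⟨v, rfl⟩ _ ⟨v, rfl⟩] at h
    exact (congrArg Complex.re h).ge
  · refine (finrank_real_of_complex (L.bundle.Fib x)).trans ?_
    rw [L.two_mul_finrank, (f.equiv x).finrank_eq, Module.finrank_baseChange]

/-- The summand `E` of `H(E)` is a Lagrangian. -/
def hyperbolicLagrangian (E : ConjBundle ℂ X) : Lagrangian (SymForm.hyperbolic E) where
  bundle := E
  incl x := LinearMap.inl ℂ (E.Fib x) (Module.Dual ℂ (E.Fib x))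
  continuous_incl := VecBundle.continuous_of_coef_id (F := (E.prod E.dual).toVecBundle)
    (fun x => LinearMap.inl ℂ (E.Fib x) (Module.Dual ℂ (E.Fib x))) fun x => by
      obtain ⟨e, he⟩ := E.exists_cframe x
      refine ⟨e, VecBundle.prodFrame e (VecBundle.dualFrame e), he, ⟨he, he⟩, ?_⟩
      rintro (k | k) l
      · exact (e.2.compat e.2 k l).mono fun y hy => ⟨hy.1, hy.1⟩
      · exact (continuousOn_const (c := (0 : ℂ))).congr fun y hy => by simp
  incl_inv x v := Prod.ext rfl (map_zero (E.dualInv x)).symm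
  incl_injective x := LinearMap.inl_injective
  mem_range_iff x v := by
    constructor
    · rintro ⟨v, rfl⟩ _ ⟨w, rfl⟩
      simp
    · intro h
      refine ⟨v.1, Prod.ext rfl (LinearMap.ext fun w => ?_)⟩
      have := h (w, 0) ⟨w, rfl⟩
      simp only [LinearMap.mk₂_apply, LinearMap.zero_apply, add_zero] at this
      exact this.symm

/-- The metric induced by an isomorphism of bundles. -/
def InvariantMetric.pullback {F F' : ConjBundle ℝ X} (θ : InvariantMetric F')
    (f : ConjBundle.Iso F F') : InvariantMetric F :=
  .ofMetric (fun x => (θ.form x).compl₁₂ (f.equiv x).toLinearMap (f.equiv x).toLinearMap)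
    (fun x => ⟨fun u v => θ.form_symm x _ _, fun v hv =>
      θ.form_pos x _ ((f.equiv x).map_ne_zero_iff.2 hv)⟩)
    (θ.contForm.comp (t := fun x => x) (fun x => (f.equiv x).toLinearMap) f.continuous_toFun)
    fun x v w => by
      have h := θ.form_inv_inv x (f.equiv x v) (f.equiv x w)
      rw [conj_trivial, ← f.map_inv, ← f.map_inv] at h
      exact h

/-- Isomorphic equivariant bundles are isometric, for all metrics on them. -/
theorem nonempty_isometry_of_iso {F F' : ConjBundle ℝ X} (θ : InvariantMetric F)
    (θ' : InvariantMetric F') (f : ConjBundle.Iso F F') :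
    Nonempty (Isometry θ.toSymForm θ'.toSymForm) := by
  obtain ⟨g⟩ := nonempty_isometry_of_invariantMetric (θ'.pullback f) θ
  exact ⟨g.trans { toIso := f, map_form := fun _ _ _ => rfl }⟩

/-- A form with a Lagrangian is isometric to the hyperbolic form: both are complexifications of
metrics, and the two equivariant bundles are both isomorphic to the bundle underlying the
Lagrangian. -/
theorem Lagrangian.nonempty_isometry [T2Space X] [CWComplex (univ : Set X)] {E : ConjBundle ℂ X}
    {φ : SymForm E} (L : Lagrangian φ) : Nonempty (Isometry φ (SymForm.hyperbolic L.bundle)) := by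
  obtain ⟨R⟩ := nonempty_realStructure φ
  obtain ⟨S⟩ := nonempty_realStructure (SymForm.hyperbolic L.bundle)
  obtain ⟨f⟩ := L.nonempty_iso R.isometry.symm
  obtain ⟨g⟩ := (hyperbolicLagrangian L.bundle).nonempty_iso S.isometry.symm
  obtain ⟨h⟩ := nonempty_isometry_of_iso R.metric S.metric (f.symm.trans g)
  exact ⟨(R.isometry.symm.trans h.complexifyCongr).trans S.isometry⟩

/-- The form `H(L)` is the complexification of any metric on the equivariant bundle underlying
`L`. -/
theorem nonempty_isometry_hyperbolic [T2Space X] [CWComplex (univ : Set X)] (L : ConjBundle ℂ X)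
    (θ : InvariantMetric L.realify) :
    Nonempty (Isometry (SymForm.hyperbolic L) θ.toSymForm.complexify) := by
  obtain ⟨S⟩ := nonempty_realStructure (SymForm.hyperbolic L)
  obtain ⟨g⟩ := (hyperbolicLagrangian L).nonempty_iso S.isometry.symm
  obtain ⟨h⟩ := nonempty_isometry_of_iso S.metric θ g.symm
  exact ⟨S.isometry.symm.trans h.complexifyCongr⟩

end Comparison

/-! ### Sums and products of metrics, and their complexifications -/

section Operations

variable {X : Type u} [TopologicalSpace X] [Involution X]

/-- The orthogonal sum of invariant metrics. -/
def InvariantMetric.prod {E F : ConjBundle ℝ X} (θ : InvariantMetric E) (η : InvariantMetric F) :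
    InvariantMetric (E.prod F) where
  toSymForm := θ.toSymForm.prod η.toSymForm
  form_pos x v hv := by
    change 0 < θ.form x v.1 v.1 + η.form x v.2 v.2
    by_cases h : v.1 = 0
    · have h2 : v.2 ≠ 0 := fun h2 => hv (Prod.ext h h2)
      have := η.form_pos x _ h2
      simpa [h] using this
    · have h1 := θ.form_pos x _ h
      by_cases h2 : v.2 = 0
      · simpa [h2] using h1
      · exact add_pos h1 (η.form_pos x _ h2)

/-- In an orthonormal basis `b` of `V`, the square of `∑ b i ⊗ w i` is the sum of the squares of
the `w i`. -/
lemma IsMetric.tmul_pos {V W : Type} [AddCommGroup V] [Module ℝ V] [Module.Finite ℝ V]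
    [AddCommGroup W] [Module ℝ W] {b : LinearMap.BilinForm ℝ V} {c : LinearMap.BilinForm ℝ W}
    (hb : IsMetric b) (hc : IsMetric c) {t : V ⊗[ℝ] W} (ht : t ≠ 0) :
    0 < LinearMap.BilinForm.tmul b c t t := by
  obtain ⟨n, e, -, he, -⟩ := hb.exists_eigenbasis (B := LinearMap.id) fun _ _ => rfl
  obtain ⟨w, rfl⟩ : ∃ w : Fin n → W, ∑ i, e i ⊗ₜ w i = t := by
    clear ht
    induction t using TensorProduct.induction_on with
    | zero => exact ⟨0, by simp⟩
    | add s t hs ht =>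
      obtain ⟨v, rfl⟩ := hs
      obtain ⟨w, rfl⟩ := ht
      exact ⟨v + w, by simp [TensorProduct.tmul_add, Finset.sum_add_distrib]⟩
    | tmul v w =>
      refine ⟨fun i => e.repr v i • w, ?_⟩
      simp only [← TensorProduct.smul_tmul, ← TensorProduct.sum_tmul, e.sum_repr]
  have h : LinearMap.BilinForm.tmul b c (∑ i, e i ⊗ₜ w i) (∑ i, e i ⊗ₜ w i) =
      ∑ i, c (w i) (w i) := by
    simp [map_sum, LinearMap.sum_apply, he]
  rw [h]
  obtain ⟨i, hi⟩ : ∃ i, w i ≠ 0 := by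
    by_contra! h
    simp [h] at ht
  refine Finset.sum_pos' (fun j _ => ?_) ⟨i, Finset.mem_univ i, hc.2 _ hi⟩
  by_cases hj : w j = 0
  · simp [hj]
  · exact (hc.2 _ hj).le

/-- The tensor product of invariant metrics. -/
def InvariantMetric.tensor {E F : ConjBundle ℝ X} (θ : InvariantMetric E) (η : InvariantMetric F) :
    InvariantMetric (E.tensor F) where
  toSymForm := θ.toSymForm.tensor η.toSymForm
  form_pos x v hv := by
    have := E.finite x
    exact (θ.isMetric x).tmul_pos (η.isMetric x) hv

/-- Complexification of forms is compatible with orthogonal sums. -/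
def Isometry.complexifyProd {E F : ConjBundle ℝ X} (φ : SymForm E) (ψ : SymForm F) :
    Isometry (φ.prod ψ).complexify (φ.complexify.prod ψ.complexify) where
  toIso := .complexifyProd E F
  map_form x u v := by
    induction u using TensorProduct.induction_on with
    | zero => simp only [map_zero, LinearMap.zero_apply]
    | add a b ha hb => simp only [map_add, LinearMap.add_apply, ha, hb]
    | tmul a b =>
      induction v using TensorProduct.induction_on with
      | zero => simp only [map_zero]
      | add a b ha hb => simp only [map_add, ha, hb]
      | tmul c d => exact (add_smul (φ.form x b.1 d.1) (ψ.form x b.2 d.2) (a * c)).symm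

/-- The isomorphism `ℂ ⊗ (E ⊗ F) ≅ (ℂ ⊗ E) ⊗ (ℂ ⊗ F)`. -/
def ConjBundle.Iso.complexifyTensor (E F : ConjBundle ℝ X) :
    Iso (E.tensor F).complexify (E.complexify.tensor F.complexify) :=
  .ofContinuous (E := (E.tensor F).complexify) (F := E.complexify.tensor F.complexify)
    (fun x => TensorProduct.AlgebraTensorModule.distribBaseChange ℝ ℂ (E.Fib x) (F.Fib x))
    (VecBundle.continuous_of_coef_id (E := (E.tensor F).complexify.toVecBundle)
      (F := (E.complexify.tensor F.complexify).toVecBundle)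
      (fun x => (TensorProduct.AlgebraTensorModule.distribBaseChange ℝ ℂ
        (E.Fib x) (F.Fib x)).toLinearMap) fun x => by
      obtain ⟨e, he⟩ := E.exists_cframe x
      obtain ⟨f, hf⟩ := F.exists_cframe x
      refine ⟨VecBundle.complexifyFrame (VecBundle.tensorFrame e f),
        VecBundle.tensorFrame (VecBundle.complexifyFrame e) (VecBundle.complexifyFrame f),
        ⟨he, hf⟩, ⟨he, hf⟩, fun k l => ?_⟩
      have hec := Complex.continuous_ofReal.comp_continuousOn (e.2.compat e.2 k.1 l.1)
      have hfc := Complex.continuous_ofReal.comp_continuousOn (f.2.compat f.2 k.2 l.2)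
      refine ((hec.mono fun y hy => ⟨hy.1.1, hy.1.1⟩).mul
        (hfc.mono fun y hy => ⟨hy.1.2, hy.1.2⟩)).congr fun y hy => ?_
      simp)
    (fun x v => by
      induction v using TensorProduct.induction_on with
      | zero => simp only [map_zero]
      | add a b ha hb => simp only [map_add, ha, hb]
      | tmul c t =>
        induction t using TensorProduct.induction_on with
        | zero => simp only [TensorProduct.tmul_zero, map_zero]
        | add a b ha hb => simp only [TensorProduct.tmul_add, map_add, ha, hb]
        | tmul v w =>
          exact congrArg (fun d : ℂ => (starRingEnd ℂ c ⊗ₜ[ℝ] E.inv x v) ⊗ₜ[ℂ] (d ⊗ₜ[ℝ] F.inv x w))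
            (map_one (starRingEnd ℂ)).symm)

/-- Complexification of forms is compatible with tensor products. -/
def Isometry.complexifyTensor {E F : ConjBundle ℝ X} (φ : SymForm E) (ψ : SymForm F) :
    Isometry (φ.tensor ψ).complexify (φ.complexify.tensor ψ.complexify) where
  toIso := .complexifyTensor E F
  map_form x u v := by
    have h : LinearMap.compl₁₂ ((φ.complexify.tensor ψ.complexify).form x)
        ((ConjBundle.Iso.complexifyTensor E F).equiv x).toLinearMap
        ((ConjBundle.Iso.complexifyTensor E F).equiv x).toLinearMap =
        (φ.tensor ψ).complexify.form x := by
      ext a b c d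
      change ((ψ.form x b d • ((1 : ℂ) * 1)) • (φ.form x a c • ((1 : ℂ) * 1)) : ℂ) =
        (ψ.form x b d * φ.form x a c) • ((1 : ℂ) * 1)
      simp
    exact LinearMap.congr_fun₂ h u v

end Operations

/-! ### The isomorphism of semirings, and of Grothendieck rings -/

section Classes

open Algebra (GrothendieckAddGroup)

section Grothendieck

variable {S T : Type*} [CommSemiring S] [CommSemiring T]

lemma grothendieck_of_mul (s t : S) : (GrothendieckAddGroup.of s * GrothendieckAddGroup.of t :
    GrothendieckAddGroup S) = GrothendieckAddGroup.of (s * t) :=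
  grothendieckMul_of s t

/-- Functoriality of the Grothendieck group. -/
def grothendieckMap (f : S →+ T) : GrothendieckAddGroup S →+ GrothendieckAddGroup T :=
  GrothendieckAddGroup.lift (GrothendieckAddGroup.of.comp f)

lemma grothendieckMap_of (f : S →+ T) (s : S) :
    grothendieckMap f (GrothendieckAddGroup.of s) = GrothendieckAddGroup.of (f s) :=
  grothendieck_lift_of _ s

lemma grothendieckMap_grothendieckMap {f : S →+ T} {g : T →+ S} (h : ∀ s, g (f s) = s)
    (a : GrothendieckAddGroup S) : grothendieckMap g (grothendieckMap f a) = a :=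
  DFunLike.congr_fun (grothendieck_hom_ext (f := (grothendieckMap g).comp (grothendieckMap f))
    (g := AddMonoidHom.id _) fun s => by
      rw [AddMonoidHom.comp_apply, grothendieckMap_of, grothendieckMap_of, h,
        AddMonoidHom.id_apply]) a

/-- Functoriality of the Grothendieck ring for isomorphisms of semirings. -/
def grothendieckCongr (e : S ≃+* T) : GrothendieckAddGroup S ≃+* GrothendieckAddGroup T where
  toFun := grothendieckMap (e : S →+ T)
  invFun := grothendieckMap (e.symm : T →+ S)
  left_inv := grothendieckMap_grothendieckMap e.symm_apply_apply
  right_inv := grothendieckMap_grothendieckMap e.apply_symm_apply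
  map_add' := map_add _
  map_mul' a b := by
    induction a using grothendieck_induction with
    | h s s' =>
      induction b using grothendieck_induction with
      | h t t' =>
        have h : ∀ s : S, (e : S →+ T) s = e s := fun _ => rfl
        simp only [sub_mul, mul_sub, grothendieck_of_mul, map_sub, grothendieckMap_of, h, map_mul]

lemma grothendieckCongr_of (e : S ≃+* T) (s : S) :
    grothendieckCongr e (GrothendieckAddGroup.of s) = GrothendieckAddGroup.of (e s) :=
  grothendieckMap_of _ s

end Grothendieck

variable {X : Type u} [TopologicalSpace X] [Involution X]

variable (X) in
/-- The class of the bundle underlying a symmetric form. -/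
def underlyingClass : GrothendieckAddGroup (FormClass ℂ X) →+ KR X :=
  GrothendieckAddGroup.lift
    { toFun := Quotient.lift (fun E => E.bundle.cls) fun _ _ ⟨f⟩ => ConjBundle.cls_congr f.toIso
      map_zero' := map_zero (GrothendieckAddGroup.of (M := BundleClass ℂ X))
      map_add' := by
        rintro ⟨E⟩ ⟨F⟩
        exact ConjBundle.cls_prod E.bundle F.bundle }

lemma underlyingClass_preCls {E : ConjBundle ℂ X} (φ : SymForm E) :
    underlyingClass X φ.preCls = E.cls :=
  grothendieck_lift_of _ _

variable [T2Space X] [CWComplex (univ : Set X)]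

/-- The isometry class of the complexification of a metric on a bundle. The metric is chosen, but the
class does not depend on it, see `complexifyClass_mk`. -/
def complexifyClass : BundleClass ℝ X → FormClass ℂ X :=
  Quotient.lift
    (fun F => FormClass.mk (Classical.choice (exists_invariantMetric F)).toSymForm.complexify)
    fun _ _ ⟨f⟩ => by
      obtain ⟨g⟩ := nonempty_isometry_of_iso _ _ f
      exact Quotient.sound ⟨g.complexifyCongr⟩

lemma complexifyClass_mk {F : ConjBundle ℝ X} (θ : InvariantMetric F) :
    complexifyClass (BundleClass.mk F) = FormClass.mk θ.toSymForm.complexify := by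
  obtain ⟨g⟩ := nonempty_isometry_of_invariantMetric θ (Classical.choice (exists_invariantMetric F))
  exact Quotient.sound ⟨g.complexifyCongr⟩

/-- Injectivity holds because the bundle can be recovered from the isometry class of the complexified
metric, surjectivity because every Real symmetric form has a real structure. -/
lemma complexifyClass_bijective : Function.Bijective (complexifyClass (X := X)) := by
  constructor
  · rintro ⟨E⟩ ⟨F⟩ h
    obtain ⟨f⟩ := Quotient.exact h
    exact Quotient.sound f.nonempty_iso
  · rintro ⟨E, φ⟩
    obtain ⟨R⟩ := nonempty_realStructure φ
    exact ⟨BundleClass.mk R.fixBundle,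
      (complexifyClass_mk R.metric).trans (Quotient.sound ⟨R.isometry⟩)⟩

variable (X) in
/-- Equivariant real bundles up to isomorphism are the same as Real symmetric forms up to
isometry. -/
def complexifyClassEquiv : BundleClass ℝ X ≃+* FormClass ℂ X where
  __ := Equiv.ofBijective complexifyClass complexifyClass_bijective
  map_add' := by
    rintro ⟨E⟩ ⟨F⟩
    obtain ⟨θ⟩ := exists_invariantMetric E
    obtain ⟨η⟩ := exists_invariantMetric F
    refine (complexifyClass_mk (θ.prod η)).trans ?_
    refine Eq.trans ?_ (congrArg₂ (· + ·) (complexifyClass_mk θ) (complexifyClass_mk η)).symm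
    exact Quotient.sound ⟨.complexifyProd θ.toSymForm η.toSymForm⟩
  map_mul' := by
    rintro ⟨E⟩ ⟨F⟩
    obtain ⟨θ⟩ := exists_invariantMetric E
    obtain ⟨η⟩ := exists_invariantMetric F
    refine (complexifyClass_mk (θ.tensor η)).trans ?_
    refine Eq.trans ?_ (congrArg₂ (· * ·) (complexifyClass_mk θ) (complexifyClass_mk η)).symm
    exact Quotient.sound ⟨.complexifyTensor θ.toSymForm η.toSymForm⟩

/-- A form with a Lagrangian is isometric to the hyperbolic form, so that the relation is trivial. -/
lemma eq_zero_of_mem_lagrangianRelations {a : GrothendieckAddGroup (FormClass ℂ X)}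
    (ha : a ∈ lagrangianRelations X) : a = 0 := by
  obtain ⟨E, φ, L, rfl⟩ := ha
  exact sub_eq_zero.2 (congrArg _ (Quotient.sound L.nonempty_isometry))

variable (X) in
lemma span_lagrangianRelations : Ideal.span (lagrangianRelations X) = ⊥ :=
  Ideal.span_eq_bot.2 fun _ => eq_zero_of_mem_lagrangianRelations

variable (X) in
/-- The projection to the Grothendieck-Witt ring is bijective, since the Lagrangian relations hold
already for isometry classes. -/
def toGR : GrothendieckAddGroup (FormClass ℂ X) ≃+* GR X :=
  RingEquiv.ofBijective (Ideal.Quotient.mk (Ideal.span (lagrangianRelations X)))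
    ⟨by
      rw [RingHom.injective_iff_ker_eq_bot, Ideal.mk_ker, span_lagrangianRelations],
      Ideal.Quotient.mk_surjective⟩

end Classes

end

end RealK

/-- For every Real space `X` (a CW complex with a continuous involution), the assignment
`[F] ↦ [ℂ ⊗ F, θ_ℂ]`, where `θ` is any invariant metric on the equivariant real bundle `F`, is a
ring isomorphism `ψ : KO_G(X) → GR(X)`. The forgetful map `[E, φ] ↦ [E]` from `GR(X)` to `KR(X)`
composed with `ψ` is complexification, and the hyperbolic map `KR(X) → GR(X)` is the composite
of `ψ` with the map taking a Real bundle to its underlying equivariant real bundle. It is included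
that invariant metrics exist and that the ideal defining the ring `GR(X)` is just the subgroup
generated by the relations `[E, φ] = [H(L)]`. -/
theorem mainTheorem11 {X : Type*} [TopologicalSpace X] [T2Space X]
    [Topology.CWComplex (Set.univ : Set X)] [RealK.Involution X] :
    (∀ F : RealK.ConjBundle ℝ X, Nonempty (RealK.InvariantMetric F)) ∧
    (AddSubgroup.closure (RealK.lagrangianRelations X) =
      (Ideal.span (RealK.lagrangianRelations X)).toAddSubgroup) ∧
    ∃ (ψ : RealK.KOG X ≃+* RealK.GR X) (forget : RealK.GR X →+ RealK.KR X),
      (∀ (F : RealK.ConjBundle ℝ X) (θ : RealK.InvariantMetric F),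
        ψ F.cls = θ.toSymForm.complexify.cls) ∧
      (∀ (E : RealK.ConjBundle ℂ X) (φ : RealK.SymForm E), forget φ.cls = E.cls) ∧
      (∀ a : RealK.KOG X, forget (ψ a) = RealK.complexification a) ∧
      (∀ b : RealK.KR X, RealK.hyperbolicMap b = ψ (RealK.realification b)) := by
  let ψ : RealK.KOG X ≃+* RealK.GR X :=
    (RealK.grothendieckCongr (RealK.complexifyClassEquiv X)).trans (RealK.toGR X)
  let forget : RealK.GR X →+ RealK.KR X :=
    (RealK.underlyingClass X).comp ((RealK.toGR X).symm : RealK.GR X →+ _)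
  have hψ : ∀ (F : RealK.ConjBundle ℝ X) (θ : RealK.InvariantMetric F),
      ψ F.cls = θ.toSymForm.complexify.cls := fun F θ =>
    congrArg (RealK.toGR X) ((RealK.grothendieckCongr_of _ _).trans
      (congrArg Algebra.GrothendieckAddGroup.of (RealK.complexifyClass_mk θ)))
  have hforget : ∀ (E : RealK.ConjBundle ℂ X) (φ : RealK.SymForm E), forget φ.cls = E.cls :=
    fun E φ => (congrArg (RealK.underlyingClass X)
      ((RealK.toGR X).symm_apply_apply φ.preCls)).trans (RealK.underlyingClass_preCls φ)
  refine ⟨RealK.exists_invariantMetric, ?_, ψ, forget, hψ, hforget, fun a => ?_, fun b => ?_⟩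
  · have h : AddSubgroup.closure (RealK.lagrangianRelations X) = ⊥ :=
      AddSubgroup.closure_eq_bot_iff.2 fun _ => RealK.eq_zero_of_mem_lagrangianRelations
    rw [h, RealK.span_lagrangianRelations]
    rfl
  · refine DFunLike.congr_fun (RealK.grothendieck_hom_ext
      (f := forget.comp (ψ : RealK.KOG X →+ RealK.GR X)) (g := RealK.complexification) ?_) a
    rintro ⟨F⟩
    obtain ⟨θ⟩ := RealK.exists_invariantMetric F
    exact ((congrArg forget (hψ F θ)).trans (hforget _ _)).trans
      (RealK.complexification_cls F).symm
  · refine DFunLike.congr_fun (RealK.grothendieck_hom_ext (f := RealK.hyperbolicMap)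
      (g := (ψ : RealK.KOG X →+ RealK.GR X).comp RealK.realification) ?_) b
    rintro ⟨L⟩
    obtain ⟨θ⟩ := RealK.exists_invariantMetric L.realify
    obtain ⟨f⟩ := RealK.nonempty_isometry_hyperbolic L θ
    refine (RealK.hyperbolicMap_cls L).trans ((RealK.SymForm.cls_congr f).trans ?_)
    exact ((congrArg ψ (RealK.realification_cls L)).trans (hψ _ θ)).symm
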